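/- **Setting.** For $w\in\mathbb R^3$ let $w^\times$ be the matrix of $z\mapsto w\times z$, for a unit vector $u$ let $\pi_u=I_3-uu^\top$, and let $e_3=(0,0,1)^\top$; $\|\cdot\|$ is the Euclidean norm. Two rigid bodies, a vehicle ($B$) and a target ($T$), move for $t\ge 0$ according to $$\dot Q_i=Q_i\omega_i^\times,\qquad \dot p_i=v_i,\qquad \dot v_i=Q_ia_i+g e_3,\qquad Q_i\in SO(3),\quad i\in\{B,T\},$$ with $p_B(t)\ne p_T(t)$ for all $t\ge0$. Put $R=Q_T^\top Q_B$, $\xi=Q_B^\top(p_B-p_T)$, $y_\xi=\xi/\|\xi\|$, $y_\xi^{\mathcal I}=Q_By_\xi$, $\eta_{\mathcal I}=Q_Te_3$, $a_T^{\mathcal I}=Q_Ta_T$, $b=a_T^{\mathcal I}\times\eta_{\mathcal I}$. For an attitude estimate $\hat R\in SO(3)$ put $$A_\theta=\begin{bmatrix}-\omega_B^\times&I_3&0\\0&-\omega_B^\times&\hat R^\top a_T^\times e_3\\0&0&0\end{bmatrix}\in\mathbb R^{7\times7},\qquad C_\theta=\begin{bmatrix}\pi_{y_\xi}&0_{3,4}\end{bmatrix}.$$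 Let $S(t)\in\mathbb R^{7\times 7}$, $D(t)\in\mathbb R^{3\times3}$ be continuous, symmetric, bounded and uniformly positive definite on $[0,\infty)$. The error system with state $x_\theta=(\tilde\xi,\tilde v,\tilde\theta)\in\mathbb R^7$ is, with $\hat R=\exp(\tilde\theta e_3^\times)R$ in $A_\theta$, $$\dot x_\theta=A_\theta x_\theta-PC_\theta^\top D\,C_\theta x_\theta+\rho(t,x_\theta),\qquad \dot P=A_\theta P+PA_\theta^\top-PC_\theta^\top DC_\theta P+S,\qquad(\ast)$$ with $P$ initialized at a symmetric positive definite matrix and $\rho=O(|\tilde\theta|^2)$ as $x_\theta\to0$, uniformly in $t$ ($\rho$ continuous, and Lipschitz in $x_\theta$ on bounded sets, uniformly for $t$ in bounded intervals). It includes the unexpanded dynamics, in which $\dot{\tilde\xi}=-\omega_B^\times\tilde\xi+\tilde v-\sigma_\xi$, $\dot{\tilde v}=-\omega_B^\times\tilde v-\sigma_v+\hat R^\top(I_3-\exp(\tilde\theta e_3^\times))a_T$, $\dot{\tilde\theta}=-\sigma_\theta$, where $(\sigma_\xi,\sigma_v,\sigma_\theta)=PC_\theta^\top DC_\theta x_\theta$.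 **Lemma.** Assume that $\omega_B,\omega_T$ are bounded and uniformly continuous, that $a_T$ is bounded and continuous, and that there are $\delta,\mu>0$ such that for all $t\ge0$ $$\frac1\delta\int_t^{t+\delta}\pi_{y_\xi^{\mathcal I}(s)}\,ds\succeq\mu I_3 .$$ Assume that $b(t)=b_0+b_1(t)$ for all $t\ge 0$, with a constant vector $b_0\neq0$ and, for all $t\ge0$, $$\frac1\delta\int_t^{t+\delta}\big\|\pi_{y_\xi^{\mathcal I}(s)}\,b_1(t)\big\|^2ds\le\frac\mu4\|b_0\|^2 .$$ Then: 1. The pair $(A_\theta,C_\theta)$ is uniformly observable, locally around $\hat R=R$: there are $\varepsilon,\delta',\mu'>0$ such that for every continuous $\hat R:[0,\infty)\to SO(3)$ whose entries differ from those of $R$ by at most $\varepsilon$ at all times (in particular for $\hat R=R$), and for all $t\ge0$, $$\frac1{\delta'}\int_t^{t+\delta'}\Phi(s,t)^\top C_\theta(s)^\top C_\theta(s)\Phi(s,t)\,ds\succeq\mu' I_7,$$ where $\partial_s\Phi(s,t)=A_\theta(s)\Phi(s,t)$, $\Phi(t,t)=I_7$. 2. For every such $\rho$, and for the unexpanded dynamics,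 the equilibrium $(\tilde\xi,\tilde v,\tilde\theta)=0$ of $(\ast)$ is locally exponentially stable: for all $p_1,p_2>0$ there are $r,k,\lambda>0$ such that for all $t_0\ge0$, all $\|x_0\|<r$ and all $p_1I_7\preceq P_0\preceq p_2I_7$, there is a solution $(x_\theta,P)$ on $[t_0,\infty)$ with $(x_\theta,P)(t_0)=(x_0,P_0)$ and $P$ positive definite, and every solution on an interval $[t_0,T)$ with these initial values satisfies $\|x_\theta(t)\|\le k e^{-\lambda(t-t_0)}\|x_0\|$ there. -/

import Mathlib

open scoped Matrix

/-- Vectors of `ℝ³` and `3 × 3` real matrices. -/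
abbrev V3 : Type := Fin 3 → ℝ

abbrev M3 : Type := Matrix (Fin 3) (Fin 3) ℝ

/-- Index type of the seven-dimensional error state `(ξ̃, ṽ, θ̃)`. -/
abbrev Idx7 : Type := (Fin 3 ⊕ Fin 3) ⊕ Fin 1

abbrev V7 : Type := Idx7 → ℝ

abbrev M7 : Type := Matrix Idx7 Idx7 ℝ

noncomputable section

/-- The Euclidean norm (the norm that Mathlib puts on `ι → ℝ` is the sup norm). -/
def eucl {ι : Type} [Fintype ι] (w : ι → ℝ) : ℝ := ‖WithLp.toLp 2 w‖

def e3 : V3 := ![0, 0, 1]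

/-- The matrix `w^×` of the map `z ↦ w × z`. -/
def skew (w : V3) : M3 := !![0, -w 2, w 1; w 2, 0, -w 0; -w 1, w 0, 0]

/-- The projection `π_u = I₃ - u uᵀ`. -/
def proj (u : V3) : M3 := 1 - Matrix.vecMulVec u u

/-- The rotation `exp(θ u^×)` about the unit vector `u`, by Rodrigues' formula. -/
def rodrigues (θ : ℝ) (u : V3) : M3 :=
  1 + Real.sin θ • skew u + (1 - Real.cos θ) • (skew u * skew u)

/-- Derivative of a matrix-valued function, entry by entry. -/
def MatHasDerivWithinAt {m n : Type} (M : ℝ → Matrix m n ℝ) (M' : Matrix m n ℝ)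
    (J : Set ℝ) (t : ℝ) : Prop :=
  ∀ i j, HasDerivWithinAt (fun s => M s i j) (M' i j) J t

/-- Integral over `[a, b]` of a matrix-valued function, entry by entry. -/
def matIntegral {m n : Type} (M : ℝ → Matrix m n ℝ) (a b : ℝ) : Matrix m n ℝ :=
  Matrix.of fun i j => ∫ s in a..b, M s i j

/-- `M ⪰ N` for symmetric matrices. -/
def Succeq {n : Type} (M N : Matrix n n ℝ) : Prop := (M - N).PosSemidef

/-! ### Linear time-varying systems -/

/-- `Φ s t` is the state transition matrix of `A` from time `t` to time `s`, `0 ≤ t ≤ s`. -/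
def IsTransitionMatrix {n : Type} [Fintype n] [DecidableEq n]
    (A : ℝ → Matrix n n ℝ) (Φ : ℝ → ℝ → Matrix n n ℝ) : Prop :=
  ∀ t, 0 ≤ t → Φ t t = 1 ∧
    ∀ s, t ≤ s → MatHasDerivWithinAt (fun r => Φ r t) (A s * Φ s t) (Set.Ici t) s

/-- The observability Gramian `W(t, t + δ)`. -/
def gramian {m n : Type} [Fintype m] [Fintype n]
    (Φ : ℝ → ℝ → Matrix n n ℝ) (C : ℝ → Matrix m n ℝ) (t δ : ℝ) : Matrix n n ℝ :=
  (1 / δ) • matIntegral (fun s => (Φ s t)ᵀ * (C s)ᵀ * C s * Φ s t) t (t + δ)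

/-- The pair `(A, C)` is uniformly observable, with the constants `δ, μ`. -/
def UniformlyObservableWith {m n : Type} [Fintype m] [Fintype n] [DecidableEq n]
    (A : ℝ → Matrix n n ℝ) (C : ℝ → Matrix m n ℝ) (δ μ : ℝ) : Prop :=
  0 < δ ∧ 0 < μ ∧ ∃ Φ, IsTransitionMatrix A Φ ∧
    ∀ t, 0 ≤ t → Succeq (gramian Φ C t δ) (μ • 1)

/-! ### Rigid motions and measurements -/

/-- Motion for `t ≥ 0` of a rigid body with attitude `Q`, position `p`, velocity `v`, angular
velocity `ω` (body frame) and specific acceleration `a` (body frame), under gravity `g e₃`. -/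
structure IsRigidMotion (g : ℝ) (Q : ℝ → M3) (p v ω a : ℝ → V3) : Prop where
  rot : ∀ t, 0 ≤ t → Q t ∈ Matrix.specialOrthogonalGroup (Fin 3) ℝ
  att : ∀ t, 0 ≤ t → MatHasDerivWithinAt Q (Q t * skew (ω t)) (Set.Ici 0) t
  pos : ∀ t, 0 ≤ t → HasDerivWithinAt p (v t) (Set.Ici 0) t
  vel : ∀ t, 0 ≤ t → HasDerivWithinAt v (Q t *ᵥ a t + g • e3) (Set.Ici 0) t

/-- Bounded and uniformly continuous on `[0, ∞)`. -/
def BddUnifCont (f : ℝ → V3) : Prop :=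
  UniformContinuousOn f (Set.Ici 0) ∧ ∃ c, ∀ t, 0 ≤ t → eucl (f t) ≤ c

/-- The relative position `ξ = Q_Bᵀ (p_B - p_T)` in the body frame. -/
def relPos (QB : ℝ → M3) (pB pT : ℝ → V3) (t : ℝ) : V3 := (QB t)ᵀ *ᵥ (pB t - pT t)

/-- The bearing `y_ξ = ξ / |ξ|`. -/
def bearing (QB : ℝ → M3) (pB pT : ℝ → V3) (t : ℝ) : V3 :=
  (eucl (relPos QB pB pT t))⁻¹ • relPos QB pB pT t

/-- The bearing in the inertial frame, `Q_B y_ξ`. -/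
def bearingI (QB : ℝ → M3) (pB pT : ℝ → V3) (t : ℝ) : V3 := QB t *ᵥ bearing QB pB pT t

/-- The relative attitude `R = Q_Tᵀ Q_B`. -/
def relAtt (QB QT : ℝ → M3) (t : ℝ) : M3 := (QT t)ᵀ * QB t

/-- `b = a_T^I × η_I`, with `a_T^I = Q_T a_T` and `η_I = Q_T e₃`. -/
def bVec (QT : ℝ → M3) (aT : ℝ → V3) (t : ℝ) : V3 := (QT t *ᵥ aT t) ⨯₃ (QT t *ᵥ e3)

/-- Persistent excitation of the direction `y`, with the constants `δ, μ`. -/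
def BearingPE (y : ℝ → V3) (δ μ : ℝ) : Prop :=
  ∀ t, 0 ≤ t → Succeq ((1 / δ) • matIntegral (fun s => proj (y s)) t (t + δ)) (μ • 1)

/-! ### The error system with appended yaw error -/

/-- The block matrix `A_θ`, for the current values of `ω_B`, `R̂` and `a_T`. -/
def Atheta (ω : V3) (Rhat : M3) (a : V3) : M7 :=
  Matrix.fromBlocks
    (Matrix.fromBlocks (-skew ω) 1 0 (-skew ω))
    (Matrix.replicateCol (Fin 1) (Sum.elim 0 (Rhatᵀ *ᵥ (skew a *ᵥ e3))))
    0 0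

/-- The output matrix `C_θ = [π_y  0]`, for the current bearing `y`. -/
def Ctheta (y : V3) : Matrix (Fin 3) Idx7 ℝ :=
  Matrix.fromCols (Matrix.fromCols (proj y) 0) 0

/-- The components `ξ̃`, `ṽ`, `θ̃` of the state. -/
def posErr (x : V7) : V3 := fun i => x (Sum.inl (Sum.inl i))

def velErr (x : V7) : V3 := fun i => x (Sum.inl (Sum.inr i))

def yawErr (x : V7) : ℝ := x (Sum.inr 0)

/-- The attitude estimate `R̂ = R̃ R` for the attitude error `R̃ = exp(θ̃ e₃^×)`. -/
def attEst (R : M3) (x : V7) : M3 := rodrigues (yawErr x) e3 * R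

/-- The innovation `σ = K y`, with `K = P C_θᵀ D` and `y = C_θ x`. -/
def innovation (C : Matrix (Fin 3) Idx7 ℝ) (D : M3) (P : M7) (x : V7) : V7 :=
  (P * Cᵀ * D) *ᵥ (C *ᵥ x)

/-- Right-hand side `A_θ x - σ + ρ` of the error dynamics, with remainder `ρ`. -/
def errField (ωB aT : ℝ → V3) (R : ℝ → M3) (y : ℝ → V3) (D : ℝ → M3) (ρ : ℝ → V7 → V7)
    (t : ℝ) (x : V7) (P : M7) : V7 :=
  Atheta (ωB t) (attEst (R t) x) (aT t) *ᵥ x - innovation (Ctheta (y t)) (D t) P x + ρ t x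

/-- Right-hand side of the error dynamics before expansion in `θ̃`:
`ξ̃' = -ω_B^× ξ̃ + ṽ - σ_ξ`, `ṽ' = -ω_B^× ṽ - σ_v + R̂ᵀ (I₃ - exp(θ̃ e₃^×)) a_T`, `θ̃' = -σ_θ`. -/
def exactErrField (ωB aT : ℝ → V3) (R : ℝ → M3) (y : ℝ → V3) (D : ℝ → M3)
    (t : ℝ) (x : V7) (P : M7) : V7 :=
  Sum.elim
    (Sum.elim
      (-(skew (ωB t) *ᵥ posErr x) + velErr x)
      (-(skew (ωB t) *ᵥ velErr x)
        + (attEst (R t) x)ᵀ *ᵥ ((1 - rodrigues (yawErr x) e3) *ᵥ aT t)))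
    0
  - innovation (Ctheta (y t)) (D t) P x

/-- Right-hand side of the continuous Riccati equation for the pair `(A_θ, C_θ)`. -/
def riccatiField (ωB aT : ℝ → V3) (R : ℝ → M3) (y : ℝ → V3) (S : ℝ → M7) (D : ℝ → M3)
    (t : ℝ) (x : V7) (P : M7) : M7 :=
  let A := Atheta (ωB t) (attEst (R t) x) (aT t)
  let C := Ctheta (y t)
  A * P + P * Aᵀ - P * Cᵀ * D t * C * P + S t

/-- A remainder of order `O(|θ̃|²)` near the origin, uniformly in time; it is regular enough for the
differential equation to be well posed. -/
structure IsQuadraticRemainder (ρ : ℝ → V7 → V7) : Prop where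
  cont : ContinuousOn (fun q : ℝ × V7 => ρ q.1 q.2) (Set.Ici 0 ×ˢ Set.univ)
  lip : ∀ T r : ℝ, ∃ L : ℝ, ∀ t, 0 ≤ t → t ≤ T → ∀ x x' : V7, eucl x ≤ r → eucl x' ≤ r →
    eucl (ρ t x - ρ t x') ≤ L * eucl (x - x')
  quad : ∃ r c : ℝ, 0 < r ∧ ∀ t, 0 ≤ t → ∀ x : V7, eucl x ≤ r →
    eucl (ρ t x) ≤ c * |yawErr x| ^ 2

/-- `(x, P)` solves `x' = f(t, x, P)`, `P' = h(t, x, P)` on `J`. -/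
def IsObserverSolution (f : ℝ → V7 → M7 → V7) (h : ℝ → V7 → M7 → M7) (J : Set ℝ)
    (x : ℝ → V7) (P : ℝ → M7) : Prop :=
  ∀ t ∈ J, HasDerivWithinAt x (f t (x t) (P t)) J t ∧
    MatHasDerivWithinAt P (h t (x t) (P t)) J t

/-- Local exponential stability of `x = 0`, uniformly in the initial time and in the initial value
of the Riccati matrix between two positive multiples of the identity: solutions that start close
to `0` exist for all time, with a positive definite Riccati matrix, and every solution that starts
close to `0`, on whatever interval, decays exponentially. -/
def LocallyExpStable (f : ℝ → V7 → M7 → V7) (h : ℝ → V7 → M7 → M7) : Prop :=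
  ∀ p₁ p₂ : ℝ, 0 < p₁ → 0 < p₂ →
    ∃ r k l : ℝ, 0 < r ∧ 0 < k ∧ 0 < l ∧
      ∀ t₀, 0 ≤ t₀ → ∀ (x₀ : V7) (P₀ : M7), eucl x₀ < r →
        Succeq P₀ (p₁ • 1) → Succeq (p₂ • 1) P₀ →
        (∃ x P, IsObserverSolution f h (Set.Ici t₀) x P ∧ x t₀ = x₀ ∧ P t₀ = P₀ ∧
          ∀ t, t₀ ≤ t → (P t).PosDef) ∧
        ∀ T, t₀ < T → ∀ x P, IsObserverSolution f h (Set.Ico t₀ T) x P →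
          x t₀ = x₀ → P t₀ = P₀ →
          ∀ t ∈ Set.Ico t₀ T, eucl (x t) ≤ k * Real.exp (-l * (t - t₀)) * eucl x₀

/-- Continuous on `[0, ∞)`, symmetric, and between two positive multiples of the identity. -/
def IsWeight {n : Type} [DecidableEq n] (S : ℝ → Matrix n n ℝ) : Prop :=
  ContinuousOn S (Set.Ici 0) ∧ ∃ s₁ s₂ : ℝ, 0 < s₁ ∧ 0 < s₂ ∧
    ∀ t, 0 ≤ t → Succeq (S t) (s₁ • 1) ∧ Succeq (s₂ • 1) (S t)

end

/- In the inertial frame the position error of the linear system is a curve `X` whose acceleration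
is `θ̃` times a vector close to `b`, with `θ̃` constant. Persistent excitation, applied to the
constant vector `b₁(t)`, gives `|b₁(t)| ≤ |b₀| / 2`, so the component of that vector along `b₀`
stays positive, also when `R̂` is only close to `R`. A second difference of `X` over a long time
`h` therefore exhibits `θ̃`, and a first difference then exhibits the velocity. For large `h` the
curve moves little within windows of the fixed length `δ`, compared with its distances from the
origin at three instants `h` apart, so persistent excitation bounds these distances by the output
energy. This is uniform observability.

Steering the adjoint system with the observability Gramian bounds the value function `z ⬝ P z`
from above, and `S` bounds it from below. So `x ⬝ P⁻¹ x` is comparable with `|x|²`; it decays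
exponentially along the linear system, and near `0` the decay dominates the quadratic remainder.
As `R̂` depends on `θ̃`, observability along a solution presupposes that it is small, which the
decay in turn propagates. The unexpanded dynamics differ from the expanded ones by one particular
quadratic remainder. -/

/-! ### The Euclidean norm -/

section Euclidean

variable {ι κ : Type} [Fintype ι] [Fintype κ]

theorem eucl_sq (w : ι → ℝ) : eucl w ^ 2 = w ⬝ᵥ w := by
  rw [eucl, EuclideanSpace.norm_sq_eq]
  simp [dotProduct, sq]

theorem eucl_nonneg (w : ι → ℝ) : 0 ≤ eucl w := norm_nonneg _

@[simp] theorem eucl_zero : eucl (0 : ι → ℝ) = 0 := by simp [eucl]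

theorem eucl_neg (w : ι → ℝ) : eucl (-w) = eucl w := by simp [eucl]

theorem eucl_add_le (v w : ι → ℝ) : eucl (v + w) ≤ eucl v + eucl w := by
  simpa [eucl] using norm_add_le (WithLp.toLp 2 v) (WithLp.toLp 2 w)

theorem eucl_sub_le (v w : ι → ℝ) : eucl (v - w) ≤ eucl v + eucl w := by
  simpa [eucl] using norm_sub_le (WithLp.toLp 2 v) (WithLp.toLp 2 w)

theorem eucl_smul (c : ℝ) (w : ι → ℝ) : eucl (c • w) = |c| * eucl w := by
  simp [eucl, norm_smul]

theorem eucl_pos {w : ι → ℝ} (hw : w ≠ 0) : 0 < eucl w := by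
  simpa [eucl, norm_pos_iff] using hw

theorem abs_dotProduct_le_eucl_mul_eucl (v w : ι → ℝ) : |v ⬝ᵥ w| ≤ eucl v * eucl w := by
  have h := abs_real_inner_le_norm (WithLp.toLp 2 w) (WithLp.toLp 2 v)
  rw [EuclideanSpace.inner_toLp_toLp] at h
  simpa [eucl, mul_comm] using h

theorem dotProduct_le_eucl_mul_eucl (v w : ι → ℝ) : v ⬝ᵥ w ≤ eucl v * eucl w :=
  (le_abs_self _).trans (abs_dotProduct_le_eucl_mul_eucl v w)

theorem abs_apply_le_eucl (w : ι → ℝ) (i : ι) : |w i| ≤ eucl w := by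
  simpa [eucl] using PiLp.norm_apply_le (WithLp.toLp 2 w) i

theorem norm_le_eucl (w : ι → ℝ) : ‖w‖ ≤ eucl w :=
  (pi_norm_le_iff_of_nonneg (eucl_nonneg w)).2 (abs_apply_le_eucl w)

theorem eucl_le_card_mul_norm (w : ι → ℝ) : eucl w ≤ Fintype.card ι * ‖w‖ := by
  refine abs_le_of_sq_le_sq' ?_ (by positivity) |>.2
  calc eucl w ^ 2 = ∑ i, |w i| ^ 2 := by rw [eucl, EuclideanSpace.norm_sq_eq]; simp
    _ ≤ (∑ i, |w i|) ^ 2 := Finset.sum_sq_le_sq_sum_of_nonneg fun i _ => abs_nonneg _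
    _ ≤ (∑ _i : ι, ‖w‖) ^ 2 := by
        gcongr with i
        exact norm_le_pi_norm w i
    _ = (Fintype.card ι * ‖w‖) ^ 2 := by simp

theorem continuous_eucl : Continuous (eucl : (ι → ℝ) → ℝ) :=
  continuous_norm.comp (PiLp.continuous_toLp 2 _)

theorem eucl_sumElim_sq (v : ι → ℝ) (w : κ → ℝ) :
    eucl (Sum.elim v w) ^ 2 = eucl v ^ 2 + eucl w ^ 2 := by
  simp [eucl_sq, dotProduct]

theorem eucl_sumElim_le (v : ι → ℝ) (w : κ → ℝ) :
    eucl (Sum.elim v w) ≤ eucl v + eucl w := by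
  have h := eucl_sumElim_sq v w
  nlinarith [eucl_nonneg v, eucl_nonneg w, eucl_nonneg (Sum.elim v w),
    mul_nonneg (eucl_nonneg v) (eucl_nonneg w)]

end Euclidean

/-! ### Spectral norms and quadratic forms -/

section SpectralNorm

variable {m n : Type} [Fintype m] [Fintype n] [DecidableEq n]

open scoped Matrix.Norms.L2Operator

theorem eucl_mulVec_le (M : Matrix m n ℝ) (z : n → ℝ) : eucl (M *ᵥ z) ≤ ‖M‖ * eucl z :=
  Matrix.l2_opNorm_mulVec M (WithLp.toLp 2 z)

theorem norm_le_of_eucl_mulVec_le {M : Matrix m n ℝ} {c : ℝ} (hc : 0 ≤ c)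
    (h : ∀ z, eucl (M *ᵥ z) ≤ c * eucl z) : ‖M‖ ≤ c := by
  rw [Matrix.l2_opNorm_def]
  exact ContinuousLinearMap.opNorm_le_bound _ hc fun z => h z.ofLp

theorem norm_transpose [DecidableEq m] (M : Matrix m n ℝ) : ‖Mᵀ‖ = ‖M‖ := by
  rw [← Matrix.conjTranspose_eq_transpose_of_trivial, Matrix.l2_opNorm_conjTranspose]

theorem abs_apply_le_norm (M : Matrix m n ℝ) (i : m) (j : n) : |M i j| ≤ ‖M‖ := by
  have h := (abs_apply_le_eucl (M *ᵥ Pi.single j 1) i).trans (eucl_mulVec_le M _)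
  have hone : eucl (Pi.single j 1 : n → ℝ) = 1 := by simp [eucl]
  simpa [hone] using h

theorem abs_dotProduct_mulVec_le (M : Matrix m n ℝ) (v : m → ℝ) (w : n → ℝ) :
    |v ⬝ᵥ (M *ᵥ w)| ≤ ‖M‖ * (eucl v * eucl w) := by
  calc |v ⬝ᵥ (M *ᵥ w)| ≤ eucl v * eucl (M *ᵥ w) := abs_dotProduct_le_eucl_mul_eucl _ _
    _ ≤ eucl v * (‖M‖ * eucl w) := by
        gcongr
        · exact eucl_nonneg v
        · exact eucl_mulVec_le M w
    _ = ‖M‖ * (eucl v * eucl w) := by ring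

end SpectralNorm

section QuadraticForms

variable {n m : Type}

theorem transpose_eq_of_posSemidef {M : Matrix n n ℝ} (h : M.PosSemidef) : Mᵀ = M := by
  simpa [Matrix.conjTranspose_eq_transpose_of_trivial] using h.isHermitian.eq

theorem transpose_eq_of_succeq_smul_one [DecidableEq n] {M : Matrix n n ℝ} {c : ℝ}
    (h : Succeq M (c • 1)) : Mᵀ = M := by
  have := transpose_eq_of_posSemidef h
  rwa [Matrix.transpose_sub, Matrix.transpose_smul, Matrix.transpose_one, sub_left_inj] at this

variable [Fintype n] [Fintype m]

theorem quadForm_nonneg {M : Matrix n n ℝ} (h : M.PosSemidef) (z : n → ℝ) :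
    0 ≤ z ⬝ᵥ (M *ᵥ z) := by
  simpa using h.dotProduct_mulVec_nonneg z

theorem posSemidef_of_quadForm_nonneg {M : Matrix n n ℝ} (hM : Mᵀ = M)
    (h : ∀ z, 0 ≤ z ⬝ᵥ (M *ᵥ z)) : M.PosSemidef :=
  .of_dotProduct_mulVec_nonneg
    (by simpa [Matrix.IsHermitian, Matrix.conjTranspose_eq_transpose_of_trivial] using hM)
    (by simpa using h)

theorem posDef_of_quadForm_pos {M : Matrix n n ℝ} (hM : Mᵀ = M)
    (h : ∀ z, z ≠ 0 → 0 < z ⬝ᵥ (M *ᵥ z)) : M.PosDef :=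
  .of_dotProduct_mulVec_pos
    (by simpa [Matrix.IsHermitian, Matrix.conjTranspose_eq_transpose_of_trivial] using hM)
    (by simpa using h)

theorem dotProduct_mulVec_comm {M : Matrix n n ℝ} (hM : Mᵀ = M) (v w : n → ℝ) :
    v ⬝ᵥ (M *ᵥ w) = w ⬝ᵥ (M *ᵥ v) := by
  nth_rw 1 [← hM]
  rw [Matrix.dotProduct_transpose_mulVec]

theorem two_mul_dotProduct_mulVec_le {G : Matrix n n ℝ} (hG : G.PosSemidef) (v w : n → ℝ) :
    2 * (v ⬝ᵥ (G *ᵥ w)) ≤ v ⬝ᵥ (G *ᵥ v) + w ⬝ᵥ (G *ᵥ w) := by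
  have h := quadForm_nonneg hG (v - w)
  rw [Matrix.mulVec_sub, sub_dotProduct, dotProduct_sub, dotProduct_sub,
    dotProduct_mulVec_comm (transpose_eq_of_posSemidef hG) w v] at h
  linarith

variable [DecidableEq n]

theorem quadForm_smul_one (c : ℝ) (z : n → ℝ) :
    z ⬝ᵥ ((c • (1 : Matrix n n ℝ)) *ᵥ z) = c * eucl z ^ 2 := by
  rw [Matrix.smul_mulVec, Matrix.one_mulVec, dotProduct_smul, eucl_sq, smul_eq_mul]

theorem mul_eucl_sq_le_of_succeq {M : Matrix n n ℝ} {c : ℝ} (h : Succeq M (c • 1)) (z : n → ℝ) :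
    c * eucl z ^ 2 ≤ z ⬝ᵥ (M *ᵥ z) := by
  have := quadForm_nonneg h z
  rwa [Matrix.sub_mulVec, dotProduct_sub, quadForm_smul_one, sub_nonneg] at this

theorem mul_eucl_le_eucl_mulVec {M : Matrix n n ℝ} {c : ℝ} (h : Succeq M (c • 1)) (z : n → ℝ) :
    c * eucl z ≤ eucl (M *ᵥ z) := by
  rcases (eucl_nonneg z).eq_or_lt with hzero | hpos
  · rw [← hzero, mul_zero]
    exact eucl_nonneg _
  · refine le_of_mul_le_mul_left ?_ hpos
    linarith [mul_eucl_sq_le_of_succeq h z, dotProduct_le_eucl_mul_eucl z (M *ᵥ z)]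

theorem quadForm_le_of_succeq {M : Matrix n n ℝ} {c : ℝ} (h : Succeq (c • 1) M) (z : n → ℝ) :
    z ⬝ᵥ (M *ᵥ z) ≤ c * eucl z ^ 2 := by
  have := quadForm_nonneg h z
  rwa [Matrix.sub_mulVec, dotProduct_sub, quadForm_smul_one, sub_nonneg] at this

theorem succeq_smul_one_of_le {M : Matrix n n ℝ} {c : ℝ} (hM : Mᵀ = M)
    (h : ∀ z, c * eucl z ^ 2 ≤ z ⬝ᵥ (M *ᵥ z)) : Succeq M (c • 1) := by
  refine posSemidef_of_quadForm_nonneg (by simp [hM]) fun z => ?_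
  rw [Matrix.sub_mulVec, dotProduct_sub, quadForm_smul_one, sub_nonneg]
  exact h z

theorem smul_one_succeq_of_le {M : Matrix n n ℝ} {c : ℝ} (hM : Mᵀ = M)
    (h : ∀ z, z ⬝ᵥ (M *ᵥ z) ≤ c * eucl z ^ 2) : Succeq (c • 1) M := by
  refine posSemidef_of_quadForm_nonneg (by simp [hM]) fun z => ?_
  rw [Matrix.sub_mulVec, dotProduct_sub, quadForm_smul_one, sub_nonneg]
  exact h z

omit [Fintype n] in
theorem posSemidef_of_succeq_smul_one [Finite n] {M : Matrix n n ℝ} {c : ℝ} (hc : 0 ≤ c)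
    (h : Succeq M (c • 1)) : M.PosSemidef :=
  have := Fintype.ofFinite n
  posSemidef_of_quadForm_nonneg (transpose_eq_of_succeq_smul_one h) fun z =>
    (mul_nonneg hc (sq_nonneg _)).trans (mul_eucl_sq_le_of_succeq h z)

omit [Fintype n] in
theorem posDef_of_succeq_smul_one [Finite n] {M : Matrix n n ℝ} {c : ℝ} (hc : 0 < c)
    (h : Succeq M (c • 1)) : M.PosDef :=
  have := Fintype.ofFinite n
  posDef_of_quadForm_pos (transpose_eq_of_succeq_smul_one h) fun z hz =>
    (mul_pos hc (pow_pos (eucl_pos hz) 2)).trans_le (mul_eucl_sq_le_of_succeq h z)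

theorem eucl_mulVec_sq_le {P : Matrix n n ℝ} {c : ℝ} (hc : 0 < c) (hP : P.PosSemidef)
    (h : Succeq (c • 1) P) (z : n → ℝ) : eucl (P *ᵥ z) ^ 2 ≤ c * (z ⬝ᵥ (P *ᵥ z)) := by
  have hyoung := two_mul_dotProduct_mulVec_le hP (c • z) (P *ᵥ z)
  have hself : z ⬝ᵥ (P *ᵥ (P *ᵥ z)) = eucl (P *ᵥ z) ^ 2 := by
    rw [dotProduct_mulVec_comm (transpose_eq_of_posSemidef hP), eucl_sq]
  simp only [Matrix.mulVec_smul, smul_dotProduct, dotProduct_smul, hself, smul_eq_mul] at hyoung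
  refine le_of_mul_le_mul_left ?_ hc
  linarith [quadForm_le_of_succeq h (P *ᵥ z)]

open scoped Matrix.Norms.L2Operator in
theorem norm_le_of_succeq {P : Matrix n n ℝ} {c : ℝ} (hc : 0 < c) (hP : P.PosSemidef)
    (h : Succeq (c • 1) P) : ‖P‖ ≤ c := by
  refine norm_le_of_eucl_mulVec_le hc.le fun z => ?_
  refine abs_le_of_sq_le_sq' ?_ (mul_nonneg hc.le (eucl_nonneg z)) |>.2
  calc eucl (P *ᵥ z) ^ 2 ≤ c * (z ⬝ᵥ (P *ᵥ z)) := eucl_mulVec_sq_le hc hP h z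
    _ ≤ c * (c * eucl z ^ 2) := by gcongr; exact quadForm_le_of_succeq h z
    _ = (c * eucl z) ^ 2 := by ring

open scoped Matrix.Norms.L2Operator in
theorem quadForm_le_norm_mul_eucl_sq (M : Matrix n n ℝ) (z : n → ℝ) :
    z ⬝ᵥ (M *ᵥ z) ≤ ‖M‖ * eucl z ^ 2 := by
  simpa [sq] using (le_abs_self _).trans (abs_dotProduct_mulVec_le M z z)

end QuadraticForms

/-! ### Matrix-valued functions -/

section MatrixCalculus

variable {l m n : Type} {J : Set ℝ} {t : ℝ}

theorem MatHasDerivWithinAt.mono {M : ℝ → Matrix m n ℝ} {M' : Matrix m n ℝ} {K : Set ℝ}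
    (h : MatHasDerivWithinAt M M' J t) (hK : K ⊆ J) : MatHasDerivWithinAt M M' K t :=
  fun i j => (h i j).mono hK

theorem MatHasDerivWithinAt.congr_deriv {M : ℝ → Matrix m n ℝ} {M' N' : Matrix m n ℝ}
    (hM : MatHasDerivWithinAt M M' J t) (h : M' = N') : MatHasDerivWithinAt M N' J t :=
  h ▸ hM

theorem MatHasDerivWithinAt.transpose {M : ℝ → Matrix m n ℝ} {M' : Matrix m n ℝ}
    (hM : MatHasDerivWithinAt M M' J t) :
    MatHasDerivWithinAt (fun s => (M s)ᵀ) M'ᵀ J t :=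
  fun i j => hM j i

theorem MatHasDerivWithinAt.sub {M N : ℝ → Matrix m n ℝ} {M' N' : Matrix m n ℝ}
    (hM : MatHasDerivWithinAt M M' J t) (hN : MatHasDerivWithinAt N N' J t) :
    MatHasDerivWithinAt (fun s => M s - N s) (M' - N') J t :=
  fun i j => (hM i j).sub (hN i j)

theorem matHasDerivWithinAt_const (M : Matrix m n ℝ) :
    MatHasDerivWithinAt (fun _ => M) 0 J t :=
  fun _ _ => hasDerivWithinAt_const ..

theorem MatHasDerivWithinAt.mulVec [Finite m] [Fintype n] {M : ℝ → Matrix m n ℝ}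
    {M' : Matrix m n ℝ} {x : ℝ → n → ℝ} {x' : n → ℝ}
    (hM : MatHasDerivWithinAt M M' J t) (hx : HasDerivWithinAt x x' J t) :
    HasDerivWithinAt (fun s => M s *ᵥ x s) (M' *ᵥ x t + M t *ᵥ x') J t := by
  have := Fintype.ofFinite m
  rw [hasDerivWithinAt_pi] at hx ⊢
  intro i
  simp only [Matrix.mulVec, dotProduct, Pi.add_apply, ← Finset.sum_add_distrib]
  exact HasDerivWithinAt.fun_sum fun k _ => (hM i k).mul (hx k)

theorem hasDerivWithinAt_dotProduct [Fintype n] {x y : ℝ → n → ℝ} {x' y' : n → ℝ}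
    (hx : HasDerivWithinAt x x' J t) (hy : HasDerivWithinAt y y' J t) :
    HasDerivWithinAt (fun s => x s ⬝ᵥ y s) (x' ⬝ᵥ y t + x t ⬝ᵥ y') J t := by
  rw [hasDerivWithinAt_pi] at hx hy
  simp only [dotProduct, ← Finset.sum_add_distrib]
  exact HasDerivWithinAt.fun_sum fun k _ => (hx k).mul (hy k)

theorem hasDerivWithinAt_eucl_sq [Fintype n] {x : ℝ → n → ℝ} {x' : n → ℝ}
    (hx : HasDerivWithinAt x x' J t) :
    HasDerivWithinAt (fun s => eucl (x s) ^ 2) (2 * (x t ⬝ᵥ x')) J t := by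
  simp only [eucl_sq]
  refine (hasDerivWithinAt_dotProduct hx hx).congr_deriv ?_
  rw [dotProduct_comm x', two_mul]

theorem MatHasDerivWithinAt.quadForm [Fintype n] {M : ℝ → Matrix n n ℝ} {M' : Matrix n n ℝ}
    {x : ℝ → n → ℝ} {x' : n → ℝ} (hM : MatHasDerivWithinAt M M' J t) (hsymm : (M t)ᵀ = M t)
    (hx : HasDerivWithinAt x x' J t) :
    HasDerivWithinAt (fun s => x s ⬝ᵥ (M s *ᵥ x s))
      (x t ⬝ᵥ (M' *ᵥ x t) + 2 * (x t ⬝ᵥ (M t *ᵥ x'))) J t := by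
  refine (hasDerivWithinAt_dotProduct hx (hM.mulVec hx)).congr_deriv ?_
  rw [dotProduct_add, dotProduct_mulVec_comm hsymm x']
  ring

theorem MatHasDerivWithinAt.continuousWithinAt {M : ℝ → Matrix m n ℝ} {M' : Matrix m n ℝ}
    (hM : MatHasDerivWithinAt M M' J t) : ContinuousWithinAt M J t :=
  continuousWithinAt_pi.2 fun i => continuousWithinAt_pi.2 fun j => (hM i j).continuousWithinAt

theorem matHasDerivWithinAt_iff [Finite m] [Finite n] {M : ℝ → Matrix m n ℝ}
    {M' : Matrix m n ℝ} : MatHasDerivWithinAt M M' J t ↔ HasDerivWithinAt M M' J t := by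
  have := Fintype.ofFinite m
  have := Fintype.ofFinite n
  exact (forall_congr' fun _ => hasDerivWithinAt_pi.symm).trans
    (hasDerivWithinAt_pi (φ := M) (φ' := M')).symm

variable {X : Type} [TopologicalSpace X] {s : Set X}

theorem continuousOn_matrix_mul [Fintype m] {M : X → Matrix l m ℝ} {N : X → Matrix m n ℝ}
    (hM : ContinuousOn M s) (hN : ContinuousOn N s) : ContinuousOn (fun x => M x * N x) s := by
  rw [continuousOn_iff_continuous_domRestrict] at *
  exact hM.matrix_mul hN

theorem continuousOn_transpose {M : X → Matrix m n ℝ} (hM : ContinuousOn M s) :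
    ContinuousOn (fun x => (M x)ᵀ) s :=
  continuous_id.matrix_transpose.comp_continuousOn hM

theorem continuousOn_mulVec [Fintype n] {M : X → Matrix m n ℝ} {v : X → n → ℝ}
    (hM : ContinuousOn M s) (hv : ContinuousOn v s) : ContinuousOn (fun x => M x *ᵥ v x) s := by
  rw [continuousOn_iff_continuous_domRestrict] at *
  exact hM.matrix_mulVec hv

theorem continuousOn_dotProduct [Fintype n] {v w : X → n → ℝ} (hv : ContinuousOn v s)
    (hw : ContinuousOn w s) : ContinuousOn (fun x => v x ⬝ᵥ w x) s := by
  rw [continuousOn_iff_continuous_domRestrict] at *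
  exact hv.dotProduct hw

theorem continuousOn_matrix_elem {M : X → Matrix m n ℝ} (hM : ContinuousOn M s) (i : m) (j : n) :
    ContinuousOn (fun x => M x i j) s :=
  (continuous_id.matrix_elem i j).comp_continuousOn hM

section Norm

open scoped Matrix.Norms.L2Operator

variable [Fintype n]

theorem MatHasDerivWithinAt.inv [DecidableEq n] {M : ℝ → Matrix n n ℝ} {M' : Matrix n n ℝ}
    (hM : MatHasDerivWithinAt M M' J t) (hdet : IsUnit (M t)) :
    MatHasDerivWithinAt (fun s => (M s)⁻¹) (-((M t)⁻¹ * M' * (M t)⁻¹)) J t := by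
  obtain ⟨u, hu⟩ := hdet
  have hinv := hasFDerivAt_ringInverse (𝕜 := ℝ) u
  rw [hu] at hinv
  have hcomp := hinv.comp_hasDerivWithinAt t (matHasDerivWithinAt_iff.1 hM)
  simp only [Function.comp_def, ← Matrix.nonsing_inv_eq_ringInverse] at hcomp
  refine (matHasDerivWithinAt_iff.2 hcomp).congr_deriv ?_
  rw [← hu, ← Matrix.coe_units_inv]
  rfl

theorem eq_zero_of_linear_deriv {E M N : ℝ → Matrix n n ℝ} {a b : ℝ}
    (hM : ContinuousOn M (Set.Icc a b)) (hN : ContinuousOn N (Set.Icc a b))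
    (hE : ∀ s ∈ Set.Icc a b, MatHasDerivWithinAt E (M s * E s + E s * N s) (Set.Icc a b) s)
    (h0 : E a = 0) : ∀ s ∈ Set.Icc a b, E s = 0 := by
  classical
  obtain ⟨K₁, hK₁⟩ := isCompact_Icc.exists_bound_of_continuousOn hM
  obtain ⟨K₂, hK₂⟩ := isCompact_Icc.exists_bound_of_continuousOn hN
  refine eq_zero_of_abs_deriv_le_mul_abs_self_of_eq_zero_right
    (f' := fun s => M s * E s + E s * N s) (K := K₁ + K₂)
    (fun s hs => (hE s hs).continuousWithinAt) (fun s hs => ?_) h0 (fun s hs => ?_)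
  · exact (matHasDerivWithinAt_iff.1 (hE s (Set.Ico_subset_Icc_self hs))).mono_of_mem_nhdsWithin
      (Icc_mem_nhdsGE_of_mem hs)
  · have hs' := Set.Ico_subset_Icc_self hs
    calc ‖M s * E s + E s * N s‖ ≤ ‖M s‖ * ‖E s‖ + ‖E s‖ * ‖N s‖ :=
          (norm_add_le _ _).trans (add_le_add (norm_mul_le _ _) (norm_mul_le _ _))
      _ ≤ K₁ * ‖E s‖ + ‖E s‖ * K₂ := by
          gcongr
          · exact hK₁ s hs'
          · exact hK₂ s hs'
      _ = (K₁ + K₂) * ‖E s‖ := by ring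

end Norm

end MatrixCalculus

/-! ### Differential inequalities -/

section Gronwall

variable {f f' : ℝ → ℝ} {a b K : ℝ}

theorem le_gronwallBound_of_hasDerivWithinAt {c : ℝ} (hab : a ≤ b)
    (hf : ∀ s ∈ Set.Icc a b, HasDerivWithinAt f (f' s) (Set.Icc a b) s)
    (h : ∀ s ∈ Set.Icc a b, f' s ≤ K * f s + c) : f b ≤ gronwallBound (f a) K c (b - a) :=
  le_gronwallBound_of_liminf_deriv_right_le (fun s hs => (hf s hs).continuousWithinAt)
    (fun s hs _ hr => ((hf s (Set.Ico_subset_Icc_self hs)).mono_of_mem_nhdsWithin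
      (Icc_mem_nhdsGE_of_mem hs)).liminf_right_slope_le hr)
    le_rfl (fun s hs => h s (Set.Ico_subset_Icc_self hs)) b (Set.right_mem_Icc.2 hab)

theorem le_add_mul_of_deriv_le {c : ℝ} (hab : a ≤ b)
    (hf : ∀ s ∈ Set.Icc a b, HasDerivWithinAt f (f' s) (Set.Icc a b) s)
    (h : ∀ s ∈ Set.Icc a b, f' s ≤ c) : f b ≤ f a + c * (b - a) := by
  have := le_gronwallBound_of_hasDerivWithinAt (K := 0) (c := c) hab hf (by simpa using h)
  rwa [gronwallBound_K0] at this

theorem le_mul_exp_of_deriv_le (hab : a ≤ b)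
    (hf : ∀ s ∈ Set.Icc a b, HasDerivWithinAt f (f' s) (Set.Icc a b) s)
    (h : ∀ s ∈ Set.Icc a b, f' s ≤ K * f s) : f b ≤ f a * Real.exp (K * (b - a)) := by
  have := le_gronwallBound_of_hasDerivWithinAt (c := 0) hab hf (by simpa using h)
  rwa [gronwallBound_ε0] at this

theorem mul_exp_le_of_le_deriv (hab : a ≤ b)
    (hf : ∀ s ∈ Set.Icc a b, HasDerivWithinAt f (f' s) (Set.Icc a b) s)
    (h : ∀ s ∈ Set.Icc a b, K * f s ≤ f' s) : f a * Real.exp (K * (b - a)) ≤ f b := by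
  have := le_mul_exp_of_deriv_le (K := K) hab (fun s hs => (hf s hs).neg) fun s hs => by
    simpa using h s hs
  simpa using this

end Gronwall

/-! ### Linear systems -/

section Flow

open scoped Matrix.Norms.L2Operator

variable {n : Type} [Fintype n] [DecidableEq n] {A F : ℝ → Matrix n n ℝ} {a b α : ℝ}

section Curve

variable {x : ℝ → n → ℝ}

theorem abs_dotProduct_mulVec_self_le {M : Matrix n n ℝ} (hM : ‖M‖ ≤ α) (z : n → ℝ) :
    |z ⬝ᵥ (M *ᵥ z)| ≤ α * eucl z ^ 2 := by
  calc |z ⬝ᵥ (M *ᵥ z)| ≤ ‖M‖ * (eucl z * eucl z) := abs_dotProduct_mulVec_le M z z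
    _ ≤ α * eucl z ^ 2 := by rw [← sq]; gcongr

theorem eucl_le_mul_exp_of_linear (hab : a ≤ b) (hA : ∀ s ∈ Set.Icc a b, ‖A s‖ ≤ α)
    (hx : ∀ s ∈ Set.Icc a b, HasDerivWithinAt x (A s *ᵥ x s) (Set.Icc a b) s) :
    eucl (x b) ≤ eucl (x a) * Real.exp (α * (b - a)) := by
  have hsq := le_mul_exp_of_deriv_le (K := 2 * α) hab
    (fun s hs => hasDerivWithinAt_eucl_sq (hx s hs)) fun s hs => by
      linarith [le_of_abs_le (abs_dotProduct_mulVec_self_le (hA s hs) (x s))]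
  refine abs_le_of_sq_le_sq' (hsq.trans_eq ?_)
    (mul_nonneg (eucl_nonneg _) (Real.exp_pos _).le) |>.2
  rw [mul_pow, ← Real.exp_nat_mul]
  push_cast
  ring_nf

theorem mul_exp_le_eucl_of_linear (hab : a ≤ b) (hA : ∀ s ∈ Set.Icc a b, ‖A s‖ ≤ α)
    (hx : ∀ s ∈ Set.Icc a b, HasDerivWithinAt x (A s *ᵥ x s) (Set.Icc a b) s) :
    eucl (x a) * Real.exp (-α * (b - a)) ≤ eucl (x b) := by
  have hsq := mul_exp_le_of_le_deriv (K := -(2 * α)) hab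
    (fun s hs => hasDerivWithinAt_eucl_sq (hx s hs)) fun s hs => by
      linarith [neg_le_of_abs_le (abs_dotProduct_mulVec_self_le (hA s hs) (x s))]
  refine abs_le_of_sq_le_sq' (le_trans (le_of_eq ?_) hsq) (eucl_nonneg _) |>.2
  rw [mul_pow, ← Real.exp_nat_mul]
  push_cast
  ring_nf

end Curve

variable (hA : ∀ s ∈ Set.Icc a b, ‖A s‖ ≤ α)
  (hF : ∀ s ∈ Set.Icc a b, MatHasDerivWithinAt F (A s * F s) (Set.Icc a b) s) (h0 : F a = 1)

omit [DecidableEq n] in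
include hF in
theorem hasDerivWithinAt_flow_mulVec (q : n → ℝ) :
    ∀ s ∈ Set.Icc a b, HasDerivWithinAt (fun r => F r *ᵥ q) (A s *ᵥ (F s *ᵥ q)) (Set.Icc a b) s :=
  fun s hs => ((hF s hs).mulVec (hasDerivWithinAt_const s _ q)).congr_deriv (by simp)

include hA hF h0

theorem norm_flow_le (hab : a ≤ b) : ‖F b‖ ≤ Real.exp (α * (b - a)) := by
  refine norm_le_of_eucl_mulVec_le (Real.exp_pos _).le fun q => ?_
  have := eucl_le_mul_exp_of_linear hab hA (hasDerivWithinAt_flow_mulVec hF q)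
  rwa [h0, Matrix.one_mulVec, mul_comm] at this

theorem eucl_le_exp_mul_eucl_flow_mulVec (hab : a ≤ b) (q : n → ℝ) :
    eucl q ≤ Real.exp (α * (b - a)) * eucl (F b *ᵥ q) := by
  have := mul_exp_le_eucl_of_linear hab hA (hasDerivWithinAt_flow_mulVec hF q)
  rwa [h0, Matrix.one_mulVec, neg_mul, Real.exp_neg, ← div_eq_mul_inv,
    div_le_iff₀ (Real.exp_pos _), mul_comm] at this

theorem isUnit_flow (hab : a ≤ b) : IsUnit (F b) := by
  rw [← Matrix.mulVec_injective_iff_isUnit]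
  refine (injective_iff_map_eq_zero (Matrix.mulVecLin (F b))).2 fun q hq => ?_
  by_contra hne
  have := eucl_le_exp_mul_eucl_flow_mulVec hA hF h0 hab q
  rw [← Matrix.mulVecLin_apply, hq, eucl_zero, mul_zero] at this
  exact this.not_gt (eucl_pos hne)

theorem norm_flow_inv_le (hab : a ≤ b) : ‖(F b)⁻¹‖ ≤ Real.exp (α * (b - a)) := by
  refine norm_le_of_eucl_mulVec_le (Real.exp_pos _).le fun q => ?_
  have hdet := (Matrix.isUnit_iff_isUnit_det _).1 (isUnit_flow hA hF h0 hab)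
  have := eucl_le_exp_mul_eucl_flow_mulVec hA hF h0 hab ((F b)⁻¹ *ᵥ q)
  rwa [Matrix.mulVec_mulVec, Matrix.mul_nonsing_inv _ hdet, Matrix.one_mulVec] at this

end Flow

/-! ### Global existence for differential equations -/

/-- A continuity argument: `f < r` propagates along `[a, b]` as soon as `f ≤ r` improves itself. -/
theorem forall_lt_of_bootstrap {f : ℝ → ℝ} {a b r : ℝ} (hf : ContinuousOn f (Set.Icc a b))
    (ha : f a < r)
    (hstep : ∀ τ ∈ Set.Icc a b, (∀ t ∈ Set.Icc a τ, f t ≤ r) → f τ < r) :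
    ∀ t ∈ Set.Icc a b, f t < r := by
  by_contra! ⟨t, ht, hrt⟩
  have hcompact : IsCompact (Set.Icc a b ∩ f ⁻¹' Set.Ici r) :=
    isCompact_Icc.of_isClosed_subset (hf.preimage_isClosed_of_isClosed isClosed_Icc isClosed_Ici)
      Set.inter_subset_left
  obtain ⟨τ, ⟨hτ, hrτ⟩, hmin⟩ := hcompact.exists_isLeast ⟨t, ht, hrt⟩
  have hlt : ∀ s ∈ Set.Ico a τ, f s < r := fun s hs => by
    by_contra! h
    exact absurd (hmin ⟨⟨hs.1, hs.2.le.trans hτ.2⟩, h⟩) (not_le.2 hs.2)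
  have haτ : a < τ := hτ.1.lt_of_ne fun h => absurd hrτ (not_le.2 (h ▸ ha))
  have hnebot : (nhdsWithin τ (Set.Ico a τ)).NeBot := by
    rw [← mem_closure_iff_nhdsWithin_neBot, closure_Ico haτ.ne]
    exact Set.right_mem_Icc.2 haτ.le
  have hτr : f τ ≤ r :=
    le_of_tendsto ((hf τ hτ).mono (Set.Ico_subset_Icc_self.trans (Set.Icc_subset_Icc_right hτ.2)))
      (eventually_nhdsWithin_of_forall fun s hs => (hlt s hs).le)
  refine absurd (hstep τ hτ fun s hs => ?_) (not_lt.2 hrτ)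
  exact hs.2.eq_or_lt.elim (fun h => h ▸ hτr) fun h => (hlt s ⟨hs.1, h⟩).le

section GlobalExistence

open Set Metric NNReal

variable {E : Type*} [NormedAddCommGroup E] [NormedSpace ℝ E] {f : ℝ → E → E}

/-- The radial retraction of a normed space onto the closed ball of radius `r > 0` about `0`; it
truncates a vector field outside that ball. -/
noncomputable def radialRetract (r : ℝ) (z : E) : E := (r / max r ‖z‖) • z

theorem radialRetract_of_norm_le {r : ℝ} {z : E} (hr : 0 < r) (hz : ‖z‖ ≤ r) :
    radialRetract r z = z := by
  rw [radialRetract, max_eq_left hz, div_self hr.ne', one_smul]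

theorem radialRetract_mem_closedBall {r : ℝ} (hr : 0 < r) (z : E) :
    radialRetract r z ∈ closedBall 0 r := by
  rw [mem_closedBall_zero_iff, radialRetract, norm_smul, Real.norm_of_nonneg (by positivity),
    div_mul_eq_mul_div, div_le_iff₀ (by positivity)]
  exact mul_le_mul_of_nonneg_left (le_max_right r ‖z‖) hr.le

theorem lipschitzWith_radialRetract {r : ℝ} (hr : 0 < r) :
    LipschitzWith 2 (radialRetract r : E → E) := by
  refine LipschitzWith.of_dist_le_mul fun z w => ?_
  rw [dist_eq_norm, dist_eq_norm]
  set m := max r ‖z‖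
  set n := max r ‖w‖
  have hm : 0 < m := hr.trans_le (le_max_left _ _)
  have hn : 0 < n := hr.trans_le (le_max_left _ _)
  have hmn : |n - m| ≤ ‖z - w‖ := by
    rw [abs_sub_comm]
    simpa only [m, n, max_comm r] using
      (abs_max_sub_max_le_abs ‖z‖ ‖w‖ r).trans (abs_norm_sub_norm_le z w)
  have hsplit : radialRetract r z - radialRetract r w
      = (r / m) • (z - w) + ((r / m) * ((n - m) / n)) • w := by
    have : (r / m) * ((n - m) / n) = r / m - r / n := by field_simp
    rw [this]
    simp only [radialRetract, m, n]
    module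
  calc ‖radialRetract r z - radialRetract r w‖
      ≤ r / m * ‖z - w‖ + r / m * (|n - m| / n) * ‖w‖ := by
        rw [hsplit]
        refine (norm_add_le _ _).trans_eq ?_
        rw [norm_smul, norm_smul, Real.norm_eq_abs, Real.norm_eq_abs, abs_mul, abs_div, abs_div,
          abs_of_pos hr, abs_of_pos hm, abs_of_pos hn]
    _ = r / m * (‖z - w‖ + |n - m| * (‖w‖ / n)) := by ring
    _ ≤ 1 * (‖z - w‖ + ‖z - w‖ * 1) := by
        gcongr
        · exact (div_le_one hm).2 (le_max_left _ _)
        · exact (div_le_one hn).2 (le_max_right _ _)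
    _ = (2 : ℝ≥0) * ‖z - w‖ := by push_cast; ring

omit [NormedSpace ℝ E] in
theorem exists_norm_le_of_lipschitzOnWith {a b r : ℝ} (hr : 0 < r) {K : ℝ≥0}
    (hcont : ContinuousOn (f · 0) (Icc a b))
    (hlip : ∀ t ∈ Icc a b, LipschitzOnWith K (f t) (closedBall 0 r)) :
    ∃ L : ℝ≥0, ∀ t ∈ Icc a b, ∀ z ∈ closedBall (0 : E) r, ‖f t z‖ ≤ L := by
  obtain ⟨C, hC⟩ := isCompact_Icc.exists_bound_of_continuousOn hcont
  refine ⟨K * r.toNNReal + C.toNNReal, fun t ht z hz => ?_⟩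
  have hdist := (hlip t ht).dist_le_mul z hz 0 (mem_closedBall_self hr.le)
  rw [dist_eq_norm, dist_zero_right] at hdist
  calc ‖f t z‖ ≤ ‖f t z - f t 0‖ + ‖f t 0‖ := by
        simpa using norm_add_le (f t z - f t 0) (f t 0)
    _ ≤ K * r.toNNReal + C.toNNReal := by
        gcongr
        · refine hdist.trans (mul_le_mul_of_nonneg_left ?_ K.2)
          exact (mem_closedBall_zero_iff.1 hz).trans (le_max_left r 0)
        · exact (hC t ht).trans (le_max_left C 0)

/-- The truncated field is bounded and Lipschitz, so Picard–Lindelöf solves it on all of `[a, b]`;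
the a priori bound keeps this solution away from the truncation. -/
theorem exists_isIntegralCurveOn_Icc [CompleteSpace E] {a b M : ℝ} {z₀ : E} (hab : a ≤ b)
    (hcont : ∀ z, ContinuousOn (f · z) (Icc a b))
    (hlip : ∀ r, ∃ K : ℝ≥0, ∀ t ∈ Icc a b, LipschitzOnWith K (f t) (closedBall 0 r))
    (hbound : ∀ T ∈ Icc a b, ∀ z, z a = z₀ → IsIntegralCurveOn z f (Icc a T) → ‖z T‖ ≤ M) :
    ∃ z, z a = z₀ ∧ IsIntegralCurveOn z f (Icc a b) := by
  set r := max 1 (max ‖z₀‖ M + 1)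
  have hr : 0 < r := lt_max_of_lt_left one_pos
  have hMr : max ‖z₀‖ M < r := (lt_add_one _).trans_le (le_max_right _ _)
  obtain ⟨K, hK⟩ := hlip r
  obtain ⟨L, hL⟩ := exists_norm_le_of_lipschitzOnWith hr (hcont 0) hK
  set g : ℝ → E → E := fun t z => f t (radialRetract r z)
  have hPL : IsPicardLindelof g (tmin := a) (tmax := b) ⟨a, left_mem_Icc.2 hab⟩ z₀
      (L * (b - a).toNNReal) 0 L (K * 2) :=
    { lipschitzOnWith := fun t ht =>
        ((hK t ht).comp (lipschitzWith_radialRetract hr).lipschitzOnWith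
          fun z _ => radialRetract_mem_closedBall hr z)
      continuousOn := fun z _ => hcont _
      norm_le := fun t ht z _ => hL t ht _ (radialRetract_mem_closedBall hr z)
      mul_max_le := by
        rw [sub_self, max_eq_left (sub_nonneg.2 hab), NNReal.coe_zero, sub_zero, NNReal.coe_mul,
          Real.coe_toNNReal _ (sub_nonneg.2 hab)] }
  obtain ⟨z, hz₀, hz⟩ := hPL.exists_eq_forall_mem_Icc_hasDerivWithinAt₀
  have hsolves : ∀ T ∈ Icc a b, (∀ t ∈ Icc a T, ‖z t‖ ≤ r) → IsIntegralCurveOn z f (Icc a T) :=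
    fun T hT hle t ht => by
      have hg : g t (z t) = f t (z t) := congrArg (f t) (radialRetract_of_norm_le hr (hle t ht))
      exact hg ▸ (hz t ⟨ht.1, ht.2.trans hT.2⟩).mono (Icc_subset_Icc_right hT.2)
  have hlt : ∀ t ∈ Icc a b, ‖z t‖ < r :=
    forall_lt_of_bootstrap (fun t ht => (hz t ht).continuousWithinAt.norm)
      (by rw [hz₀]; exact (le_max_left _ _).trans_lt hMr) fun T hT hle =>
        (hbound T hT z hz₀ (hsolves T hT hle)).trans_lt ((le_max_right _ _).trans_lt hMr)
  exact ⟨z, hz₀, hsolves b (right_mem_Icc.2 hab) fun t ht => (hlt t ht).le⟩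

theorem eqOn_of_isIntegralCurveOn {a b : ℝ} {z w : ℝ → E}
    (hlip : ∀ r, ∃ K : ℝ≥0, ∀ t ∈ Icc a b, LipschitzOnWith K (f t) (closedBall 0 r))
    (hz : IsIntegralCurveOn z f (Icc a b)) (hw : IsIntegralCurveOn w f (Icc a b))
    (h : z a = w a) : EqOn z w (Icc a b) := by
  obtain ⟨r₁, hr₁⟩ := isCompact_Icc.exists_bound_of_continuousOn hz.continuousOn
  obtain ⟨r₂, hr₂⟩ := isCompact_Icc.exists_bound_of_continuousOn hw.continuousOn
  obtain ⟨K, hK⟩ := hlip (max r₁ r₂)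
  have hIci : ∀ {z : ℝ → E}, IsIntegralCurveOn z f (Icc a b) →
      ∀ t ∈ Ico a b, HasDerivWithinAt z (f t (z t)) (Ici t) t := fun hz t ht =>
    (hz t (Ico_subset_Icc_self ht)).mono_of_mem_nhdsWithin (Icc_mem_nhdsGE_of_mem ht)
  exact ODE_solution_unique_of_mem_Icc_right (s := fun _ => closedBall 0 (max r₁ r₂))
    (fun t ht => hK t (Ico_subset_Icc_self ht)) hz.continuousOn (hIci hz)
    (fun t ht => mem_closedBall_zero_iff.2 <|
      (hr₁ t (Ico_subset_Icc_self ht)).trans (le_max_left _ _))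
    hw.continuousOn (hIci hw)
    (fun t ht => mem_closedBall_zero_iff.2 <|
      (hr₂ t (Ico_subset_Icc_self ht)).trans (le_max_right _ _)) h

theorem exists_isIntegralCurveOn_Ici [CompleteSpace E] {t₀ : ℝ} {z₀ : E}
    (hcont : ∀ z, ContinuousOn (f · z) (Ici t₀))
    (hlip : ∀ T r : ℝ, ∃ K : ℝ≥0, ∀ t ∈ Icc t₀ T, LipschitzOnWith K (f t) (closedBall 0 r))
    (hbound : ∀ b, ∃ M, ∀ T ∈ Icc t₀ b, ∀ z, z t₀ = z₀ → IsIntegralCurveOn z f (Icc t₀ T) →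
      ‖z T‖ ≤ M) :
    ∃ z, z t₀ = z₀ ∧ IsIntegralCurveOn z f (Ici t₀) := by
  have hexists : ∀ k : ℕ, ∃ z, z t₀ = z₀ ∧ IsIntegralCurveOn z f (Icc t₀ (t₀ + k)) := fun k => by
    obtain ⟨M, hM⟩ := hbound (t₀ + k)
    exact exists_isIntegralCurveOn_Icc (le_add_of_nonneg_right k.cast_nonneg)
      (fun z => (hcont z).mono Icc_subset_Ici_self) (hlip _) hM
  choose z hz₀ hz using hexists
  set y : ℝ → E := fun t => z ⌈t - t₀⌉₊ t
  have hyz : ∀ k : ℕ, EqOn y (z k) (Icc t₀ (t₀ + k)) := fun k t ht => by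
    have hceil : ⌈t - t₀⌉₊ ≤ k := Nat.ceil_le.2 (sub_le_iff_le_add'.2 ht.2)
    have hsub : Icc t₀ (t₀ + (⌈t - t₀⌉₊ : ℝ)) ⊆ Icc t₀ (t₀ + k) :=
      Icc_subset_Icc_right (add_le_add_right (Nat.cast_le.2 hceil) _)
    exact eqOn_of_isIntegralCurveOn (hlip _) (hz _) ((hz k).mono hsub)
      ((hz₀ _).trans (hz₀ k).symm) ⟨ht.1, sub_le_iff_le_add'.1 (Nat.le_ceil _)⟩
  refine ⟨y, by simp [y, hz₀], fun t ht => ?_⟩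
  obtain ⟨k, hk⟩ := exists_nat_gt (t - t₀)
  have htk : t < t₀ + k := sub_lt_iff_lt_add'.1 hk
  have hmem : t ∈ Icc t₀ (t₀ + k) := ⟨ht, htk.le⟩
  have hderiv := (hz k t hmem).congr (hyz k) (hyz k hmem)
  rw [← hyz k hmem] at hderiv
  refine hderiv.mono_of_mem_nhdsWithin ?_
  exact Filter.inter_mem self_mem_nhdsWithin (mem_nhdsWithin_of_mem_nhds (Iic_mem_nhds htk))

end GlobalExistence

section UnifLip

variable {E : Type*} [PseudoMetricSpace E] {I : Set ℝ} {B : Set E} {F G : ℝ → E → ℝ}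

/-- The functions `F t`, for `t ∈ I`, are bounded and Lipschitz on `B` with a common constant. Both
properties are asked for together so that they survive products. -/
def UnifLip (I : Set ℝ) (B : Set E) (F : ℝ → E → ℝ) : Prop :=
  ∃ C, 0 ≤ C ∧ (∀ t ∈ I, ∀ z ∈ B, |F t z| ≤ C) ∧
    ∀ t ∈ I, ∀ z ∈ B, ∀ z' ∈ B, |F t z - F t z'| ≤ C * dist z z'

theorem UnifLip.mono {I' : Set ℝ} {B' : Set E} (hF : UnifLip I B F) (hI : I' ⊆ I)
    (hB : B' ⊆ B) : UnifLip I' B' F := by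
  obtain ⟨C, hC, hbdd, hlip⟩ := hF
  exact ⟨C, hC, fun t ht z hz => hbdd t (hI ht) z (hB hz),
    fun t ht z hz z' hz' => hlip t (hI ht) z (hB hz) z' (hB hz')⟩

theorem UnifLip.add (hF : UnifLip I B F) (hG : UnifLip I B G) :
    UnifLip I B fun t z => F t z + G t z := by
  obtain ⟨C, hC, hFbdd, hFlip⟩ := hF
  obtain ⟨C', hC', hGbdd, hGlip⟩ := hG
  refine ⟨C + C', by positivity, fun t ht z hz => ?_, fun t ht z hz z' hz' => ?_⟩
  · exact (abs_add_le _ _).trans (add_le_add (hFbdd t ht z hz) (hGbdd t ht z hz))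
  · rw [add_sub_add_comm, add_mul]
    exact (abs_add_le _ _).trans (add_le_add (hFlip t ht z hz z' hz') (hGlip t ht z hz z' hz'))

theorem UnifLip.mul (hF : UnifLip I B F) (hG : UnifLip I B G) :
    UnifLip I B fun t z => F t z * G t z := by
  obtain ⟨C, hC, hFbdd, hFlip⟩ := hF
  obtain ⟨C', hC', hGbdd, hGlip⟩ := hG
  have hCC' := mul_nonneg hC hC'
  refine ⟨2 * (C * C'), by positivity, fun t ht z hz => ?_, fun t ht z hz z' hz' => ?_⟩
  · rw [abs_mul]
    linarith [mul_le_mul (hFbdd t ht z hz) (hGbdd t ht z hz) (abs_nonneg _) hC]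
  · calc |F t z * G t z - F t z' * G t z'|
        = |F t z * (G t z - G t z') + (F t z - F t z') * G t z'| := by ring_nf
      _ ≤ |F t z| * |G t z - G t z'| + |F t z - F t z'| * |G t z'| := by
          rw [← abs_mul, ← abs_mul]
          exact abs_add_le _ _
      _ ≤ C * (C' * dist z z') + C * dist z z' * C' := by
          gcongr
          exacts [hFbdd t ht z hz, hGlip t ht z hz z' hz', hFlip t ht z hz z' hz',
            hGbdd t ht z' hz']
      _ = 2 * (C * C') * dist z z' := by ring

theorem unifLip_of_bounded {f : ℝ → ℝ} {C : ℝ} (hf : ∀ t ∈ I, |f t| ≤ C) :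
    UnifLip I B fun t _ => f t := by
  refine ⟨|C|, abs_nonneg C, fun t ht _ _ => (hf t ht).trans (le_abs_self C),
    fun t _ z _ z' _ => ?_⟩
  rw [sub_self, abs_zero]
  positivity

theorem unifLip_const (c : ℝ) : UnifLip I B fun _ _ => c :=
  unifLip_of_bounded (C := |c|) fun _ _ => le_rfl

theorem unifLip_of_continuousOn {f : ℝ → ℝ} {a b : ℝ} (hf : ContinuousOn f (Set.Icc a b)) :
    UnifLip (Set.Icc a b) B fun t _ => f t := by
  obtain ⟨C, hC⟩ := isCompact_Icc.exists_bound_of_continuousOn hf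
  exact unifLip_of_bounded hC

theorem unifLip_of_lipschitzWith {φ : E → ℝ} {K : NNReal} (hφ : LipschitzWith K φ)
    (hB : Bornology.IsBounded B) : UnifLip I B fun _ => φ := by
  obtain ⟨C, hC⟩ := (hφ.isBounded_image hB).exists_norm_le
  refine ⟨K + |C|, by positivity, fun _ _ z hz => ?_, fun _ _ z _ z' _ => ?_⟩
  · exact (hC _ (Set.mem_image_of_mem φ hz)).trans
      ((le_abs_self C).trans (le_add_of_nonneg_left K.2))
  · rw [← Real.dist_eq]
    exact (hφ.dist_le_mul z z').trans
      (mul_le_mul_of_nonneg_right (le_add_of_nonneg_right (abs_nonneg C)) dist_nonneg)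

theorem UnifLip.neg (hF : UnifLip I B F) : UnifLip I B fun t z => -F t z := by
  simpa using (unifLip_const (-1)).mul hF

theorem UnifLip.sub (hF : UnifLip I B F) (hG : UnifLip I B G) :
    UnifLip I B fun t z => F t z - G t z := by
  simpa [sub_eq_add_neg] using hF.add hG.neg

theorem UnifLip.sum {ι : Type*} (s : Finset ι) {F : ι → ℝ → E → ℝ}
    (hF : ∀ i ∈ s, UnifLip I B (F i)) : UnifLip I B fun t z => ∑ i ∈ s, F i t z := by
  classical
  induction s using Finset.induction_on with
  | empty => simpa using unifLip_const 0
  | insert i s hi ih =>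
    simp only [Finset.sum_insert hi]
    exact (hF i (Finset.mem_insert_self i s)).add
      (ih fun j hj => hF j (Finset.mem_insert_of_mem hj))

theorem UnifLip.matrix_mul {l m n : Type*} [Fintype m] {M : ℝ → E → Matrix l m ℝ}
    {N : ℝ → E → Matrix m n ℝ} (hM : ∀ i j, UnifLip I B fun t z => M t z i j)
    (hN : ∀ i j, UnifLip I B fun t z => N t z i j) (i : l) (j : n) :
    UnifLip I B fun t z => (M t z * N t z) i j := by
  simp only [Matrix.mul_apply]
  exact UnifLip.sum _ fun k _ => (hM i k).mul (hN k j)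

theorem UnifLip.matrix_mulVec {m n : Type*} [Fintype n] {M : ℝ → E → Matrix m n ℝ}
    {v : ℝ → E → n → ℝ} (hM : ∀ i j, UnifLip I B fun t z => M t z i j)
    (hv : ∀ i, UnifLip I B fun t z => v t z i) (i : m) :
    UnifLip I B fun t z => (M t z *ᵥ v t z) i := by
  simp only [Matrix.mulVec, dotProduct]
  exact UnifLip.sum _ fun k _ => (hM i k).mul (hv k)

theorem UnifLip.comp {E' : Type*} [PseudoMetricSpace E'] {B' : Set E'} {g : E' → E}
    (hF : UnifLip I B F) (hg : LipschitzWith 1 g) (hmaps : Set.MapsTo g B' B) :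
    UnifLip I B' fun t z => F t (g z) := by
  obtain ⟨C, hC, hbdd, hlip⟩ := hF
  refine ⟨C, hC, fun t ht z hz => hbdd t ht _ (hmaps hz), fun t ht z hz z' hz' => ?_⟩
  refine (hlip t ht _ (hmaps hz) _ (hmaps hz')).trans (mul_le_mul_of_nonneg_left ?_ hC)
  simpa using hg.dist_le_mul z z'

theorem UnifLip.exists_lipschitzOnWith (hF : UnifLip I B F) :
    ∃ K : NNReal, ∀ t ∈ I, LipschitzOnWith K (F t) B := by
  obtain ⟨C, hC, -, hlip⟩ := hF
  exact ⟨⟨C, hC⟩, fun t ht => LipschitzOnWith.of_dist_le_mul (hlip t ht)⟩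

theorem exists_lipschitzOnWith_pi {ι X : Type*} [Fintype ι] [PseudoMetricSpace X]
    {F : ℝ → E → ι → X}
    (hF : ∀ i, ∃ K : NNReal, ∀ t ∈ I, LipschitzOnWith K (fun z => F t z i) B) :
    ∃ K : NNReal, ∀ t ∈ I, LipschitzOnWith K (F t) B := by
  choose K hK using hF
  refine ⟨∑ i, K i, fun t ht => LipschitzOnWith.of_dist_le_mul fun z hz z' hz' => ?_⟩
  refine (dist_pi_le_iff (mul_nonneg (NNReal.coe_nonneg _) dist_nonneg)).2 fun i => ?_
  refine ((hK i t ht).dist_le_mul z hz z' hz').trans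
    (mul_le_mul_of_nonneg_right ?_ dist_nonneg)
  exact Finset.single_le_sum (f := K) (fun j _ => (K j).2) (Finset.mem_univ i)

end UnifLip

section LinearExistence

open scoped Matrix.Norms.L2Operator

variable {n : Type} [Fintype n]

theorem exists_hasDerivWithinAt_mulVec {M : ℝ → Matrix n n ℝ} {a : ℝ}
    (hM : ContinuousOn M (Set.Ici a)) (z : n → ℝ) :
    ∃ x : ℝ → n → ℝ, x a = z ∧
      ∀ s ∈ Set.Ici a, HasDerivWithinAt x (M s *ᵥ x s) (Set.Ici a) s := by
  classical
  have hMb : ∀ b, ContinuousOn M (Set.Icc a b) := fun b => hM.mono Set.Icc_subset_Ici_self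
  refine exists_isIntegralCurveOn_Ici (f := fun s x => M s *ᵥ x)
    (fun x => continuousOn_mulVec hM continuousOn_const)
    (fun T r => exists_lipschitzOnWith_pi fun i => (UnifLip.matrix_mulVec
      (fun i j => unifLip_of_continuousOn (continuousOn_matrix_elem (hMb T) i j))
      (fun i => unifLip_of_lipschitzWith (LipschitzWith.eval i)
        Metric.isBounded_closedBall) i).exists_lipschitzOnWith) fun b => ?_
  obtain ⟨α, hα⟩ := isCompact_Icc.exists_bound_of_continuousOn (hMb b)
  refine ⟨eucl z * Real.exp (|α| * (b - a)), fun T hT x hx hsol => (norm_le_eucl _).trans ?_⟩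
  have hgrowth := eucl_le_mul_exp_of_linear hT.1
    (fun s hs => (hα s ⟨hs.1, hs.2.trans hT.2⟩).trans (le_abs_self α)) hsol
  rw [hx] at hgrowth
  refine hgrowth.trans ?_
  gcongr
  exacts [eucl_nonneg z, hT.2]

theorem exists_hasDerivWithinAt_mulVec_of_right {M : ℝ → Matrix n n ℝ} {a b : ℝ} (hab : a ≤ b)
    (hM : ContinuousOn M (Set.Icc a b)) (z : n → ℝ) :
    ∃ x : ℝ → n → ℝ, x b = z ∧
      ∀ s ∈ Set.Icc a b, HasDerivWithinAt x (M s *ᵥ x s) (Set.Icc a b) s := by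
  set M' := Set.IccExtend hab ((Set.Icc a b).domRestrict M)
  have hM' : Continuous M' := hM.domRestrict.Icc_extend'
  have hmaps : Set.MapsTo (fun s => a + b - s) (Set.Icc a b) (Set.Ici a) :=
    fun s hs => show a ≤ a + b - s by linarith [hs.2]
  obtain ⟨y, hy, hderiv⟩ := exists_hasDerivWithinAt_mulVec (M := fun s => -M' (a + b - s)) (a := a)
    (hM'.comp (continuous_const.sub continuous_id)).neg.continuousOn z
  refine ⟨fun s => y (a + b - s), by simpa using hy, fun s hs => ?_⟩
  have hflow := (hderiv _ (hmaps hs)).scomp s ((hasDerivWithinAt_id s _).const_sub (a + b)) hmaps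
  have hMs : M' s = M s := Set.IccExtend_of_mem hab _ hs
  simpa [Function.comp_def, Matrix.neg_mulVec, hMs] using hflow

theorem exists_isTransitionMatrix [DecidableEq n] {A : ℝ → Matrix n n ℝ}
    (hA : ContinuousOn A (Set.Ici 0)) : ∃ Φ, IsTransitionMatrix A Φ := by
  have hcolumn : ∀ (t : ℝ) (j : n), ∃ x : ℝ → n → ℝ, 0 ≤ t → x t = Pi.single j 1 ∧
      ∀ s ∈ Set.Ici t, HasDerivWithinAt x (A s *ᵥ x s) (Set.Ici t) s := fun t j => by
    by_cases ht : 0 ≤ t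
    · obtain ⟨x, hx⟩ := exists_hasDerivWithinAt_mulVec (hA.mono (Set.Ici_subset_Ici.2 ht))
        (Pi.single j 1)
      exact ⟨x, fun _ => hx⟩
    · exact ⟨0, fun h => absurd h ht⟩
  choose x hx using hcolumn
  refine ⟨fun s t => Matrix.of fun i j => x t j s i, fun t ht => ⟨?_, fun s hs i j => ?_⟩⟩
  · ext i j
    simp [(hx t j ht).1, Matrix.one_apply, Pi.single_apply]
  · exact hasDerivWithinAt_pi.1 ((hx t j ht).2 s hs) i

end LinearExistence

section MatrixIntegrals

variable {m n : Type} {a b : ℝ}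

@[simp] theorem matIntegral_self (M : ℝ → Matrix m n ℝ) : matIntegral M a a = 0 := by
  ext i j
  simp [matIntegral]

theorem hasDerivWithinAt_matIntegral {M : ℝ → Matrix m n ℝ} (hM : ContinuousOn M (Set.Icc a b))
    {s : ℝ} (hs : s ∈ Set.Icc a b) :
    MatHasDerivWithinAt (fun r => matIntegral M a r) (M s) (Set.Icc a b) s := by
  intro i j
  have : Fact (s ∈ Set.Icc a b) := ⟨hs⟩
  have hc := continuousOn_matrix_elem hM i j
  exact intervalIntegral.integral_hasDerivWithinAt_right
    ((hc.mono (Set.Icc_subset_Icc_right hs.2)).intervalIntegrable_of_Icc hs.1)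
    (hc.stronglyMeasurableAtFilter_nhdsWithin measurableSet_Icc s) (hc s hs)

theorem transpose_matIntegral (M : ℝ → Matrix m n ℝ) :
    (matIntegral M a b)ᵀ = matIntegral (fun s => (M s)ᵀ) a b := rfl

variable [Fintype m] [Fintype n]

theorem dotProduct_matIntegral_mulVec {M : ℝ → Matrix m n ℝ} (hab : a ≤ b)
    (hM : ContinuousOn M (Set.Icc a b)) (v : m → ℝ) (w : n → ℝ) :
    v ⬝ᵥ (matIntegral M a b *ᵥ w) = ∫ s in a..b, v ⬝ᵥ (M s *ᵥ w) := by
  have hint : ∀ i j, IntervalIntegrable (fun s => M s i j) MeasureTheory.volume a b := fun i j =>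
    (continuousOn_matrix_elem hM i j).intervalIntegrable_of_Icc hab
  have hrow : ∀ i, IntervalIntegrable (fun s => (M s *ᵥ w) i) MeasureTheory.volume a b := fun i =>
    (continuousOn_pi.1 (continuousOn_mulVec hM continuousOn_const) i).intervalIntegrable_of_Icc hab
  simp only [dotProduct]
  rw [intervalIntegral.integral_finsetSum fun i _ => (hrow i).const_mul (v i)]
  refine Finset.sum_congr rfl fun i _ => ?_
  simp only [Matrix.mulVec, dotProduct, matIntegral, Matrix.of_apply]
  rw [intervalIntegral.integral_const_mul, intervalIntegral.integral_finsetSum fun j _ =>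
    (hint i j).mul_const (w j)]
  simp only [intervalIntegral.integral_mul_const]

omit [Fintype n] in
theorem posSemidef_matIntegral [Finite n] {M : ℝ → Matrix n n ℝ} (hab : a ≤ b)
    (hM : ContinuousOn M (Set.Icc a b)) (hpos : ∀ s ∈ Set.Icc a b, (M s).PosSemidef) :
    (matIntegral M a b).PosSemidef := by
  have := Fintype.ofFinite n
  refine posSemidef_of_quadForm_nonneg ?_ fun z => ?_
  · rw [transpose_matIntegral]
    ext i j
    refine intervalIntegral.integral_congr fun s hs => ?_
    rw [Set.uIcc_of_le hab] at hs
    exact congrFun₂ (transpose_eq_of_posSemidef (hpos s hs)) i j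
  · rw [dotProduct_matIntegral_mulVec hab hM]
    exact intervalIntegral.integral_nonneg hab fun s hs => quadForm_nonneg (hpos s hs) z

open scoped Matrix.Norms.L2Operator in
theorem norm_matIntegral_le [DecidableEq n] {M : ℝ → Matrix m n ℝ} {c : ℝ} (hab : a ≤ b)
    (hM : ContinuousOn M (Set.Icc a b)) (hc : ∀ s ∈ Set.Icc a b, ‖M s‖ ≤ c) :
    ‖matIntegral M a b‖ ≤ c * (b - a) := by
  have hc0 : 0 ≤ c := (norm_nonneg _).trans (hc a (Set.left_mem_Icc.2 hab))
  refine norm_le_of_eucl_mulVec_le (mul_nonneg hc0 (sub_nonneg.2 hab)) fun z => ?_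
  set v := matIntegral M a b *ᵥ z with hv
  have hsq : eucl v * eucl v ≤ eucl v * (c * (b - a) * eucl z) := by
    calc eucl v * eucl v = ∫ s in a..b, v ⬝ᵥ (M s *ᵥ z) := by
          rw [← dotProduct_matIntegral_mulVec hab hM, ← hv, ← sq, eucl_sq]
      _ ≤ c * (eucl v * eucl z) * |b - a| := by
          refine (Real.le_norm_self _).trans
            (intervalIntegral.norm_integral_le_of_norm_le_const fun s hs => ?_)
          rw [Set.uIoc_of_le hab] at hs
          exact (abs_dotProduct_mulVec_le _ _ _).trans
            (mul_le_mul_of_nonneg_right (hc s (Set.Ioc_subset_Icc_self hs))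
              (mul_nonneg (eucl_nonneg _) (eucl_nonneg _)))
      _ = eucl v * (c * (b - a) * eucl z) := by rw [abs_of_nonneg (sub_nonneg.2 hab)]; ring
  rcases (eucl_nonneg v).eq_or_lt with hzero | hpos
  · rw [← hzero]
    exact mul_nonneg (mul_nonneg hc0 (sub_nonneg.2 hab)) (eucl_nonneg z)
  · exact le_of_mul_le_mul_left hsq hpos

end MatrixIntegrals

/-! ### The Riccati equation -/

section Riccati

variable {n : Type} [Fintype n] {A G S P : ℝ → Matrix n n ℝ} {a b : ℝ}

/-- `P` solves the Riccati equation `P' = A P + P Aᵀ - P G P + S` on `[a, b]`. The matrix `G`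
stands for `Cᵀ D C`. -/
def SolvesRiccatiOn (A G S P : ℝ → Matrix n n ℝ) (a b : ℝ) : Prop :=
  ∀ s ∈ Set.Icc a b, MatHasDerivWithinAt P
    (A s * P s + P s * (A s)ᵀ - P s * G s * P s + S s) (Set.Icc a b) s

theorem hasDerivWithinAt_quadForm_lyapunov {M N : Matrix n n ℝ} {e : ℝ → n → ℝ} {r : n → ℝ}
    {J : Set ℝ} {t : ℝ} (hP : MatHasDerivWithinAt P (M * P t + P t * Mᵀ + N) J t)
    (hsymm : (P t)ᵀ = P t) (he : HasDerivWithinAt e (-(Mᵀ *ᵥ e t) + r) J t) :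
    HasDerivWithinAt (fun s => e s ⬝ᵥ (P s *ᵥ e s))
      (e t ⬝ᵥ (N *ᵥ e t) + 2 * (e t ⬝ᵥ (P t *ᵥ r))) J t := by
  refine (hP.quadForm hsymm he).congr_deriv ?_
  have hflip : e t ⬝ᵥ (M *ᵥ (P t *ᵥ e t)) = e t ⬝ᵥ (P t *ᵥ (Mᵀ *ᵥ e t)) := by
    rw [dotProduct_mulVec_comm hsymm, dotProduct_comm (Mᵀ *ᵥ e t),
      Matrix.dotProduct_transpose_mulVec]
  simp only [Matrix.add_mulVec, Matrix.mulVec_add, Matrix.mulVec_neg, dotProduct_add,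
    dotProduct_neg, ← Matrix.mulVec_mulVec, hflip]
  ring

theorem SolvesRiccatiOn.mono {a' b' : ℝ} (h : SolvesRiccatiOn A G S P a b) (ha : a ≤ a')
    (hb : b' ≤ b) : SolvesRiccatiOn A G S P a' b' := fun s hs =>
  (h s (Set.Icc_subset_Icc ha hb hs)).mono (Set.Icc_subset_Icc ha hb)

theorem SolvesRiccatiOn.continuousOn (h : SolvesRiccatiOn A G S P a b) :
    ContinuousOn P (Set.Icc a b) := fun s hs => (h s hs).continuousWithinAt

theorem SolvesRiccatiOn.transpose_eq (h : SolvesRiccatiOn A G S P a b)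
    (hA : ContinuousOn A (Set.Icc a b)) (hG : ContinuousOn G (Set.Icc a b))
    (hGs : ∀ s ∈ Set.Icc a b, (G s)ᵀ = G s) (hSs : ∀ s ∈ Set.Icc a b, (S s)ᵀ = S s)
    (h0 : (P a)ᵀ = P a) : ∀ s ∈ Set.Icc a b, (P s)ᵀ = P s := by
  classical
  have hskew := eq_zero_of_linear_deriv (E := fun s => P s - (P s)ᵀ)
    (M := fun s => A s - P s * G s) (N := fun s => (A s)ᵀ - G s * (P s)ᵀ)
    (hA.sub (continuousOn_matrix_mul h.continuousOn hG))
    ((continuousOn_transpose hA).sub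
      (continuousOn_matrix_mul hG (continuousOn_transpose h.continuousOn)))
    (fun s hs => ((h s hs).sub (h s hs).transpose).congr_deriv (by
      simp only [Matrix.transpose_add, Matrix.transpose_sub, Matrix.transpose_mul,
        Matrix.transpose_transpose, hGs s hs, hSs s hs]
      noncomm_ring))
    (by simp [h0])
  exact fun s hs => (sub_eq_zero.1 (hskew s hs)).symm

/- Optimal control reads `z ⬝ P(b) z` as the value of a problem in which `c` is the control of the
adjoint system `e' = -Aᵀ e + G c`, so every choice of `c` steering `e` to `z` bounds it. -/
theorem SolvesRiccatiOn.quadForm_le (h : SolvesRiccatiOn A G S P a b) (hab : a ≤ b)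
    (hPs : ∀ s ∈ Set.Icc a b, (P s)ᵀ = P s) (hG : ∀ s ∈ Set.Icc a b, (G s).PosSemidef)
    {e c : ℝ → n → ℝ} {κ : ℝ}
    (he : ∀ s ∈ Set.Icc a b,
      HasDerivWithinAt e (-((A s)ᵀ *ᵥ e s) + G s *ᵥ c s) (Set.Icc a b) s)
    (hκ : ∀ s ∈ Set.Icc a b, c s ⬝ᵥ (G s *ᵥ c s) + e s ⬝ᵥ (S s *ᵥ e s) ≤ κ) :
    e b ⬝ᵥ (P b *ᵥ e b) ≤ e a ⬝ᵥ (P a *ᵥ e a) + κ * (b - a) := by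
  refine le_add_mul_of_deriv_le hab
    (fun s hs => hasDerivWithinAt_quadForm_lyapunov (N := S s - P s * G s * P s)
      ((h s hs).congr_deriv (by abel)) (hPs s hs) (he s hs)) fun s hs => ?_
  have hyoung := two_mul_dotProduct_mulVec_le (hG s hs) (P s *ᵥ e s) (c s)
  have hsq : e s ⬝ᵥ ((P s * G s * P s) *ᵥ e s) = (P s *ᵥ e s) ⬝ᵥ (G s *ᵥ (P s *ᵥ e s)) := by
    rw [← Matrix.mulVec_mulVec, ← Matrix.mulVec_mulVec, dotProduct_mulVec_comm (hPs s hs),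
      dotProduct_comm]
  have hcross : e s ⬝ᵥ (P s *ᵥ (G s *ᵥ c s)) = (P s *ᵥ e s) ⬝ᵥ (G s *ᵥ c s) := by
    rw [dotProduct_mulVec_comm (hPs s hs), dotProduct_comm]
  rw [Matrix.sub_mulVec, dotProduct_sub, hsq, hcross]
  linarith [hκ s hs]

theorem SolvesRiccatiOn.posSemidef (h : SolvesRiccatiOn A G S P a b) (hab : a ≤ b)
    (hA : ContinuousOn A (Set.Icc a b)) (hG : ContinuousOn G (Set.Icc a b))
    (hGs : ∀ s ∈ Set.Icc a b, (G s)ᵀ = G s) (hS : ∀ s ∈ Set.Icc a b, (S s).PosSemidef)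
    (h0 : (P a).PosSemidef) : (P b).PosSemidef := by
  have hPs := h.transpose_eq hA hG hGs (fun s hs => transpose_eq_of_posSemidef (hS s hs))
    (transpose_eq_of_posSemidef h0)
  refine posSemidef_of_quadForm_nonneg (hPs b (Set.right_mem_Icc.2 hab)) fun z => ?_
  -- With `M = A - P G / 2` the equation reads `P' = M P + P Mᵀ + S`.
  set M := fun s => A s - (1 / 2 : ℝ) • (P s * G s) with hMdef
  have hM : ContinuousOn M (Set.Icc a b) :=
    hA.sub ((continuousOn_matrix_mul h.continuousOn hG).fun_const_smul _)
  obtain ⟨e, rfl, he⟩ :=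
    exists_hasDerivWithinAt_mulVec_of_right hab (continuousOn_transpose hM).neg z
  have hderiv : ∀ s ∈ Set.Icc a b, HasDerivWithinAt (fun s => e s ⬝ᵥ (P s *ᵥ e s))
      (e s ⬝ᵥ (S s *ᵥ e s) + 2 * (e s ⬝ᵥ (P s *ᵥ 0))) (Set.Icc a b) s := fun s hs => by
    refine hasDerivWithinAt_quadForm_lyapunov (M := M s) ((h s hs).congr_deriv ?_) (hPs s hs)
      ((he s hs).congr_deriv (by rw [Pi.neg_apply, Matrix.neg_mulVec, add_zero]))
    rw [hMdef, Matrix.transpose_sub, Matrix.transpose_smul, Matrix.transpose_mul, hPs s hs,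
      hGs s hs, Matrix.sub_mul, Matrix.mul_sub, Matrix.smul_mul, Matrix.mul_smul,
      ← Matrix.mul_assoc]
    module
  have hmono := le_add_mul_of_deriv_le (c := 0) hab (fun s hs => (hderiv s hs).neg) fun s hs => by
    rw [Matrix.mulVec_zero, dotProduct_zero, mul_zero, add_zero, neg_nonpos]
    exact quadForm_nonneg (hS s hs) _
  have hstart := quadForm_nonneg h0 (e a)
  simp only [Pi.neg_apply, zero_mul, add_zero] at hmono
  linarith

section Bounds

variable [DecidableEq n]

theorem SolvesRiccatiOn.sub_smul_one (h : SolvesRiccatiOn A G S P a b)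
    (hGs : ∀ s ∈ Set.Icc a b, (G s)ᵀ = G s) (m : ℝ) :
    SolvesRiccatiOn (fun s => A s - m • G s) G (fun s => S s + m • (A s + (A s)ᵀ) - m ^ 2 • G s)
      (fun s => P s - m • 1) a b := fun s hs => by
  refine ((h s hs).sub (matHasDerivWithinAt_const _)).congr_deriv ?_
  simp only [Matrix.transpose_sub, Matrix.transpose_smul, hGs s hs, Matrix.sub_mul, Matrix.mul_sub,
    Matrix.smul_mul, Matrix.mul_smul, Matrix.mul_one, Matrix.one_mul]
  module

open scoped Matrix.Norms.L2Operator

variable {α γ s₁ s₂ : ℝ}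

theorem SolvesRiccatiOn.succeq_smul_one {m : ℝ} (h : SolvesRiccatiOn A G S P a b) (hab : a ≤ b)
    (hA : ContinuousOn A (Set.Icc a b)) (hG : ContinuousOn G (Set.Icc a b))
    (hGs : ∀ s ∈ Set.Icc a b, (G s)ᵀ = G s) (hAle : ∀ s ∈ Set.Icc a b, ‖A s‖ ≤ α)
    (hGle : ∀ s ∈ Set.Icc a b, ‖G s‖ ≤ γ) (hS : ∀ s ∈ Set.Icc a b, Succeq (S s) (s₁ • 1))
    (hm : 0 ≤ m) (hms : 2 * α * m + γ * m ^ 2 ≤ s₁) (h0 : Succeq (P a) (m • 1)) :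
    Succeq (P b) (m • 1) := by
  refine (h.sub_smul_one hGs m).posSemidef hab (hA.sub (hG.fun_const_smul m)) hG hGs
    (fun s hs => posSemidef_of_quadForm_nonneg ?_ fun z => ?_) h0
  · simp only [Matrix.transpose_sub, Matrix.transpose_add, Matrix.transpose_smul,
      Matrix.transpose_transpose, hGs s hs, transpose_eq_of_succeq_smul_one (hS s hs),
      add_comm (A s)ᵀ]
  · have hAz := neg_le_of_abs_le (abs_dotProduct_mulVec_self_le (hAle s hs) z)
    have hGz := (quadForm_le_norm_mul_eucl_sq (G s) z).trans
      (mul_le_mul_of_nonneg_right (hGle s hs) (sq_nonneg _))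
    have hSz := mul_eucl_sq_le_of_succeq (hS s hs) z
    have hsum := mul_le_mul_of_nonneg_right hms (sq_nonneg (eucl z))
    simp only [Matrix.sub_mulVec, Matrix.add_mulVec, Matrix.smul_mulVec, dotProduct_sub,
      dotProduct_add, dotProduct_smul, smul_eq_mul, Matrix.dotProduct_transpose_mulVec]
    linarith [mul_le_mul_of_nonneg_left hAz hm, mul_le_mul_of_nonneg_left hGz (sq_nonneg m)]

variable (hAle : ∀ s ∈ Set.Icc a b, ‖A s‖ ≤ α)
include hAle

theorem SolvesRiccatiOn.smul_one_succeq {p : ℝ} (h : SolvesRiccatiOn A G S P a b) (hab : a ≤ b)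
    (hA : ContinuousOn A (Set.Icc a b)) (hPs : ∀ s ∈ Set.Icc a b, (P s)ᵀ = P s)
    (hG : ∀ s ∈ Set.Icc a b, (G s).PosSemidef) (hS : ∀ s ∈ Set.Icc a b, Succeq (s₂ • 1) (S s))
    (hp : 0 ≤ p) (hs₂ : 0 ≤ s₂) (h0 : Succeq (p • 1) (P a)) :
    Succeq (((p + s₂ * (b - a)) * Real.exp (α * (b - a)) ^ 2) • 1) (P b) := by
  refine smul_one_succeq_of_le (hPs b (Set.right_mem_Icc.2 hab)) fun z => ?_
  obtain ⟨e, rfl, he⟩ :=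
    exists_hasDerivWithinAt_mulVec_of_right hab (continuousOn_transpose hA).neg z
  set E := Real.exp (α * (b - a))
  have hα : 0 ≤ α := (norm_nonneg _).trans (hAle a (Set.left_mem_Icc.2 hab))
  have hle : ∀ s ∈ Set.Icc a b, eucl (e s) ≤ E * eucl (e b) := fun s hs => by
    have hsub : Set.Icc s b ⊆ Set.Icc a b := Set.Icc_subset_Icc_left hs.1
    have hback := mul_exp_le_eucl_of_linear hs.2
      (fun r hr => (norm_neg _).trans_le ((norm_transpose _).trans_le (hAle r (hsub hr))))
      fun r hr => (he r (hsub hr)).mono hsub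
    rw [neg_mul, Real.exp_neg, ← div_eq_mul_inv, div_le_iff₀ (Real.exp_pos _), mul_comm] at hback
    refine hback.trans (mul_le_mul_of_nonneg_right (Real.exp_le_exp.2 ?_) (eucl_nonneg _))
    exact mul_le_mul_of_nonneg_left (by linarith [hs.1]) hα
  have hvalue := h.quadForm_le hab hPs hG (c := fun _ => 0) (κ := s₂ * (E * eucl (e b)) ^ 2)
    (fun s hs => (he s hs).congr_deriv (by simp [Matrix.neg_mulVec])) fun s hs => by
      rw [Matrix.mulVec_zero, dotProduct_zero, zero_add]
      refine (quadForm_le_of_succeq (hS s hs) _).trans ?_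
      exact mul_le_mul_of_nonneg_left (pow_le_pow_left₀ (eucl_nonneg _) (hle s hs) 2) hs₂
  calc e b ⬝ᵥ (P b *ᵥ e b)
      ≤ e a ⬝ᵥ (P a *ᵥ e a) + s₂ * (E * eucl (e b)) ^ 2 * (b - a) := hvalue
    _ ≤ p * (E * eucl (e b)) ^ 2 + s₂ * (E * eucl (e b)) ^ 2 * (b - a) := by
        refine add_le_add_left ((quadForm_le_of_succeq h0 _).trans ?_) _
        exact mul_le_mul_of_nonneg_left
          (pow_le_pow_left₀ (eucl_nonneg _) (hle a (Set.left_mem_Icc.2 hab)) 2) hp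
    _ = (p + s₂ * (b - a)) * E ^ 2 * eucl (e b) ^ 2 := by ring

theorem flow_bounds {F : ℝ → Matrix n n ℝ}
    (hF : ∀ s ∈ Set.Icc a b, MatHasDerivWithinAt F (A s * F s) (Set.Icc a b) s) (h0 : F a = 1)
    {s : ℝ} (hs : s ∈ Set.Icc a b) :
    IsUnit (F s) ∧ ‖F s‖ ≤ Real.exp (α * (b - a)) ∧ ‖(F s)⁻¹‖ ≤ Real.exp (α * (b - a)) := by
  have hsub : Set.Icc a s ⊆ Set.Icc a b := Set.Icc_subset_Icc_right hs.2
  have hA' : ∀ r ∈ Set.Icc a s, ‖A r‖ ≤ α := fun r hr => hAle r (hsub hr)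
  have hF' : ∀ r ∈ Set.Icc a s, MatHasDerivWithinAt F (A r * F r) (Set.Icc a s) r :=
    fun r hr => (hF r (hsub hr)).mono hsub
  have hexp : Real.exp (α * (s - a)) ≤ Real.exp (α * (b - a)) :=
    Real.exp_le_exp.2 (mul_le_mul_of_nonneg_left (by linarith [hs.2])
      ((norm_nonneg _).trans (hAle s hs)))
  exact ⟨isUnit_flow hA' hF' h0 hs.1, (norm_flow_le hA' hF' h0 hs.1).trans hexp,
    (norm_flow_inv_le hA' hF' h0 hs.1).trans hexp⟩

omit hAle in
theorem matHasDerivWithinAt_inv_transpose_flow {M : Matrix n n ℝ} {F : ℝ → Matrix n n ℝ} {J : Set ℝ}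
    {t : ℝ} (hF : MatHasDerivWithinAt F (M * F t) J t) (hunit : IsUnit (F t)) :
    MatHasDerivWithinAt (fun s => ((F s)⁻¹)ᵀ) (-(Mᵀ * ((F t)⁻¹)ᵀ)) J t := by
  refine (hF.inv hunit).transpose.congr_deriv ?_
  rw [Matrix.mul_assoc, Matrix.mul_assoc, Matrix.mul_nonsing_inv _
    ((Matrix.isUnit_iff_isUnit_det _).1 hunit), Matrix.mul_one, Matrix.transpose_neg,
    Matrix.transpose_mul]

end Bounds

section Gramian

open scoped Matrix.Norms.L2Operator

variable [DecidableEq n] {α γ s₂ w : ℝ} {F : ℝ → Matrix n n ℝ}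

/-- The state at time `s` of the adjoint system `e' = -Aᵀ e + G c`, `e a = 0`, under the control
`c = F q`, where `F` is the flow of `A` from time `a`. With `q = W⁻¹ Fᵀ z`, for the Gramian `W`,
this is the minimum energy control that steers `0` to `z`. -/
noncomputable def steering (G F : ℝ → Matrix n n ℝ) (a : ℝ) (q : n → ℝ) (s : ℝ) : n → ℝ :=
  ((F s)⁻¹)ᵀ *ᵥ (matIntegral (fun r => (F r)ᵀ * G r * F r) a s *ᵥ q)

theorem steering_self (q : n → ℝ) : steering G F a q a = 0 := by
  rw [steering, matIntegral_self, Matrix.zero_mulVec, Matrix.mulVec_zero]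

theorem hasDerivWithinAt_steering {M : Matrix n n ℝ} (hG : ContinuousOn G (Set.Icc a b))
    (hFc : ContinuousOn F (Set.Icc a b)) {s : ℝ} (hs : s ∈ Set.Icc a b)
    (hF : MatHasDerivWithinAt F (M * F s) (Set.Icc a b) s) (hunit : IsUnit (F s)) (q : n → ℝ) :
    HasDerivWithinAt (steering G F a q) (-(Mᵀ *ᵥ steering G F a q s) + G s *ᵥ (F s *ᵥ q))
      (Set.Icc a b) s := by
  have hint : ContinuousOn (fun s => (F s)ᵀ * G s * F s) (Set.Icc a b) :=
    continuousOn_matrix_mul (continuousOn_matrix_mul (continuousOn_transpose hFc) hG) hFc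
  have hcancel : ((F s)⁻¹)ᵀ * ((F s)ᵀ * G s * F s) = G s * F s := by
    rw [Matrix.mul_assoc, ← Matrix.mul_assoc, ← Matrix.transpose_mul,
      Matrix.mul_nonsing_inv _ ((Matrix.isUnit_iff_isUnit_det _).1 hunit), Matrix.transpose_one,
      Matrix.one_mul]
  refine ((matHasDerivWithinAt_inv_transpose_flow hF hunit).mulVec
    ((hasDerivWithinAt_matIntegral hint hs).mulVec
      (hasDerivWithinAt_const s _ q))).congr_deriv ?_
  rw [Matrix.mulVec_zero, add_zero, Matrix.mulVec_mulVec q ((F s)⁻¹)ᵀ, hcancel,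
    Matrix.neg_mulVec, ← Matrix.mulVec_mulVec, ← Matrix.mulVec_mulVec, steering]

theorem eucl_steering_le {E : ℝ} (hG : ContinuousOn G (Set.Icc a b))
    (hFc : ContinuousOn F (Set.Icc a b)) (hGle : ∀ s ∈ Set.Icc a b, ‖G s‖ ≤ γ)
    (hFle : ∀ s ∈ Set.Icc a b, ‖F s‖ ≤ E) (hFinv : ∀ s ∈ Set.Icc a b, ‖(F s)⁻¹‖ ≤ E) (q : n → ℝ)
    {s : ℝ} (hs : s ∈ Set.Icc a b) :
    eucl (steering G F a q s) ≤ γ * E ^ 3 * (b - a) * eucl q := by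
  have hsub : Set.Icc a s ⊆ Set.Icc a b := Set.Icc_subset_Icc_right hs.2
  have hint : ContinuousOn (fun s => (F s)ᵀ * G s * F s) (Set.Icc a b) :=
    continuousOn_matrix_mul (continuousOn_matrix_mul (continuousOn_transpose hFc) hG) hFc
  have hE : 0 ≤ E := (norm_nonneg _).trans (hFle s hs)
  have hγ : 0 ≤ γ := (norm_nonneg _).trans (hGle s hs)
  have hW : ‖matIntegral (fun r => (F r)ᵀ * G r * F r) a s‖ ≤ E * γ * E * (s - a) :=
    norm_matIntegral_le hs.1 (hint.mono hsub) fun r hr => by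
      have hr := hsub hr
      refine (norm_mul_le _ _).trans (mul_le_mul ((norm_mul_le _ _).trans ?_) (hFle r hr)
        (norm_nonneg _) (mul_nonneg hE hγ))
      rw [norm_transpose]
      exact mul_le_mul (hFle r hr) (hGle r hr) (norm_nonneg _) hE
  calc eucl (steering G F a q s)
      ≤ ‖((F s)⁻¹)ᵀ‖ * (‖matIntegral (fun r => (F r)ᵀ * G r * F r) a s‖ * eucl q) :=
        (eucl_mulVec_le _ _).trans
          (mul_le_mul_of_nonneg_left (eucl_mulVec_le _ _) (norm_nonneg _))
    _ ≤ E * (E * γ * E * (b - a) * eucl q) := by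
        rw [norm_transpose]
        have hlen : E * γ * E * (s - a) ≤ E * γ * E * (b - a) :=
          mul_le_mul_of_nonneg_left (by linarith [hs.2]) (by positivity)
        exact mul_le_mul (hFinv s hs)
          (mul_le_mul_of_nonneg_right (hW.trans hlen) (eucl_nonneg q))
          (mul_nonneg (norm_nonneg _) (eucl_nonneg q)) hE
    _ = γ * E ^ 3 * (b - a) * eucl q := by ring

theorem exists_steering_eq (hunit : IsUnit (F b)) (hw : 0 < w)
    (hW : Succeq (matIntegral (fun s => (F s)ᵀ * G s * F s) a b) (w • 1)) (z : n → ℝ) :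
    ∃ q, steering G F a q b = z ∧ w * eucl q ≤ ‖F b‖ * eucl z := by
  set W := matIntegral (fun s => (F s)ᵀ * G s * F s) a b
  have hWq : W *ᵥ (W⁻¹ *ᵥ ((F b)ᵀ *ᵥ z)) = (F b)ᵀ *ᵥ z := by
    rw [Matrix.mulVec_mulVec, Matrix.mul_nonsing_inv _ ((Matrix.isUnit_iff_isUnit_det _).1
      (posDef_of_succeq_smul_one hw hW).isUnit), Matrix.one_mulVec]
  refine ⟨W⁻¹ *ᵥ ((F b)ᵀ *ᵥ z), ?_, ?_⟩
  · rw [steering, hWq, Matrix.mulVec_mulVec, ← Matrix.transpose_mul, Matrix.mul_nonsing_inv _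
      ((Matrix.isUnit_iff_isUnit_det _).1 hunit), Matrix.transpose_one, Matrix.one_mulVec]
  · rw [← norm_transpose (F b)]
    refine (mul_eucl_le_eucl_mulVec hW _).trans ?_
    rw [hWq]
    exact eucl_mulVec_le _ _

theorem SolvesRiccatiOn.smul_one_succeq_of_gramian (h : SolvesRiccatiOn A G S P a b) (hab : a ≤ b)
    (hPs : ∀ s ∈ Set.Icc a b, (P s)ᵀ = P s) (hG : ContinuousOn G (Set.Icc a b))
    (hGpos : ∀ s ∈ Set.Icc a b, (G s).PosSemidef) (hAle : ∀ s ∈ Set.Icc a b, ‖A s‖ ≤ α)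
    (hGle : ∀ s ∈ Set.Icc a b, ‖G s‖ ≤ γ) (hS : ∀ s ∈ Set.Icc a b, Succeq (s₂ • 1) (S s))
    (hs₂ : 0 ≤ s₂) (hw : 0 < w)
    (hF : ∀ s ∈ Set.Icc a b, MatHasDerivWithinAt F (A s * F s) (Set.Icc a b) s) (h0 : F a = 1)
    (hW : Succeq (matIntegral (fun s => (F s)ᵀ * G s * F s) a b) (w • 1)) :
    Succeq (((γ * Real.exp (α * (b - a)) ^ 2
      + s₂ * (γ * Real.exp (α * (b - a)) ^ 3 * (b - a)) ^ 2) * (b - a)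
      * (Real.exp (α * (b - a)) / w) ^ 2) • 1) (P b) := by
  have hb := Set.right_mem_Icc.2 hab
  refine smul_one_succeq_of_le (hPs b hb) fun z => ?_
  have hFc : ContinuousOn F (Set.Icc a b) := fun s hs => (hF s hs).continuousWithinAt
  have hbounds : ∀ s ∈ Set.Icc a b, IsUnit (F s) ∧ ‖F s‖ ≤ Real.exp (α * (b - a)) ∧
      ‖(F s)⁻¹‖ ≤ Real.exp (α * (b - a)) := fun s hs => flow_bounds hAle hF h0 hs
  generalize Real.exp (α * (b - a)) = E at hbounds ⊢
  obtain ⟨q, hqz, hq⟩ := exists_steering_eq (hbounds b hb).1 hw hW z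
  have hvalue := h.quadForm_le hab hPs hGpos (c := fun s => F s *ᵥ q)
    (κ := γ * (E * eucl q) ^ 2 + s₂ * (γ * E ^ 3 * (b - a) * eucl q) ^ 2)
    (fun s hs => hasDerivWithinAt_steering hG hFc hs (hF s hs) (hbounds s hs).1 q) fun s hs => by
      have hFq : eucl (F s *ᵥ q) ≤ E * eucl q :=
        (eucl_mulVec_le _ _).trans
          (mul_le_mul_of_nonneg_right (hbounds s hs).2.1 (eucl_nonneg q))
      have hsteer := eucl_steering_le hG hFc hGle (fun r hr => (hbounds r hr).2.1)
        (fun r hr => (hbounds r hr).2.2) q hs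
      refine add_le_add ((quadForm_le_norm_mul_eucl_sq _ _).trans ?_)
        ((quadForm_le_of_succeq (hS s hs) _).trans ?_)
      · exact mul_le_mul (hGle s hs) (pow_le_pow_left₀ (eucl_nonneg _) hFq 2) (sq_nonneg _)
          ((norm_nonneg _).trans (hGle s hs))
      · exact mul_le_mul_of_nonneg_left (pow_le_pow_left₀ (eucl_nonneg _) hsteer 2) hs₂
  rw [steering_self, zero_dotProduct, zero_add, hqz] at hvalue
  have hqE : eucl q ≤ E / w * eucl z := by
    rw [div_mul_eq_mul_div, le_div_iff₀ hw, mul_comm]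
    exact hq.trans (mul_le_mul_of_nonneg_right (hbounds b hb).2.1 (eucl_nonneg z))
  have hγ : 0 ≤ γ := (norm_nonneg _).trans (hGle b hb)
  have _hlen : 0 ≤ b - a := sub_nonneg.2 hab
  calc z ⬝ᵥ (P b *ᵥ z)
      ≤ (γ * E ^ 2 + s₂ * (γ * E ^ 3 * (b - a)) ^ 2) * (b - a) * eucl q ^ 2 := by linarith
    _ ≤ (γ * E ^ 2 + s₂ * (γ * E ^ 3 * (b - a)) ^ 2) * (b - a) * (E / w * eucl z) ^ 2 := by
        gcongr
        exact eucl_nonneg q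
    _ = _ := by ring

end Gramian

section Lyapunov

variable [DecidableEq n] {x : ℝ → n → ℝ}

theorem hasDerivWithinAt_quadForm_inv {M G₀ S₀ : Matrix n n ℝ} {r : n → ℝ} {J : Set ℝ} {t : ℝ}
    (hP : MatHasDerivWithinAt P (M * P t + P t * Mᵀ - P t * G₀ * P t + S₀) J t)
    (hpos : (P t).PosDef) (hx : HasDerivWithinAt x (M *ᵥ x t - P t *ᵥ (G₀ *ᵥ x t) + r) J t) :
    HasDerivWithinAt (fun s => x s ⬝ᵥ ((P s)⁻¹ *ᵥ x s))
      (-(x t ⬝ᵥ (G₀ *ᵥ x t)) - ((P t)⁻¹ *ᵥ x t) ⬝ᵥ (S₀ *ᵥ ((P t)⁻¹ *ᵥ x t))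
        + 2 * (((P t)⁻¹ *ᵥ x t) ⬝ᵥ r)) J t := by
  have hdet : IsUnit (P t).det := (Matrix.isUnit_iff_isUnit_det _).1 hpos.isUnit
  have hsymm : ((P t)⁻¹)ᵀ = (P t)⁻¹ := by
    rw [Matrix.transpose_nonsing_inv, transpose_eq_of_posSemidef hpos.posSemidef]
  have hinv : MatHasDerivWithinAt (fun s => (P s)⁻¹)
      (-Mᵀ * (P t)⁻¹ + (P t)⁻¹ * (-Mᵀ)ᵀ + (G₀ - (P t)⁻¹ * S₀ * (P t)⁻¹)) J t := by
    refine (hP.inv hpos.isUnit).congr_deriv ?_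
    simp only [Matrix.mul_add, Matrix.mul_sub, Matrix.add_mul, Matrix.sub_mul, ← Matrix.mul_assoc,
      Matrix.nonsing_inv_mul _ hdet, Matrix.one_mul]
    simp only [Matrix.mul_assoc, Matrix.mul_nonsing_inv _ hdet, Matrix.mul_one,
      Matrix.transpose_neg, Matrix.transpose_transpose, Matrix.neg_mul, Matrix.mul_neg]
    abel
  refine (hasDerivWithinAt_quadForm_lyapunov hinv hsymm (hx.congr_deriv (f' := _)
    (g' := -((-Mᵀ)ᵀ *ᵥ x t) + (r - P t *ᵥ (G₀ *ᵥ x t))) ?_)).congr_deriv ?_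
  · rw [Matrix.transpose_neg, Matrix.transpose_transpose, Matrix.neg_mulVec, neg_neg]
    abel
  · have hflip : ∀ v, x t ⬝ᵥ ((P t)⁻¹ *ᵥ v) = ((P t)⁻¹ *ᵥ x t) ⬝ᵥ v := fun v => by
      rw [dotProduct_mulVec_comm hsymm, dotProduct_comm]
    rw [Matrix.sub_mulVec, ← Matrix.mulVec_mulVec, ← Matrix.mulVec_mulVec, dotProduct_sub, hflip,
      Matrix.mulVec_sub, dotProduct_sub, Matrix.mulVec_mulVec _ (P t)⁻¹ (P t),
      Matrix.nonsing_inv_mul _ hdet, Matrix.one_mulVec, hflip]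
    ring

variable {p s₁ : ℝ}

theorem eucl_sq_le_mul_quadForm_inv {M : Matrix n n ℝ} (hM : M.PosDef) (hp : 0 < p)
    (h : Succeq (p • 1) M) (z : n → ℝ) : eucl z ^ 2 ≤ p * (z ⬝ᵥ (M⁻¹ *ᵥ z)) := by
  have hcancel : M *ᵥ (M⁻¹ *ᵥ z) = z := by
    rw [Matrix.mulVec_mulVec, Matrix.mul_nonsing_inv _
      ((Matrix.isUnit_iff_isUnit_det _).1 hM.isUnit), Matrix.one_mulVec]
  simpa only [hcancel, dotProduct_comm (M⁻¹ *ᵥ z)] using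
    eucl_mulVec_sq_le hp hM.posSemidef h (M⁻¹ *ᵥ z)

theorem mul_quadForm_inv_le_eucl_sq {M : Matrix n n ℝ} (hp : 0 < p) (h : Succeq M (p • 1))
    (z : n → ℝ) : p * (z ⬝ᵥ (M⁻¹ *ᵥ z)) ≤ eucl z ^ 2 := by
  have hcancel : M *ᵥ (M⁻¹ *ᵥ z) = z := by
    rw [Matrix.mulVec_mulVec, Matrix.mul_nonsing_inv _
      ((Matrix.isUnit_iff_isUnit_det _).1 (posDef_of_succeq_smul_one hp h).isUnit),
      Matrix.one_mulVec]
  have hle := mul_eucl_le_eucl_mulVec h (M⁻¹ *ᵥ z)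
  rw [hcancel] at hle
  calc p * (z ⬝ᵥ (M⁻¹ *ᵥ z)) ≤ p * (eucl z * eucl (M⁻¹ *ᵥ z)) :=
        mul_le_mul_of_nonneg_left (dotProduct_le_eucl_mul_eucl _ _) hp.le
    _ = eucl z * (p * eucl (M⁻¹ *ᵥ z)) := by ring
    _ ≤ eucl z ^ 2 := by rw [sq]; exact mul_le_mul_of_nonneg_left hle (eucl_nonneg z)

theorem lyapunov_deriv_le {M G₀ S₀ : Matrix n n ℝ} {η r : n → ℝ} (hM : M.PosDef) (hp : 0 < p)
    (hMle : Succeq (p • 1) M) (hG : G₀.PosSemidef) (hs₁ : 0 ≤ s₁) (hS : Succeq S₀ (s₁ • 1))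
    (hr : 4 * p * eucl r ≤ s₁ * eucl (M *ᵥ η)) (z : n → ℝ) :
    -(z ⬝ᵥ (G₀ *ᵥ z)) - η ⬝ᵥ (S₀ *ᵥ η) + 2 * (η ⬝ᵥ r)
      ≤ -(s₁ / (2 * p)) * (η ⬝ᵥ (M *ᵥ η)) := by
  have hnorm : eucl (M *ᵥ η) ≤ p * eucl η :=
    (open scoped Matrix.Norms.L2Operator in
      (eucl_mulVec_le M η).trans (mul_le_mul_of_nonneg_right
        (norm_le_of_succeq hp hM.posSemidef hMle) (eucl_nonneg η)))
  have hrη : 4 * eucl r ≤ s₁ * eucl η := by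
    refine le_of_mul_le_mul_left ?_ hp
    linarith [mul_le_mul_of_nonneg_left hnorm hs₁]
  have hcross : 2 * (η ⬝ᵥ r) ≤ s₁ / 2 * eucl η ^ 2 := by
    linarith [dotProduct_le_eucl_mul_eucl η r, mul_le_mul_of_nonneg_left hrη (eucl_nonneg η)]
  have hquad : s₁ / (2 * p) * (η ⬝ᵥ (M *ᵥ η)) ≤ s₁ / 2 * eucl η ^ 2 := by
    calc s₁ / (2 * p) * (η ⬝ᵥ (M *ᵥ η)) ≤ s₁ / (2 * p) * (p * eucl η ^ 2) :=
          mul_le_mul_of_nonneg_left (quadForm_le_of_succeq hMle η) (by positivity)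
      _ = s₁ / 2 * eucl η ^ 2 := by field_simp
  linarith [quadForm_nonneg hG z, mul_eucl_sq_le_of_succeq hS η]

theorem SolvesRiccatiOn.eucl_error_le {r : ℝ → n → ℝ} {p₀ : ℝ} (h : SolvesRiccatiOn A G S P a b)
    (hab : a ≤ b) (hP : ∀ s ∈ Set.Icc a b, (P s).PosDef) (hp : 0 < p)
    (hPle : ∀ s ∈ Set.Icc a b, Succeq (p • 1) (P s)) (hp₀ : 0 < p₀) (hPa : Succeq (P a) (p₀ • 1))
    (hG : ∀ s ∈ Set.Icc a b, (G s).PosSemidef) (hs₁ : 0 ≤ s₁)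
    (hS : ∀ s ∈ Set.Icc a b, Succeq (S s) (s₁ • 1))
    (hx : ∀ s ∈ Set.Icc a b,
      HasDerivWithinAt x (A s *ᵥ x s - P s *ᵥ (G s *ᵥ x s) + r s) (Set.Icc a b) s)
    (hr : ∀ s ∈ Set.Icc a b, 4 * p * eucl (r s) ≤ s₁ * eucl (x s)) :
    eucl (x b) ≤ √(p / p₀) * Real.exp (-(s₁ / (4 * p)) * (b - a)) * eucl (x a) := by
  have hdecay := le_mul_exp_of_deriv_le (K := -(s₁ / (2 * p))) hab
    (fun s hs => hasDerivWithinAt_quadForm_inv (h s hs) (hP s hs) (hx s hs)) fun s hs => by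
      have hcancel : P s *ᵥ ((P s)⁻¹ *ᵥ x s) = x s := by
        rw [Matrix.mulVec_mulVec, Matrix.mul_nonsing_inv _
          ((Matrix.isUnit_iff_isUnit_det _).1 (hP s hs).isUnit), Matrix.one_mulVec]
      have := lyapunov_deriv_le (hP s hs) hp (hPle s hs) (hG s hs) hs₁ (hS s hs)
        (η := (P s)⁻¹ *ᵥ x s) (hcancel.symm ▸ hr s hs) (x s)
      rwa [hcancel, dotProduct_comm ((P s)⁻¹ *ᵥ x s) (x s)] at this
  refine abs_le_of_sq_le_sq' ?_ (mul_nonneg (by positivity) (eucl_nonneg _)) |>.2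
  have hend := eucl_sq_le_mul_quadForm_inv (hP b (Set.right_mem_Icc.2 hab)) hp
    (hPle b (Set.right_mem_Icc.2 hab)) (x b)
  have hstart : x a ⬝ᵥ ((P a)⁻¹ *ᵥ x a) ≤ eucl (x a) ^ 2 / p₀ := by
    rw [le_div_iff₀ hp₀, mul_comm]
    exact mul_quadForm_inv_le_eucl_sq hp₀ hPa (x a)
  have hexp : Real.exp (-(s₁ / (4 * p)) * (b - a)) ^ 2 = Real.exp (-(s₁ / (2 * p)) * (b - a)) := by
    rw [← Real.exp_nat_mul]
    congr 1
    push_cast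
    field_simp
    ring
  rw [mul_pow, mul_pow, Real.sq_sqrt (by positivity), hexp]
  calc eucl (x b) ^ 2
      ≤ p * (eucl (x a) ^ 2 / p₀ * Real.exp (-(s₁ / (2 * p)) * (b - a))) :=
        hend.trans (mul_le_mul_of_nonneg_left (hdecay.trans
          (mul_le_mul_of_nonneg_right hstart (Real.exp_pos _).le)) hp.le)
    _ = p / p₀ * Real.exp (-(s₁ / (2 * p)) * (b - a)) * eucl (x a) ^ 2 := by ring

end Lyapunov

end Riccati

/-! ### Uniformly observable error systems -/

section ErrorSystem

open scoped Matrix.Norms.L2Operator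

variable {n : Type}

theorem Succeq.smul_one_mono [DecidableEq n] {M : Matrix n n ℝ} {c c' : ℝ}
    (h : Succeq (c • 1) M) (hc : c ≤ c') : Succeq (c' • 1) M := by
  have hsum := h.add (Matrix.PosSemidef.one.smul (sub_nonneg.2 hc))
  rwa [sub_smul, sub_add_sub_cancel', ← Succeq] at hsum

variable [Fintype n]

theorem SolvesRiccatiOn.exists_smul_one_succeq [DecidableEq n] {α γ s₂ w δ p : ℝ}
    (hα : 0 ≤ α) (hγ : 0 ≤ γ) (hs₂ : 0 ≤ s₂) (hw : 0 < w) (hδ : 0 ≤ δ) (hp : 0 < p) :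
    ∃ M : ℝ, 0 < M ∧ ∀ (A G S P : ℝ → Matrix n n ℝ) (a b : ℝ), SolvesRiccatiOn A G S P a b → a ≤ b →
      ContinuousOn A (Set.Icc a b) → ContinuousOn G (Set.Icc a b) →
      (∀ s ∈ Set.Icc a b, ‖A s‖ ≤ α) →
      (∀ s ∈ Set.Icc a b, (G s).PosSemidef ∧ ‖G s‖ ≤ γ) →
      (∀ s ∈ Set.Icc a b, Succeq (s₂ • 1) (S s)) → (∀ s ∈ Set.Icc a b, (P s)ᵀ = P s) →
      (a ≤ b - δ → ∃ F : ℝ → Matrix n n ℝ,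
        (∀ s ∈ Set.Icc (b - δ) b, MatHasDerivWithinAt F (A s * F s) (Set.Icc (b - δ) b) s) ∧
        F (b - δ) = 1 ∧
        Succeq (matIntegral (fun s => (F s)ᵀ * G s * F s) (b - δ) b) (w • 1)) →
      Succeq (p • 1) (P a) → Succeq (M • 1) (P b) := by
  set E := Real.exp (α * δ) with hE
  have hbound : 0 ≤ (γ * E ^ 2 + s₂ * (γ * E ^ 3 * δ) ^ 2) * δ * (E / w) ^ 2 := by positivity
  have hgrowth : 0 < (p + s₂ * δ) * E ^ 2 := by positivity
  refine ⟨_, add_pos_of_pos_of_nonneg hgrowth hbound,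
    fun A G S P a b h hab hA hG hAle hGle hS hPs hobs h0 => ?_⟩
  rcases le_total a (b - δ) with hle | hle
  · obtain ⟨F, hF, hF0, hW⟩ := hobs hle
    have hsub : Set.Icc (b - δ) b ⊆ Set.Icc a b := Set.Icc_subset_Icc_left hle
    have hlater := (h.mono hle le_rfl).smul_one_succeq_of_gramian (sub_le_self b hδ)
      (fun s hs => hPs s (hsub hs)) (hG.mono hsub) (fun s hs => (hGle s (hsub hs)).1)
      (fun s hs => hAle s (hsub hs)) (fun s hs => (hGle s (hsub hs)).2)
      (fun s hs => hS s (hsub hs)) hs₂ hw hF hF0 hW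
    rw [sub_sub_cancel, ← hE] at hlater
    exact hlater.smul_one_mono (le_add_of_nonneg_left hgrowth.le)
  · refine (h.smul_one_succeq hAle hab hA hPs (fun s hs => (hGle s hs).1) hS hp.le hs₂
      h0).smul_one_mono (le_add_of_le_of_nonneg ?_ hbound)
    have hlen : b - a ≤ δ := by linarith
    rw [hE]
    gcongr

/-- The data of an error system `x' = A(t, x) x - P G x + ρ(t, x)`, where `P` solves the Riccati
equation `P' = A(t, x) P + P A(t, x)ᵀ - P G P + S`. -/
structure ErrorSystem (n : Type) where
  /-- The linear part, which may depend on the state. -/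
  A : ℝ → (n → ℝ) → Matrix n n ℝ
  /-- The information rate `Cᵀ D C`. -/
  G : ℝ → Matrix n n ℝ
  /-- The forcing term of the Riccati equation. -/
  S : ℝ → Matrix n n ℝ
  /-- The remainder. -/
  ρ : ℝ → (n → ℝ) → n → ℝ

namespace ErrorSystem

/-- The right-hand side of the equation for the error `x`. -/
def errorRhs (E : ErrorSystem n) (t : ℝ) (x : n → ℝ) (P : Matrix n n ℝ) : n → ℝ :=
  E.A t x *ᵥ x - P *ᵥ (E.G t *ᵥ x) + E.ρ t x

/-- The right-hand side of the Riccati equation. -/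
def riccatiRhs (E : ErrorSystem n) (t : ℝ) (x : n → ℝ) (P : Matrix n n ℝ) : Matrix n n ℝ :=
  E.A t x * P + P * (E.A t x)ᵀ - P * E.G t * P + E.S t

/-- `(x, P)` solves the error system on `J`. -/
def IsSolutionOn (E : ErrorSystem n) (J : Set ℝ) (x : ℝ → n → ℝ) (P : ℝ → Matrix n n ℝ) : Prop :=
  ∀ t ∈ J, HasDerivWithinAt x (E.errorRhs t (x t) (P t)) J t ∧
    MatHasDerivWithinAt P (E.riccatiRhs t (x t) (P t)) J t

/-- The standing assumptions on the coefficients of an error system: they are continuous in time,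
locally Lipschitz in the state, and uniformly bounded in time, and the remainder is of smaller order
than the state. -/
structure IsRegular [DecidableEq n] (E : ErrorSystem n) : Prop where
  continuousOn_A : ContinuousOn (Function.uncurry E.A) (Set.Ici 0 ×ˢ Set.univ)
  norm_A_le : ∃ α : ℝ, ∀ t, 0 ≤ t → ∀ x, ‖E.A t x‖ ≤ α
  unifLip_A : ∀ (T r : ℝ) (i j : n),
    UnifLip (Set.Icc 0 T) (Metric.closedBall 0 r) fun t x => E.A t x i j
  continuousOn_G : ContinuousOn E.G (Set.Ici 0)
  posSemidef_G : ∀ t, 0 ≤ t → (E.G t).PosSemidef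
  norm_G_le : ∃ γ : ℝ, ∀ t, 0 ≤ t → ‖E.G t‖ ≤ γ
  isWeight_S : IsWeight E.S
  continuousOn_ρ : ∀ x, ContinuousOn (fun t => E.ρ t x) (Set.Ici 0)
  unifLip_ρ : ∀ (T r : ℝ) (i : n),
    UnifLip (Set.Icc 0 T) (Metric.closedBall 0 r) fun t x => E.ρ t x i
  eucl_ρ_le : ∀ c : ℝ, 0 < c → ∃ r : ℝ, 0 < r ∧ ∀ t, 0 ≤ t → ∀ x, eucl x ≤ r →
    eucl (E.ρ t x) ≤ c * eucl x

/-- Uniform observability of `(A(t, x(t)), G)` along all small continuous curves `x`. -/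
def UniformlyObservable [DecidableEq n] (E : ErrorSystem n) : Prop :=
  ∃ ε δ w : ℝ, 0 < ε ∧ 0 < δ ∧ 0 < w ∧ ∀ x : ℝ → n → ℝ, Continuous x → (∀ t, eucl (x t) ≤ ε) →
    ∃ Φ, IsTransitionMatrix (fun t => E.A t (x t)) Φ ∧ ∀ t, 0 ≤ t →
      Succeq (matIntegral (fun s => (Φ s t)ᵀ * E.G s * Φ s t) t (t + δ)) (w • 1)

variable {E : ErrorSystem n} {x : ℝ → n → ℝ} {P : ℝ → Matrix n n ℝ} {t₀ T : ℝ}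

theorem IsSolutionOn.mono {J J' : Set ℝ} (h : E.IsSolutionOn J x P) (hJ : J' ⊆ J) :
    E.IsSolutionOn J' x P := fun t ht => ⟨(h t (hJ ht)).1.mono hJ, (h t (hJ ht)).2.mono hJ⟩

theorem IsSolutionOn.continuousOn {J : Set ℝ} (h : E.IsSolutionOn J x P) : ContinuousOn x J :=
  fun t ht => (h t ht).1.continuousWithinAt

theorem IsSolutionOn.solvesRiccatiOn (h : E.IsSolutionOn (Set.Icc t₀ T) x P) :
    SolvesRiccatiOn (fun s => E.A s (x s)) E.G E.S P t₀ T := fun s hs => (h s hs).2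

namespace IsRegular

variable [DecidableEq n] (hE : E.IsRegular)
include hE

theorem continuousOn_A_comp (ht₀ : 0 ≤ t₀) (hx : ContinuousOn x (Set.Icc t₀ T)) :
    ContinuousOn (fun s => E.A s (x s)) (Set.Icc t₀ T) :=
  hE.continuousOn_A.comp (continuousOn_id.prodMk hx) fun _ hs => ⟨ht₀.trans hs.1, Set.mem_univ _⟩

theorem transpose_eq (ht₀ : 0 ≤ t₀) (h : E.IsSolutionOn (Set.Icc t₀ T) x P)
    (h0 : (P t₀)ᵀ = P t₀) : ∀ s ∈ Set.Icc t₀ T, (P s)ᵀ = P s := by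
  obtain ⟨-, s₁, s₂, -, -, hS⟩ := hE.isWeight_S
  exact h.solvesRiccatiOn.transpose_eq (hE.continuousOn_A_comp ht₀ h.continuousOn)
    (hE.continuousOn_G.mono fun s hs => ht₀.trans hs.1)
    (fun s hs => transpose_eq_of_posSemidef (hE.posSemidef_G s (ht₀.trans hs.1)))
    (fun s hs => transpose_eq_of_succeq_smul_one (hS s (ht₀.trans hs.1)).1) h0

theorem exists_succeq_smul_one {p : ℝ} (hp : 0 < p) :
    ∃ m : ℝ, 0 < m ∧ ∀ t₀ T, 0 ≤ t₀ → t₀ ≤ T → ∀ x P, E.IsSolutionOn (Set.Icc t₀ T) x P →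
      Succeq (P t₀) (p • 1) → Succeq (P T) (m • 1) := by
  obtain ⟨α, hα⟩ := hE.norm_A_le
  obtain ⟨γ, hγ⟩ := hE.norm_G_le
  obtain ⟨-, s₁, s₂, hs₁, -, hS⟩ := hE.isWeight_S
  obtain ⟨m, hm, hmp, hms⟩ : ∃ m, 0 < m ∧ m ≤ p ∧ 2 * α * m + γ * m ^ 2 ≤ s₁ := by
    have hlim : Filter.Tendsto (fun m : ℝ => 2 * α * m + γ * m ^ 2) (nhdsWithin 0 (Set.Ioi 0))
        (nhds (2 * α * 0 + γ * 0 ^ 2)) :=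
      (Continuous.tendsto (by fun_prop) 0).mono_left nhdsWithin_le_nhds
    have hsmall := hlim.eventually_le_const (u := s₁) (by simpa using hs₁)
    obtain ⟨m, hms, hm, hmp⟩ := (hsmall.and (Ioc_mem_nhdsGT hp)).exists
    exact ⟨m, hm, hmp, hms⟩
  refine ⟨m, hm, fun t₀ T ht₀ hT x P h h0 => ?_⟩
  have hnonneg : Set.Icc t₀ T ⊆ Set.Ici 0 := fun s hs => ht₀.trans hs.1
  refine h.solvesRiccatiOn.succeq_smul_one hT (hE.continuousOn_A_comp ht₀ h.continuousOn)
    (hE.continuousOn_G.mono hnonneg)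
    (fun s hs => transpose_eq_of_posSemidef (hE.posSemidef_G s (hnonneg hs)))
    (fun s hs => hα s (hnonneg hs) _) (fun s hs => hγ s (hnonneg hs))
    (fun s hs => (hS s (hnonneg hs)).1) hm.le hms ?_
  have hsum := Matrix.PosSemidef.add h0 (Matrix.PosSemidef.one.smul (sub_nonneg.2 hmp))
  rwa [sub_smul, sub_add_sub_cancel, ← Succeq] at hsum

/- Observability is only assumed along curves defined for all times, so the solution is extended by
constants outside `[t₀, T]`. -/
theorem exists_smul_one_succeq (hobs : E.UniformlyObservable) {p : ℝ} (hp : 0 < p) :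
    ∃ ε M : ℝ, 0 < ε ∧ 0 < M ∧ ∀ t₀ T, 0 ≤ t₀ → t₀ ≤ T → ∀ x P,
      E.IsSolutionOn (Set.Icc t₀ T) x P → (∀ s ∈ Set.Icc t₀ T, eucl (x s) ≤ ε) →
      (P t₀)ᵀ = P t₀ → Succeq (p • 1) (P t₀) → Succeq (M • 1) (P T) := by
  obtain ⟨α, hα⟩ := hE.norm_A_le
  obtain ⟨γ, hγ⟩ := hE.norm_G_le
  obtain ⟨-, s₁, s₂, -, hs₂, hS⟩ := hE.isWeight_S
  obtain ⟨ε, δ, w, hε, hδ, hw, hobs⟩ := hobs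
  obtain ⟨M, hM, hbound⟩ := SolvesRiccatiOn.exists_smul_one_succeq (n := n)
    ((norm_nonneg _).trans (hα 0 le_rfl 0)) ((norm_nonneg _).trans (hγ 0 le_rfl)) hs₂.le hw hδ.le hp
  refine ⟨ε, M, hε, hM, fun t₀ T ht₀ hT x P h hsmall hsymm h0 => ?_⟩
  have hnonneg : Set.Icc t₀ T ⊆ Set.Ici 0 := fun s hs => ht₀.trans hs.1
  refine hbound _ _ _ _ t₀ T h.solvesRiccatiOn hT (hE.continuousOn_A_comp ht₀ h.continuousOn)
    (hE.continuousOn_G.mono hnonneg) (fun s hs => hα s (hnonneg hs) _)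
    (fun s hs => ⟨hE.posSemidef_G s (hnonneg hs), hγ s (hnonneg hs)⟩)
    (fun s hs => (hS s (hnonneg hs)).2) (hE.transpose_eq ht₀ h hsymm) (fun hle => ?_) h0
  obtain ⟨Φ, hΦ, hW⟩ := hobs (Set.IccExtend hT ((Set.Icc t₀ T).domRestrict x))
    (h.continuousOn.domRestrict.Icc_extend') fun t => hsmall _ (Set.projIcc t₀ T hT t).2
  have ht : 0 ≤ T - δ := ht₀.trans hle
  refine ⟨fun s => Φ s (T - δ), fun s hs => ?_, (hΦ _ ht).1, ?_⟩
  · have hderiv := ((hΦ _ ht).2 s hs.1).mono (K := Set.Icc (T - δ) T) Set.Icc_subset_Ici_self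
    dsimp only at hderiv
    rwa [Set.IccExtend_of_mem _ _ ⟨hle.trans hs.1, hs.2⟩] at hderiv
  · simpa only [sub_add_cancel] using hW _ ht

/-- Where the state is small, the remainder is dominated by the decay of the Lyapunov function
`x ⬝ᵥ P⁻¹ *ᵥ x`. -/
theorem exists_decay_of_eucl_le (hobs : E.UniformlyObservable) {p₁ p₂ : ℝ} (hp₁ : 0 < p₁)
    (hp₂ : 0 < p₂) :
    ∃ r k l m M : ℝ, 0 < r ∧ 0 < k ∧ 0 < l ∧ 0 < m ∧ 0 < M ∧ ∀ t₀ T, 0 ≤ t₀ → t₀ ≤ T → ∀ x P,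
      E.IsSolutionOn (Set.Icc t₀ T) x P → (∀ s ∈ Set.Icc t₀ T, eucl (x s) ≤ r) →
      Succeq (P t₀) (p₁ • 1) → Succeq (p₂ • 1) (P t₀) →
      eucl (x T) ≤ k * Real.exp (-l * (T - t₀)) * eucl (x t₀) ∧
        Succeq (P T) (m • 1) ∧ Succeq (M • 1) (P T) := by
  obtain ⟨m, hm, hlower⟩ := hE.exists_succeq_smul_one hp₁
  obtain ⟨ε, M, hε, hM, hupper⟩ := hE.exists_smul_one_succeq hobs hp₂
  obtain ⟨-, s₁, s₂, hs₁, -, hS⟩ := hE.isWeight_S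
  obtain ⟨r, hr, hρ⟩ := hE.eucl_ρ_le (s₁ / (4 * M)) (by positivity)
  refine ⟨min ε r, √(M / p₁), s₁ / (4 * M), m, M, lt_min hε hr, by positivity, by positivity, hm,
    hM, fun t₀ T ht₀ hT x P h hsmall hP₁ hP₂ => ?_⟩
  have hbounds : ∀ s ∈ Set.Icc t₀ T, Succeq (P s) (m • 1) ∧ Succeq (M • 1) (P s) := fun s hs => by
    have hsub : Set.Icc t₀ s ⊆ Set.Icc t₀ T := Set.Icc_subset_Icc_right hs.2
    exact ⟨hlower t₀ s ht₀ hs.1 x P (h.mono hsub) hP₁, hupper t₀ s ht₀ hs.1 x P (h.mono hsub)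
      (fun q hq => (hsmall q (hsub hq)).trans (min_le_left _ _))
      (transpose_eq_of_succeq_smul_one hP₁) hP₂⟩
  refine ⟨?_, hbounds T (Set.right_mem_Icc.2 hT)⟩
  refine h.solvesRiccatiOn.eucl_error_le hT
    (fun s hs => posDef_of_succeq_smul_one hm (hbounds s hs).1) hM
    (fun s hs => (hbounds s hs).2) hp₁ hP₁ (fun s hs => hE.posSemidef_G s (ht₀.trans hs.1)) hs₁.le
    (fun s hs => (hS s (ht₀.trans hs.1)).1) (fun s hs => (h s hs).1) fun s hs => ?_
  have hrem := hρ s (ht₀.trans hs.1) (x s) ((hsmall s hs).trans (min_le_right _ _))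
  calc 4 * M * eucl (E.ρ s (x s)) ≤ 4 * M * (s₁ / (4 * M) * eucl (x s)) := by gcongr
    _ = s₁ * eucl (x s) := by field_simp

theorem exists_decay (hobs : E.UniformlyObservable) {p₁ p₂ : ℝ} (hp₁ : 0 < p₁) (hp₂ : 0 < p₂) :
    ∃ r k l m M : ℝ, 0 < r ∧ 0 < k ∧ 0 < l ∧ 0 < m ∧ 0 < M ∧ ∀ t₀ T, 0 ≤ t₀ → t₀ ≤ T → ∀ x P,
      E.IsSolutionOn (Set.Icc t₀ T) x P → eucl (x t₀) < r →
      Succeq (P t₀) (p₁ • 1) → Succeq (p₂ • 1) (P t₀) →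
      eucl (x T) ≤ k * Real.exp (-l * (T - t₀)) * eucl (x t₀) ∧
        Succeq (P T) (m • 1) ∧ Succeq (M • 1) (P T) := by
  obtain ⟨r, k, l, m, M, hr, hk, hl, hm, hM, hdecay⟩ := hE.exists_decay_of_eucl_le hobs hp₁ hp₂
  refine ⟨r / (k + 1), k, l, m, M, by positivity, hk, hl, hm, hM,
    fun t₀ T ht₀ hT x P h hx₀ hP₁ hP₂ => ?_⟩
  rw [lt_div_iff₀ (by positivity)] at hx₀
  have hsmall : ∀ s ∈ Set.Icc t₀ T, eucl (x s) < r := by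
    refine forall_lt_of_bootstrap (continuous_eucl.comp_continuousOn h.continuousOn)
      (by nlinarith [eucl_nonneg (x t₀)]) fun τ hτ hle => ?_
    have hexp : Real.exp (-l * (τ - t₀)) ≤ 1 :=
      Real.exp_le_one_iff.2 (by nlinarith [hτ.1])
    calc eucl (x τ) ≤ k * Real.exp (-l * (τ - t₀)) * eucl (x t₀) :=
          (hdecay t₀ τ ht₀ hτ.1 x P (h.mono (Set.Icc_subset_Icc_right hτ.2)) hle hP₁ hP₂).1
      _ ≤ k * 1 * eucl (x t₀) := by gcongr; exact eucl_nonneg _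
      _ < r := by nlinarith [eucl_nonneg (x t₀)]
  exact hdecay t₀ T ht₀ hT x P h (fun s hs => (hsmall s hs).le) hP₁ hP₂

end IsRegular

/-- The joint right-hand side for the error and the Riccati matrix. The matrix is represented by its
entries, since matrices carry no global norm. -/
def jointRhs (E : ErrorSystem n) (t : ℝ) (z : (n → ℝ) × (n → n → ℝ)) : (n → ℝ) × (n → n → ℝ) :=
  (E.errorRhs t z.1 (Matrix.of z.2), E.riccatiRhs t z.1 (Matrix.of z.2))

theorem isSolutionOn_of_isIntegralCurveOn {J : Set ℝ} {z : ℝ → (n → ℝ) × (n → n → ℝ)}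
    (hz : IsIntegralCurveOn z E.jointRhs J) :
    E.IsSolutionOn J (fun t => (z t).1) fun t => Matrix.of (z t).2 := fun t ht => by
  have hfst := (hasFDerivAt_fst (𝕜 := ℝ) (p := z t)).comp_hasDerivWithinAt t (hz t ht)
  have hsnd := (hasFDerivAt_snd (𝕜 := ℝ) (p := z t)).comp_hasDerivWithinAt t (hz t ht)
  exact ⟨hfst, fun i j => hasDerivWithinAt_pi.1 (hasDerivWithinAt_pi.1 hsnd i) j⟩

namespace IsRegular

variable [DecidableEq n] (hE : E.IsRegular)
include hE

theorem continuousOn_jointRhs (z : (n → ℝ) × (n → n → ℝ)) :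
    ContinuousOn (fun t => E.jointRhs t z) (Set.Ici 0) := by
  have hA : ContinuousOn (fun t => E.A t z.1) (Set.Ici 0) :=
    hE.continuousOn_A.comp (f := fun t : ℝ => (t, z.1)) (by fun_prop)
      fun t ht => ⟨ht, Set.mem_univ _⟩
  refine ContinuousOn.prodMk ?_ ?_
  · exact ((continuousOn_mulVec hA continuousOn_const).sub (continuousOn_mulVec continuousOn_const
      (continuousOn_mulVec hE.continuousOn_G continuousOn_const))).add (hE.continuousOn_ρ z.1)
  · exact (((continuousOn_matrix_mul hA continuousOn_const).add
      (continuousOn_matrix_mul continuousOn_const (continuousOn_transpose hA))).sub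
      (continuousOn_matrix_mul (continuousOn_matrix_mul continuousOn_const hE.continuousOn_G)
        continuousOn_const)).add hE.isWeight_S.1

theorem exists_lipschitzOnWith_jointRhs (ht₀ : 0 ≤ t₀) (T r : ℝ) :
    ∃ K : NNReal, ∀ t ∈ Set.Icc t₀ T, LipschitzOnWith K (E.jointRhs t) (Metric.closedBall 0 r) := by
  set I := Set.Icc t₀ T
  set B := Metric.closedBall (0 : (n → ℝ) × (n → n → ℝ)) r
  have hI : I ⊆ Set.Icc 0 T := Set.Icc_subset_Icc_left ht₀
  have hnonneg : I ⊆ Set.Ici 0 := fun t ht => ht₀.trans ht.1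
  have hmaps : Set.MapsTo Prod.fst B (Metric.closedBall (0 : n → ℝ) r) := fun z hz =>
    mem_closedBall_zero_iff.2 ((norm_fst_le z).trans (mem_closedBall_zero_iff.1 hz))
  have hA : ∀ i j, UnifLip I B fun t z => E.A t z.1 i j := fun i j =>
    ((hE.unifLip_A T r i j).mono hI subset_rfl).comp LipschitzWith.prod_fst hmaps
  have hρ : ∀ i, UnifLip I B fun t z => E.ρ t z.1 i := fun i =>
    ((hE.unifLip_ρ T r i).mono hI subset_rfl).comp LipschitzWith.prod_fst hmaps
  have hG : ∀ i j, UnifLip I B fun t _ => E.G t i j := fun i j =>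
    unifLip_of_continuousOn (continuousOn_matrix_elem (hE.continuousOn_G.mono hnonneg) i j)
  have hS : ∀ i j, UnifLip I B fun t _ => E.S t i j := fun i j =>
    unifLip_of_continuousOn (continuousOn_matrix_elem (hE.isWeight_S.1.mono hnonneg) i j)
  have hx : ∀ i, UnifLip I B fun _ z => z.1 i := fun i =>
    unifLip_of_lipschitzWith ((LipschitzWith.eval i).comp LipschitzWith.prod_fst)
      Metric.isBounded_closedBall
  have hP : ∀ i j, UnifLip I B fun _ z => Matrix.of z.2 i j := fun i j =>
    unifLip_of_lipschitzWith
      ((LipschitzWith.eval j).comp ((LipschitzWith.eval i).comp LipschitzWith.prod_snd))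
      Metric.isBounded_closedBall
  obtain ⟨K₁, hK₁⟩ := exists_lipschitzOnWith_pi fun i =>
    (((UnifLip.matrix_mulVec hA hx i).sub (UnifLip.matrix_mulVec hP
      (UnifLip.matrix_mulVec hG hx) i)).add (hρ i)).exists_lipschitzOnWith
  obtain ⟨K₂, hK₂⟩ := exists_lipschitzOnWith_pi fun i => exists_lipschitzOnWith_pi fun j =>
    ((((UnifLip.matrix_mul hA hP i j).add (UnifLip.matrix_mul hP (fun i j => hA j i) i j)).sub
      (UnifLip.matrix_mul (UnifLip.matrix_mul hP hG) hP i j)).add (hS i j)).exists_lipschitzOnWith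
  exact ⟨max K₁ K₂, fun t ht => (hK₁ t ht).prodMk (hK₂ t ht)⟩

theorem exists_isSolutionOn_Ici {x₀ : n → ℝ} {P₀ : Matrix n n ℝ} {c M : ℝ} (ht₀ : 0 ≤ t₀)
    (hbound : ∀ T, t₀ ≤ T → ∀ x P, E.IsSolutionOn (Set.Icc t₀ T) x P → x t₀ = x₀ → P t₀ = P₀ →
      eucl (x T) ≤ c ∧ ‖P T‖ ≤ M) :
    ∃ x P, E.IsSolutionOn (Set.Ici t₀) x P ∧ x t₀ = x₀ ∧ P t₀ = P₀ := by
  obtain ⟨z, hz₀, hz⟩ := exists_isIntegralCurveOn_Ici (z₀ := (x₀, Matrix.of.symm P₀))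
    (fun z => (hE.continuousOn_jointRhs z).mono (Set.Ici_subset_Ici.2 ht₀))
    (hE.exists_lipschitzOnWith_jointRhs ht₀) fun _ => ⟨max c M, fun T hT z hz₀ hz => by
      obtain ⟨hx, hP⟩ := hbound T hT.1 _ _ (isSolutionOn_of_isIntegralCurveOn hz)
        (congrArg Prod.fst hz₀) (congrArg (fun z => Matrix.of z.2) hz₀)
      have hM : 0 ≤ M := (norm_nonneg _).trans hP
      exact max_le_max ((norm_le_eucl _).trans hx) <| (pi_norm_le_iff_of_nonneg hM).2 fun i =>
        (pi_norm_le_iff_of_nonneg hM).2 fun j => (abs_apply_le_norm _ i j).trans hP⟩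
  exact ⟨_, _, isSolutionOn_of_isIntegralCurveOn hz, congrArg Prod.fst hz₀,
    congrArg (fun z => Matrix.of z.2) hz₀⟩

end IsRegular

theorem locallyExpStable {E : ErrorSystem Idx7} (hE : E.IsRegular) (hobs : E.UniformlyObservable) :
    LocallyExpStable E.errorRhs E.riccatiRhs := by
  intro p₁ p₂ hp₁ hp₂
  obtain ⟨r, k, l, m, M, hr, hk, hl, hm, hM, hdecay⟩ := hE.exists_decay hobs hp₁ hp₂
  refine ⟨r, k, l, hr, hk, hl, fun t₀ ht₀ x₀ P₀ hx₀ hP₁ hP₂ => ?_⟩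
  have hdecay₀ : ∀ T, t₀ ≤ T → ∀ x P, E.IsSolutionOn (Set.Icc t₀ T) x P → x t₀ = x₀ → P t₀ = P₀ →
      eucl (x T) ≤ k * Real.exp (-l * (T - t₀)) * eucl x₀ ∧
        Succeq (P T) (m • 1) ∧ Succeq (M • 1) (P T) := by
    rintro T hT x P h rfl rfl
    exact hdecay t₀ T ht₀ hT x P h hx₀ hP₁ hP₂
  refine ⟨?_, fun T _ x P h hx hP t ht => ?_⟩
  · obtain ⟨x, P, h, hx, hP⟩ := hE.exists_isSolutionOn_Ici (c := k * eucl x₀) (M := M) ht₀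
      fun T hT x P h hx hP => by
        obtain ⟨hxT, hPm, hPM⟩ := hdecay₀ T hT x P h hx hP
        refine ⟨hxT.trans (mul_le_mul_of_nonneg_right (mul_le_of_le_one_right hk.le
          (Real.exp_le_one_iff.2 ?_)) (eucl_nonneg x₀)),
          norm_le_of_succeq hM (posDef_of_succeq_smul_one hm hPm).posSemidef hPM⟩
        nlinarith
    exact ⟨x, P, h, hx, hP, fun t ht => posDef_of_succeq_smul_one hm
      (hdecay₀ t ht x P (h.mono Set.Icc_subset_Ici_self) hx hP).2.1⟩
  · exact (hdecay₀ t ht.1 x P (IsSolutionOn.mono h fun s hs => ⟨hs.1, hs.2.trans_lt ht.2⟩) hx hP).1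

end ErrorSystem
end ErrorSystem

/-! ### Rotations, cross products and projections -/

section Geometry

theorem eucl_mulVec_of_transpose_mul_self {n : Type} [Fintype n] [DecidableEq n]
    {Q : Matrix n n ℝ} (hQ : Qᵀ * Q = 1) (z : n → ℝ) : eucl (Q *ᵥ z) = eucl z := by
  rw [← sq_eq_sq₀ (eucl_nonneg _) (eucl_nonneg _), eucl_sq, eucl_sq,
    ← Matrix.dotProduct_transpose_mulVec, Matrix.mulVec_mulVec, hQ, Matrix.one_mulVec]

theorem transpose_mulVec_cross_mulVec {K : Type*} [CommRing K] (Q : Matrix (Fin 3) (Fin 3) K)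
    (v w : Fin 3 → K) : Qᵀ *ᵥ ((Q *ᵥ v) ⨯₃ (Q *ᵥ w)) = Q.det • (v ⨯₃ w) := by
  rw [Matrix.det_fin_three]
  ext i
  fin_cases i <;>
  · simp [crossProduct, Matrix.mulVec, dotProduct, Fin.sum_univ_three]
    ring

section Rotation

variable {Q : M3} (hQ : Q ∈ Matrix.specialOrthogonalGroup (Fin 3) ℝ)
include hQ

theorem transpose_mul_self_of_mem_specialOrthogonalGroup : Qᵀ * Q = 1 :=
  (Matrix.mem_orthogonalGroup_iff' _ _).1 (Matrix.mem_specialOrthogonalGroup_iff.1 hQ).1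

theorem mul_transpose_self_of_mem_specialOrthogonalGroup : Q * Qᵀ = 1 :=
  (Matrix.mem_orthogonalGroup_iff _ _).1 (Matrix.mem_specialOrthogonalGroup_iff.1 hQ).1

theorem transpose_mem_specialOrthogonalGroup :
    Qᵀ ∈ Matrix.specialOrthogonalGroup (Fin 3) ℝ := by
  rw [Matrix.mem_specialOrthogonalGroup_iff, Matrix.mem_orthogonalGroup_iff, Matrix.det_transpose]
  exact ⟨transpose_mul_self_of_mem_specialOrthogonalGroup hQ,
    (Matrix.mem_specialOrthogonalGroup_iff.1 hQ).2⟩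

theorem eucl_rot_mulVec (z : V3) : eucl (Q *ᵥ z) = eucl z :=
  eucl_mulVec_of_transpose_mul_self (transpose_mul_self_of_mem_specialOrthogonalGroup hQ) z

theorem rot_mulVec_cross (v w : V3) : Q *ᵥ (v ⨯₃ w) = (Q *ᵥ v) ⨯₃ (Q *ᵥ w) := by
  have h := transpose_mulVec_cross_mulVec Q v w
  rw [(Matrix.mem_specialOrthogonalGroup_iff.1 hQ).2, one_smul] at h
  rw [← h, Matrix.mulVec_mulVec, mul_transpose_self_of_mem_specialOrthogonalGroup hQ,
    Matrix.one_mulVec]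

end Rotation

theorem skew_mulVec (w z : V3) : skew w *ᵥ z = w ⨯₃ z := by
  ext i
  fin_cases i <;>
  · simp [skew, crossProduct, Matrix.mulVec, dotProduct, Fin.sum_univ_three]
    ring

theorem eucl_skew_mulVec_le (w z : V3) : eucl (skew w *ᵥ z) ≤ eucl w * eucl z := by
  refine abs_le_of_sq_le_sq' ?_ (mul_nonneg (eucl_nonneg w) (eucl_nonneg z)) |>.2
  rw [mul_pow, eucl_sq, eucl_sq, eucl_sq, skew_mulVec, cross_dot_cross, dotProduct_comm z w]
  linarith [mul_self_nonneg (w ⬝ᵥ z)]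

theorem continuousOn_skew {X : Type} [TopologicalSpace X] {w : X → V3} {J : Set X}
    (hw : ContinuousOn w J) :
    ContinuousOn (fun s => skew (w s)) J := by
  have hw' := continuousOn_pi.1 hw
  refine continuousOn_pi.2 fun i => continuousOn_pi.2 fun j => ?_
  fin_cases i <;> fin_cases j <;> simp [skew, hw', (hw' _).fun_neg, continuousOn_const]

theorem eucl_e3 : eucl e3 = 1 := by
  rw [← sq_eq_sq₀ (eucl_nonneg _) zero_le_one, eucl_sq]
  simp [e3, dotProduct, Fin.sum_univ_three]

theorem eucl_skew_e3_le (w : V3) : eucl (skew w *ᵥ e3) ≤ eucl w := by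
  simpa [eucl_e3] using eucl_skew_mulVec_le w e3

theorem proj_mulVec (y z : V3) : proj y *ᵥ z = z - (y ⬝ᵥ z) • y := by
  rw [proj, Matrix.sub_mulVec, Matrix.one_mulVec, Matrix.vecMulVec_mulVec, op_smul_eq_smul]

theorem eucl_proj_mulVec_sq {y : V3} (hy : eucl y = 1) (z : V3) :
    eucl (proj y *ᵥ z) ^ 2 = z ⬝ᵥ (proj y *ᵥ z) := by
  have hyy : y ⬝ᵥ y = 1 := by rw [← eucl_sq, hy, one_pow]
  rw [eucl_sq, proj_mulVec]
  simp only [sub_dotProduct, dotProduct_sub, smul_dotProduct, dotProduct_smul, smul_eq_mul, hyy]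
  rw [dotProduct_comm z y]
  ring

theorem eucl_proj_mulVec_le {y : V3} (hy : eucl y = 1) (z : V3) :
    eucl (proj y *ᵥ z) ≤ eucl z := by
  refine abs_le_of_sq_le_sq' ?_ (eucl_nonneg z) |>.2
  rw [eucl_proj_mulVec_sq hy, proj_mulVec, eucl_sq]
  simp only [dotProduct_sub, dotProduct_smul, smul_eq_mul]
  rw [dotProduct_comm z y]
  linarith [mul_self_nonneg (y ⬝ᵥ z)]

theorem eucl_proj_rot_mulVec {Q : M3} (hQ : Q ∈ Matrix.specialOrthogonalGroup (Fin 3) ℝ)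
    (y z : V3) : eucl (proj (Q *ᵥ y) *ᵥ (Q *ᵥ z)) = eucl (proj y *ᵥ z) := by
  rw [← eucl_rot_mulVec hQ (proj y *ᵥ z), proj_mulVec, proj_mulVec, Matrix.mulVec_sub,
    Matrix.mulVec_smul, ← Matrix.dotProduct_transpose_mulVec, Matrix.mulVec_mulVec,
    transpose_mul_self_of_mem_specialOrthogonalGroup hQ, Matrix.one_mulVec, dotProduct_comm]

theorem continuousOn_proj {J : Set ℝ} {y : ℝ → V3} (hy : ContinuousOn y J) :
    ContinuousOn (fun s => proj (y s)) J := by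
  have hy' := continuousOn_pi.1 hy
  refine continuousOn_pi.2 fun i => continuousOn_pi.2 fun j => ?_
  simp only [proj, Matrix.sub_apply, Matrix.vecMulVec_apply]
  exact continuousOn_const.sub ((hy' i).mul (hy' j))

end Geometry

/-! ### Rigid motions -/

section Motion

variable {g : ℝ} {QB QT : ℝ → M3} {pB vB ωB aB pT vT ωT aT : ℝ → V3}
  (hB : IsRigidMotion g QB pB vB ωB aB) (hT : IsRigidMotion g QT pT vT ωT aT)
  (hsep : ∀ t, 0 ≤ t → pB t ≠ pT t)

include hB in
theorem IsRigidMotion.continuousOn_rot : ContinuousOn QB (Set.Ici 0) :=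
  fun t ht => (hB.att t ht).continuousWithinAt

include hB in
theorem IsRigidMotion.continuousOn_pos : ContinuousOn pB (Set.Ici 0) :=
  fun t ht => (hB.pos t ht).continuousWithinAt

include hB hsep in
theorem eucl_relPos_pos {t : ℝ} (ht : 0 ≤ t) : 0 < eucl (relPos QB pB pT t) := by
  rw [relPos, eucl_rot_mulVec (transpose_mem_specialOrthogonalGroup (hB.rot t ht))]
  exact eucl_pos (sub_ne_zero.2 (hsep t ht))

include hB hsep in
theorem eucl_bearing {t : ℝ} (ht : 0 ≤ t) : eucl (bearing QB pB pT t) = 1 := by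
  have h := eucl_relPos_pos hB hsep ht
  rw [bearing, eucl_smul, abs_of_pos (inv_pos.2 h), inv_mul_cancel₀ h.ne']

include hB hsep in
theorem eucl_bearingI {t : ℝ} (ht : 0 ≤ t) : eucl (bearingI QB pB pT t) = 1 := by
  rw [bearingI, eucl_rot_mulVec (hB.rot t ht), eucl_bearing hB hsep ht]

include hB hT hsep in
theorem continuousOn_bearing : ContinuousOn (bearing QB pB pT) (Set.Ici 0) := by
  have hrel : ContinuousOn (relPos QB pB pT) (Set.Ici 0) :=
    continuousOn_mulVec (continuousOn_transpose hB.continuousOn_rot)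
      (hB.continuousOn_pos.sub hT.continuousOn_pos)
  exact ((continuous_eucl.comp_continuousOn hrel).inv₀ fun t ht =>
    (eucl_relPos_pos hB hsep ht).ne').smul hrel

include hB hT hsep in
theorem continuousOn_bearingI : ContinuousOn (bearingI QB pB pT) (Set.Ici 0) :=
  continuousOn_mulVec hB.continuousOn_rot (continuousOn_bearing hB hT hsep)

include hB hT in
theorem relAtt_mem_specialOrthogonalGroup {t : ℝ} (ht : 0 ≤ t) :
    relAtt QB QT t ∈ Matrix.specialOrthogonalGroup (Fin 3) ℝ :=
  mul_mem (transpose_mem_specialOrthogonalGroup (hT.rot t ht)) (hB.rot t ht)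

include hB hT in
theorem continuousOn_relAtt : ContinuousOn (relAtt QB QT) (Set.Ici 0) :=
  continuousOn_matrix_mul (continuousOn_transpose hT.continuousOn_rot) hB.continuousOn_rot

end Motion

/-! ### Persistently exciting bearings -/

section BearingPE

variable {y X : ℝ → V3} {δ μ t : ℝ}

theorem half_sq_sub_sq_le_eucl_sq {n : Type} [Fintype n] (v w : n → ℝ) :
    eucl v ^ 2 / 2 - eucl (w - v) ^ 2 ≤ eucl w ^ 2 := by
  have htri := eucl_sub_le w (w - v)
  rw [sub_sub_cancel] at htri
  have hsq := pow_le_pow_left₀ (eucl_nonneg v) htri 2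
  linarith [add_sq_le (a := eucl w) (b := eucl (w - v))]

theorem continuousOn_eucl_proj_mulVec_sq {J : Set ℝ} (hy : ContinuousOn y J)
    (hX : ContinuousOn X J) : ContinuousOn (fun s => eucl (proj (y s) *ᵥ X s) ^ 2) J :=
  (continuous_eucl.comp_continuousOn (continuousOn_mulVec (continuousOn_proj hy) hX)).pow 2

variable (hPE : BearingPE y δ μ) (hδ : 0 < δ) (hy : ContinuousOn y (Set.Ici 0))
  (hy1 : ∀ t, 0 ≤ t → eucl (y t) = 1) (ht : 0 ≤ t)
include hPE hδ hy hy1 ht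

theorem BearingPE.mul_eucl_sq_le_integral (z : V3) :
    δ * μ * eucl z ^ 2 ≤ ∫ s in t..t + δ, eucl (proj (y s) *ᵥ z) ^ 2 := by
  have htd : t ≤ t + δ := by linarith
  have hcont : ContinuousOn (fun s => proj (y s)) (Set.Icc t (t + δ)) :=
    continuousOn_proj (hy.mono fun s hs => ht.trans hs.1)
  have hquad : ∫ s in t..t + δ, eucl (proj (y s) *ᵥ z) ^ 2
      = z ⬝ᵥ (matIntegral (fun s => proj (y s)) t (t + δ) *ᵥ z) := by
    rw [dotProduct_matIntegral_mulVec htd hcont]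
    refine intervalIntegral.integral_congr fun s hs => ?_
    rw [Set.uIcc_of_le htd] at hs
    exact eucl_proj_mulVec_sq (hy1 s (ht.trans hs.1)) z
  have hle := mul_eucl_sq_le_of_succeq (hPE t ht) z
  rw [Matrix.smul_mulVec, dotProduct_smul, smul_eq_mul, one_div, ← div_eq_inv_mul,
    le_div_iff₀ hδ, ← hquad] at hle
  linarith

theorem BearingPE.le_integral {v : ℝ} (hX : ContinuousOn X (Set.Icc t (t + δ)))
    (hv : ∀ s ∈ Set.Icc t (t + δ), eucl (X s - X t) ≤ v) :
    δ * μ / 2 * eucl (X t) ^ 2 - δ * v ^ 2 ≤ ∫ s in t..t + δ, eucl (proj (y s) *ᵥ X s) ^ 2 := by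
  have htd : t ≤ t + δ := by linarith
  have hyc : ContinuousOn y (Set.Icc t (t + δ)) := hy.mono fun s hs => ht.trans hs.1
  have hconst := (continuousOn_eucl_proj_mulVec_sq hyc
    (continuousOn_const (c := X t))).intervalIntegrable_of_Icc
      (μ := MeasureTheory.volume) htd
  have hcurve := (continuousOn_eucl_proj_mulVec_sq hyc hX).intervalIntegrable_of_Icc
    (μ := MeasureTheory.volume) htd
  have hmono : ∫ s in t..t + δ, (eucl (proj (y s) *ᵥ X t) ^ 2 / 2 - v ^ 2)
      ≤ ∫ s in t..t + δ, eucl (proj (y s) *ᵥ X s) ^ 2 := by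
    refine intervalIntegral.integral_mono_on htd ((hconst.div_const 2).sub
      intervalIntegrable_const) hcurve fun s hs => ?_
    have hdiff := (eucl_proj_mulVec_le (hy1 s (ht.trans hs.1)) (X s - X t)).trans (hv s hs)
    have hhalf := half_sq_sub_sq_le_eucl_sq (proj (y s) *ᵥ X t) (proj (y s) *ᵥ X s)
    rw [← Matrix.mulVec_sub] at hhalf
    linarith [pow_le_pow_left₀ (eucl_nonneg _) hdiff 2]
  rw [intervalIntegral.integral_sub (hconst.div_const 2) intervalIntegrable_const,
    intervalIntegral.integral_div, intervalIntegral.integral_const, smul_eq_mul,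
    add_sub_cancel_left] at hmono
  linarith [hPE.mul_eucl_sq_le_integral hδ hy hy1 ht (X t)]

end BearingPE

/-! ### Curves with an acceleration known up to a factor -/

section Acceleration

/-- A curve `X` with velocity `V` and acceleration `a` on `J`. -/
structure HasAcceleration {n : Type} [Fintype n] (X V a : ℝ → n → ℝ) (J : Set ℝ) : Prop where
  pos : ∀ s ∈ J, HasDerivWithinAt X (V s) J s
  vel : ∀ s ∈ J, HasDerivWithinAt V (a s) J s

variable {n : Type} [Fintype n] {X V a : ℝ → n → ℝ}

theorem eucl_sub_le_of_eucl_deriv_le {s r c : ℝ} (hsr : s ≤ r)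
    (hX : ∀ u ∈ Set.Icc s r, HasDerivWithinAt X (V u) (Set.Icc s r) u)
    (hc : ∀ u ∈ Set.Icc s r, eucl (V u) ≤ c) : eucl (X r - X s) ≤ c * (r - s) := by
  set d := X r - X s
  have hc0 : 0 ≤ c := (eucl_nonneg _).trans (hc s (Set.left_mem_Icc.2 hsr))
  rcases (eucl_nonneg d).eq_or_lt with h0 | h0
  · rw [← h0]
    exact mul_nonneg hc0 (sub_nonneg.2 hsr)
  · have hle := le_add_mul_of_deriv_le (c := eucl d * c) hsr
      (fun u hu => hasDerivWithinAt_dotProduct (hasDerivWithinAt_const u _ d) (hX u hu))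
      fun u hu => by
        rw [zero_dotProduct, zero_add]
        exact (dotProduct_le_eucl_mul_eucl _ _).trans
          (mul_le_mul_of_nonneg_left (hc u hu) (eucl_nonneg d))
    rw [← sub_le_iff_le_add', ← dotProduct_sub, ← eucl_sq, sq, mul_assoc] at hle
    exact le_of_mul_le_mul_left hle h0

/-- The function `s ↦ f (s + h) - f s` has derivative at most `m * h` on `[t, t + h]`. -/
theorem second_difference_le {f f' f'' : ℝ → ℝ} {t h m : ℝ} (hh : 0 ≤ h)
    (hf : ∀ s ∈ Set.Icc t (t + 2 * h), HasDerivWithinAt f (f' s) (Set.Icc t (t + 2 * h)) s)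
    (hf' : ∀ s ∈ Set.Icc t (t + 2 * h), HasDerivWithinAt f' (f'' s) (Set.Icc t (t + 2 * h)) s)
    (hm : ∀ s ∈ Set.Icc t (t + 2 * h), f'' s ≤ m) :
    f t - 2 * f (t + h) + f (t + 2 * h) ≤ m * h ^ 2 := by
  have hmaps : Set.MapsTo (· + h) (Set.Icc t (t + h)) (Set.Icc t (t + 2 * h)) :=
    fun s hs => ⟨by linarith [hs.1], by linarith [hs.2]⟩
  have hsub : Set.Icc t (t + h) ⊆ Set.Icc t (t + 2 * h) := Set.Icc_subset_Icc_right (by linarith)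
  have hincr : ∀ s ∈ Set.Icc t (t + h), f' (s + h) - f' s ≤ m * h := fun s hs => by
    have hs' : Set.Icc s (s + h) ⊆ Set.Icc t (t + 2 * h) :=
      Set.Icc_subset_Icc hs.1 (by linarith [hs.2])
    have := le_add_mul_of_deriv_le (by linarith) (fun u hu => (hf' u (hs' hu)).mono hs')
      fun u hu => hm u (hs' hu)
    linarith
  have hshift : ∀ s ∈ Set.Icc t (t + h), HasDerivWithinAt (fun s => f (s + h) - f s)
      (f' (s + h) - f' s) (Set.Icc t (t + h)) s := fun s hs => by
    have := (hf _ (hmaps hs)).comp s ((hasDerivWithinAt_id s _).add_const h) hmaps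
    rw [mul_one] at this
    exact this.sub ((hf s (hsub hs)).mono hsub)
  have hle := le_add_mul_of_deriv_le (le_add_of_nonneg_right hh) hshift hincr
  rw [show t + h + h = t + 2 * h by ring] at hle
  linarith

/-- The sum of the distances of a curve from the origin at three equidistant times. -/
noncomputable def sampleSum (X : ℝ → n → ℝ) (t h : ℝ) : ℝ :=
  eucl (X t) + eucl (X (t + h)) + eucl (X (t + 2 * h))

theorem sampleSum_nonneg (X : ℝ → n → ℝ) (t h : ℝ) : 0 ≤ sampleSum X t h :=
  add_nonneg (add_nonneg (eucl_nonneg _) (eucl_nonneg _)) (eucl_nonneg _)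

theorem eucl_le_sampleSum (X : ℝ → n → ℝ) (t h : ℝ) : eucl (X t) ≤ sampleSum X t h := by
  rw [sampleSum]
  linarith [eucl_nonneg (X (t + h)), eucl_nonneg (X (t + 2 * h))]

theorem sampleSum_sq_le (X : ℝ → n → ℝ) (t h : ℝ) : sampleSum X t h ^ 2
    ≤ 3 * (eucl (X t) ^ 2 + eucl (X (t + h)) ^ 2 + eucl (X (t + 2 * h)) ^ 2) := by
  rw [sampleSum]
  linarith [sq_nonneg (eucl (X t) - eucl (X (t + h))),
    sq_nonneg (eucl (X t) - eucl (X (t + 2 * h))),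
    sq_nonneg (eucl (X (t + h)) - eucl (X (t + 2 * h)))]

namespace HasAcceleration

variable {J K : Set ℝ} {t h c : ℝ}

theorem mono (hX : HasAcceleration X V a J) (hK : K ⊆ J) : HasAcceleration X V a K :=
  ⟨fun s hs => (hX.pos s (hK hs)).mono hK, fun s hs => (hX.vel s (hK hs)).mono hK⟩

theorem mul_sq_le {e : n → ℝ} {m : ℝ} (hX : HasAcceleration X V a (Set.Icc t (t + 2 * h)))
    (hh : 0 ≤ h) (hm : ∀ s ∈ Set.Icc t (t + 2 * h), m ≤ e ⬝ᵥ a s) :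
    m * h ^ 2 ≤ 2 * eucl e * sampleSum X t h := by
  have hdot : ∀ {Y Y' : ℝ → n → ℝ} {s : ℝ},
      HasDerivWithinAt Y (Y' s) (Set.Icc t (t + 2 * h)) s →
      HasDerivWithinAt (fun s => -e ⬝ᵥ Y s) (-e ⬝ᵥ Y' s) (Set.Icc t (t + 2 * h)) s := fun hY => by
    have := hasDerivWithinAt_dotProduct (hasDerivWithinAt_const _ _ (-e)) hY
    rwa [zero_dotProduct, zero_add] at this
  have hle := second_difference_le (m := -m) hh (fun s hs => hdot (hX.pos s hs))
    (fun s hs => hdot (hX.vel s hs)) fun s hs => by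
      rw [neg_dotProduct]
      exact neg_le_neg (hm s hs)
  simp only [neg_dotProduct] at hle
  have h0 := dotProduct_le_eucl_mul_eucl e (X t)
  have h1 := neg_le_of_abs_le (abs_dotProduct_le_eucl_mul_eucl e (X (t + h)))
  have h2 := dotProduct_le_eucl_mul_eucl e (X (t + 2 * h))
  rw [sampleSum]
  linarith [mul_nonneg (eucl_nonneg e) (eucl_nonneg (X t)),
    mul_nonneg (eucl_nonneg e) (eucl_nonneg (X (t + 2 * h)))]

theorem eucl_vel_le {ℓ : ℝ} (hX : HasAcceleration X V a (Set.Icc t (t + ℓ)))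
    (hc : ∀ s ∈ Set.Icc t (t + ℓ), eucl (a s) ≤ c) :
    ∀ s ∈ Set.Icc t (t + ℓ), eucl (V s - V t) ≤ c * ℓ := fun s hs => by
  have hsub : Set.Icc t s ⊆ Set.Icc t (t + ℓ) := Set.Icc_subset_Icc_right hs.2
  have hc0 : 0 ≤ c := (eucl_nonneg _).trans (hc s hs)
  refine (eucl_sub_le_of_eucl_deriv_le hs.1 (fun u hu => (hX.vel u (hsub hu)).mono hsub)
    fun u hu => hc u (hsub hu)).trans ?_
  gcongr
  linarith [hs.2]

theorem eucl_vel_mul_le (hX : HasAcceleration X V a (Set.Icc t (t + h))) (hh : 0 ≤ h)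
    (hc : ∀ s ∈ Set.Icc t (t + h), eucl (a s) ≤ c) :
    eucl (V t) * h ≤ eucl (X t) + eucl (X (t + h)) + c * h ^ 2 := by
  have hdrift : ∀ s ∈ Set.Icc t (t + h), HasDerivWithinAt (fun s => X s - (s - t) • V t)
      (V s - V t) (Set.Icc t (t + h)) s := fun s hs => by
    have := ((hasDerivWithinAt_id s (Set.Icc t (t + h))).sub_const t).smul_const (V t)
    rw [one_smul] at this
    exact (hX.pos s hs).sub this
  have hle := eucl_sub_le_of_eucl_deriv_le (le_add_of_nonneg_right hh) hdrift (hX.eucl_vel_le hc)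
  rw [add_sub_cancel_left, sub_self, zero_smul, sub_zero] at hle
  calc eucl (V t) * h = eucl (X (t + h) - X t - (X (t + h) - h • V t - X t)) := by
        rw [← abs_of_nonneg hh, mul_comm, ← eucl_smul, abs_of_nonneg hh]
        congr 1
        abel
    _ ≤ eucl (X (t + h)) + eucl (X t) + eucl (X (t + h) - h • V t - X t) :=
        (eucl_sub_le _ _).trans (add_le_add_left (eucl_sub_le _ _) _)
    _ ≤ eucl (X t) + eucl (X (t + h)) + c * h ^ 2 := by linarith

theorem eucl_sub_le {ℓ : ℝ} (hX : HasAcceleration X V a (Set.Icc t (t + ℓ)))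
    (hc : ∀ s ∈ Set.Icc t (t + ℓ), eucl (a s) ≤ c) {s r : ℝ} (hs : t ≤ s) (hsr : s ≤ r)
    (hr : r ≤ t + ℓ) : eucl (X r - X s) ≤ (eucl (V t) + c * ℓ) * (r - s) := by
  have hsub : Set.Icc s r ⊆ Set.Icc t (t + ℓ) := Set.Icc_subset_Icc hs hr
  refine eucl_sub_le_of_eucl_deriv_le hsr (fun u hu => (hX.pos u (hsub hu)).mono hsub)
    fun u hu => ?_
  calc eucl (V u) = eucl (V t + (V u - V t)) := by rw [add_sub_cancel]
    _ ≤ eucl (V t) + c * ℓ :=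
        (eucl_add_le _ _).trans (add_le_add_right (hX.eucl_vel_le hc u (hsub hu)) _)

section Factor

variable {b : ℝ → n → ℝ} {e : n → ℝ} {θ c₀ : ℝ}

theorem abs_mul_sq_le (hX : HasAcceleration X V (fun s => θ • b s) (Set.Icc t (t + 2 * h)))
    (hh : 0 ≤ h) (hc₀ : 0 < c₀) (hb : ∀ s ∈ Set.Icc t (t + 2 * h), c₀ ≤ e ⬝ᵥ b s) :
    |θ| * h ^ 2 ≤ 2 * eucl e / c₀ * sampleSum X t h := by
  have hle := hX.mul_sq_le (e := θ • e) (m := θ ^ 2 * c₀) hh fun s hs => by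
    rw [smul_dotProduct, dotProduct_smul, smul_eq_mul, smul_eq_mul, ← mul_assoc, ← sq]
    exact mul_le_mul_of_nonneg_left (hb s hs) (sq_nonneg θ)
  rw [eucl_smul, ← sq_abs] at hle
  have hN := mul_nonneg (mul_nonneg zero_le_two (eucl_nonneg e)) (sampleSum_nonneg X t h)
  rw [div_mul_eq_mul_div, le_div_iff₀ hc₀]
  rcases (abs_nonneg θ).eq_or_lt with h0 | h0
  · rwa [← h0, zero_mul, zero_mul]
  · exact le_of_mul_le_mul_left (by linarith) h0

theorem speed_mul_le (hX : HasAcceleration X V (fun s => θ • b s) (Set.Icc t (t + 2 * h)))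
    (hh : 0 ≤ h) (hc : 0 ≤ c) (hbc : ∀ s ∈ Set.Icc t (t + 2 * h), eucl (b s) ≤ c) {B : ℝ}
    (hθ : |θ| * h ^ 2 ≤ B * sampleSum X t h) :
    (eucl (V t) + |θ| * c * (3 * h)) * h ≤ (1 + 4 * B * c) * sampleSum X t h := by
  have hsub : Set.Icc t (t + h) ⊆ Set.Icc t (t + 2 * h) := Set.Icc_subset_Icc_right (by linarith)
  have hV := (hX.mono hsub).eucl_vel_mul_le (c := |θ| * c) hh fun s hs => by
    rw [eucl_smul]
    exact mul_le_mul_of_nonneg_left (hbc s (hsub hs)) (abs_nonneg θ)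
  have hV' : eucl (X t) + eucl (X (t + h)) ≤ sampleSum X t h :=
    le_add_of_nonneg_right (eucl_nonneg _)
  linarith [mul_le_mul_of_nonneg_left hθ hc]

end Factor
end HasAcceleration

theorem exists_sampling_step {δ μ κ : ℝ} (hδ : 0 ≤ δ) (hμ : 0 < μ) (hκ : 0 ≤ κ) :
    ∃ h : ℝ, 1 ≤ h ∧ δ ≤ h ∧ 36 * δ ^ 2 * κ ^ 2 ≤ μ * h ^ 2 := by
  have hfrac : 0 ≤ 6 * δ * κ / √μ := by positivity
  refine ⟨1 + δ + 6 * δ * κ / √μ, by linarith, by linarith, ?_⟩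
  have hle : 6 * δ * κ / √μ ≤ 1 + δ + 6 * δ * κ / √μ := by linarith
  rw [div_le_iff₀ (Real.sqrt_pos.2 hμ)] at hle
  have hsq := pow_le_pow_left₀ (by positivity) hle 2
  rw [mul_pow _ √μ, Real.sq_sqrt hμ.le] at hsq
  linarith

section Windows

variable {y X V : ℝ → V3} {b : ℝ → V3} {δ μ h t θ v κ c : ℝ}
  (hPE : BearingPE y δ μ) (hδ : 0 < δ) (hy : ContinuousOn y (Set.Ici 0))
  (hy1 : ∀ t, 0 ≤ t → eucl (y t) = 1) (ht : 0 ≤ t)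
include hPE hδ hy hy1 ht

theorem BearingPE.le_integral_of_window {r : ℝ} (htr : t ≤ r) (hr : r ≤ t + 2 * h)
    (hX : ContinuousOn X (Set.Icc t (t + (2 * h + δ)))) (hv : 0 ≤ v)
    (hXv : ∀ s ∈ Set.Icc r (t + (2 * h + δ)), eucl (X s - X r) ≤ v * (s - r)) :
    δ * μ / 2 * eucl (X r) ^ 2 - δ * (v * δ) ^ 2
      ≤ ∫ s in t..t + (2 * h + δ), eucl (proj (y s) *ᵥ X s) ^ 2 := by
  refine (hPE.le_integral hδ hy hy1 (ht.trans htr)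
    (hX.mono (Set.Icc_subset_Icc htr (by linarith))) fun s hs => ?_).trans ?_
  · exact (hXv s ⟨hs.1, by linarith [hs.2]⟩).trans
      (mul_le_mul_of_nonneg_left (by linarith [hs.2]) hv)
  · exact intervalIntegral.integral_mono_interval htr (by linarith) (by linarith)
      (Filter.Eventually.of_forall fun s => sq_nonneg _)
      ((continuousOn_eucl_proj_mulVec_sq (hy.mono fun s hs => ht.trans hs.1)
        hX).intervalIntegrable_of_Icc (by linarith))

/-- If the speed is small compared with the sampled distances, the lower bounds over the three
windows of length `δ` combine. -/
theorem BearingPE.mul_sampleSum_sq_le_integral (hh : 0 < h) (hμ : 0 ≤ μ)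
    (hX : ContinuousOn X (Set.Icc t (t + (2 * h + δ)))) (hv : 0 ≤ v)
    (hXv : ∀ r s, t ≤ r → r ≤ s → s ≤ t + (2 * h + δ) → eucl (X s - X r) ≤ v * (s - r))
    (hvN : v * h ≤ κ * sampleSum X t h) (hκ : 36 * δ ^ 2 * κ ^ 2 ≤ μ * h ^ 2) :
    δ * μ * sampleSum X t h ^ 2
      ≤ 36 * ∫ s in t..t + (2 * h + δ), eucl (proj (y s) *ᵥ X s) ^ 2 := by
  have hspeed : 36 * (v * δ) ^ 2 ≤ μ * sampleSum X t h ^ 2 := by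
    refine le_of_mul_le_mul_left ?_ (sq_pos_of_pos hh)
    calc h ^ 2 * (36 * (v * δ) ^ 2) = 36 * δ ^ 2 * (v * h) ^ 2 := by ring
      _ ≤ 36 * δ ^ 2 * (κ * sampleSum X t h) ^ 2 := by gcongr
      _ = 36 * δ ^ 2 * κ ^ 2 * sampleSum X t h ^ 2 := by ring
      _ ≤ μ * h ^ 2 * sampleSum X t h ^ 2 := by gcongr
      _ = h ^ 2 * (μ * sampleSum X t h ^ 2) := by ring
  have hwindow : ∀ r, t ≤ r → r ≤ t + 2 * h → _ := fun r htr hr =>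
    hPE.le_integral_of_window hδ hy hy1 ht htr hr hX hv fun s hs => hXv r s htr hs.1 hs.2
  linarith [hwindow t le_rfl (by linarith), hwindow (t + h) (by linarith) (by linarith),
    hwindow (t + 2 * h) (by linarith) le_rfl,
    mul_le_mul_of_nonneg_left (sampleSum_sq_le X t h) (mul_nonneg hδ.le hμ),
    mul_le_mul_of_nonneg_left hspeed hδ.le]

theorem HasAcceleration.mul_sampleSum_sq_le_integral
    (hX : HasAcceleration X V (fun s => θ • b s) (Set.Icc t (t + (2 * h + δ)))) (hh : 0 < h)
    (hδh : δ ≤ h) (hμ : 0 ≤ μ) (hc : 0 ≤ c)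
    (hbc : ∀ s ∈ Set.Icc t (t + (2 * h + δ)), eucl (b s) ≤ c)
    (hspeed : (eucl (V t) + |θ| * c * (3 * h)) * h ≤ κ * sampleSum X t h)
    (hκ : 36 * δ ^ 2 * κ ^ 2 ≤ μ * h ^ 2) :
    δ * μ * sampleSum X t h ^ 2
      ≤ 36 * ∫ s in t..t + (2 * h + δ), eucl (proj (y s) *ᵥ X s) ^ 2 := by
  have hθc := mul_nonneg (abs_nonneg θ) hc
  refine hPE.mul_sampleSum_sq_le_integral hδ hy hy1 ht hh hμ
    (fun s hs => (hX.pos s hs).continuousWithinAt)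
    (add_nonneg (eucl_nonneg (V t)) (mul_nonneg hθc (by linarith)))
    (fun r s hr hrs hs => (hX.eucl_sub_le (c := |θ| * c) (fun u hu => ?_) hr hrs hs).trans ?_)
    hspeed hκ
  · rw [eucl_smul]
    exact mul_le_mul_of_nonneg_left (hbc u hu) (abs_nonneg θ)
  · gcongr
    linarith

end Windows

theorem initial_data_sq_le {X : ℝ → n → ℝ} {V₀ : n → ℝ} {θ h t κ B : ℝ} (hh : 1 ≤ h)
    (hθ : |θ| * h ^ 2 ≤ B * sampleSum X t h) (hV : eucl V₀ * h ≤ κ * sampleSum X t h) :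
    eucl (X t) ^ 2 + eucl V₀ ^ 2 + θ ^ 2 ≤ (1 + κ + B) ^ 2 * sampleSum X t h ^ 2 := by
  have hθ' := (le_mul_of_one_le_right (abs_nonneg θ) (one_le_pow₀ hh)).trans hθ
  have hV' := (le_mul_of_one_le_right (eucl_nonneg V₀) hh).trans hV
  have hsum : eucl (X t) + eucl V₀ + |θ| ≤ (1 + κ + B) * sampleSum X t h := by
    linarith [eucl_le_sampleSum X t h]
  have hX := eucl_nonneg (X t)
  have hV₀ := eucl_nonneg V₀
  calc eucl (X t) ^ 2 + eucl V₀ ^ 2 + θ ^ 2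
      ≤ (eucl (X t) + eucl V₀ + |θ|) ^ 2 := by
        rw [← sq_abs θ]
        linarith [mul_nonneg hX hV₀, mul_nonneg hX (abs_nonneg θ), mul_nonneg hV₀ (abs_nonneg θ)]
    _ ≤ ((1 + κ + B) * sampleSum X t h) ^ 2 := by gcongr
    _ = (1 + κ + B) ^ 2 * sampleSum X t h ^ 2 := mul_pow _ _ _

/-- A second difference of `X` over a long time exhibits `θ`, a first difference then exhibits
`V`, and over a window of the fixed length `δ` the curve moves little compared with its sampled
distances from the origin. -/
theorem exists_observability_constants {δ μ c₀ c : ℝ} (hδ : 0 < δ) (hμ : 0 < μ) (hc₀ : 0 < c₀)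
    (hc : 0 ≤ c) (e : V3) :
    ∃ δ' μ' : ℝ, 0 < δ' ∧ 0 < μ' ∧ ∀ y : ℝ → V3, BearingPE y δ μ → ContinuousOn y (Set.Ici 0) →
      (∀ t, 0 ≤ t → eucl (y t) = 1) → ∀ {X V b : ℝ → V3} {θ t : ℝ}, 0 ≤ t →
      HasAcceleration X V (fun s => θ • b s) (Set.Icc t (t + δ')) →
      (∀ s ∈ Set.Icc t (t + δ'), c₀ ≤ e ⬝ᵥ b s) → (∀ s ∈ Set.Icc t (t + δ'), eucl (b s) ≤ c) →
      δ' * μ' * (eucl (X t) ^ 2 + eucl (V t) ^ 2 + θ ^ 2)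
        ≤ ∫ s in t..t + δ', eucl (proj (y s) *ᵥ X s) ^ 2 := by
  set B := 2 * eucl e / c₀
  have hB : 0 ≤ B := div_nonneg (mul_nonneg zero_le_two (eucl_nonneg e)) hc₀.le
  set κ := 1 + 4 * B * c
  have hκ : 0 ≤ κ := by positivity
  obtain ⟨h, hh1, hδh, hκh⟩ := exists_sampling_step hδ.le hμ hκ
  have hh : 0 < h := by linarith
  have hδ' : 0 < 2 * h + δ := by linarith
  have _hL : 0 < 1 + κ + B := by linarith
  refine ⟨2 * h + δ, δ * μ / (36 * (2 * h + δ) * (1 + κ + B) ^ 2), hδ', by positivity, ?_⟩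
  intro y hPE hy hy1 X V b θ t ht hX hbe hbc
  have hsub : Set.Icc t (t + 2 * h) ⊆ Set.Icc t (t + (2 * h + δ)) :=
    Set.Icc_subset_Icc_right (by linarith)
  have hθ := (hX.mono hsub).abs_mul_sq_le hh.le hc₀ fun s hs => hbe s (hsub hs)
  have hspeed := (hX.mono hsub).speed_mul_le hh.le hc (fun s hs => hbc s (hsub hs)) hθ
  have hV : eucl (V t) * h ≤ κ * sampleSum X t h := by
    refine le_trans ?_ hspeed
    gcongr
    exact le_add_of_nonneg_right (by positivity)
  have hint := hX.mul_sampleSum_sq_le_integral hPE hδ hy hy1 ht hh hδh hμ.le hc hbc hspeed hκh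
  calc (2 * h + δ) * (δ * μ / (36 * (2 * h + δ) * (1 + κ + B) ^ 2))
        * (eucl (X t) ^ 2 + eucl (V t) ^ 2 + θ ^ 2)
      ≤ (2 * h + δ) * (δ * μ / (36 * (2 * h + δ) * (1 + κ + B) ^ 2))
        * ((1 + κ + B) ^ 2 * sampleSum X t h ^ 2) := by
        gcongr
        exact initial_data_sq_le hh1 hθ hV
    _ = δ * μ * sampleSum X t h ^ 2 / 36 := by field_simp
    _ ≤ _ := by linarith

end Acceleration

/-! ### The error state and its matrices -/

section ErrorState

theorem sumElim_posErr_velErr_yawErr (x : V7) :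
    Sum.elim (Sum.elim (posErr x) (velErr x)) (fun _ => yawErr x) = x := by
  ext i
  rcases i with (i | i) | i
  · rfl
  · rfl
  · rw [Subsingleton.elim i 0]
    rfl

theorem eucl_state_sq (x : V7) :
    eucl x ^ 2 = eucl (posErr x) ^ 2 + eucl (velErr x) ^ 2 + yawErr x ^ 2 := by
  have hyaw : eucl (fun _ : Fin 1 => yawErr x) ^ 2 = yawErr x ^ 2 := by
    rw [eucl_sq]
    simp [dotProduct, sq]
  conv_lhs => rw [← sumElim_posErr_velErr_yawErr x]
  rw [eucl_sumElim_sq, eucl_sumElim_sq, hyaw]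

theorem eucl_posErr_le (x : V7) : eucl (posErr x) ≤ eucl x := by
  refine abs_le_of_sq_le_sq' ?_ (eucl_nonneg x) |>.2
  rw [eucl_state_sq x]
  linarith [sq_nonneg (eucl (velErr x)), sq_nonneg (yawErr x)]

theorem eucl_velErr_le (x : V7) : eucl (velErr x) ≤ eucl x := by
  refine abs_le_of_sq_le_sq' ?_ (eucl_nonneg x) |>.2
  rw [eucl_state_sq x]
  linarith [sq_nonneg (eucl (posErr x)), sq_nonneg (yawErr x)]

theorem abs_yawErr_le (x : V7) : |yawErr x| ≤ eucl x := abs_apply_le_eucl x _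

theorem Ctheta_mulVec (y : V3) (x : V7) : Ctheta y *ᵥ x = proj y *ᵥ posErr x := by
  conv_lhs => rw [← sumElim_posErr_velErr_yawErr x]
  simp [Ctheta]

theorem Atheta_mulVec (ω : V3) (R : M3) (a : V3) (x : V7) :
    Atheta ω R a *ᵥ x = Sum.elim (Sum.elim (-(skew ω *ᵥ posErr x) + velErr x)
      (-(skew ω *ᵥ velErr x) + yawErr x • (Rᵀ *ᵥ (skew a *ᵥ e3)))) 0 := by
  conv_lhs => rw [← sumElim_posErr_velErr_yawErr x]
  rw [Atheta, Matrix.fromBlocks_mulVec, Sum.elim_comp_inl, Sum.elim_comp_inr,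
    Matrix.fromBlocks_mulVec]
  ext i
  rcases i with (i | i) | i <;>
    simp [Matrix.mulVec, dotProduct, Matrix.neg_apply, mul_comm]

theorem continuousOn_Ctheta {J : Set ℝ} {y : ℝ → V3} (hy : ContinuousOn y J) :
    ContinuousOn (fun s => Ctheta (y s)) J := by
  refine continuousOn_pi.2 fun i => continuousOn_pi.2 fun j => ?_
  rcases j with (j | j) | j
  · simpa [Ctheta] using continuousOn_matrix_elem (continuousOn_proj hy) i j
  · simpa [Ctheta] using continuousOn_const
  · simpa [Ctheta] using continuousOn_const

theorem continuousOn_Atheta {X : Type} [TopologicalSpace X] {J : Set X} {ω a : X → V3}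
    {R : X → M3} (hω : ContinuousOn ω J) (hR : ContinuousOn R J) (ha : ContinuousOn a J) :
    ContinuousOn (fun s => Atheta (ω s) (R s) (a s)) J := by
  have hcol : ContinuousOn (fun s => (R s)ᵀ *ᵥ (skew (a s) *ᵥ e3)) J :=
    continuousOn_mulVec (continuousOn_transpose hR)
      (continuousOn_mulVec (continuousOn_skew ha) continuousOn_const)
  refine continuousOn_pi.2 fun i => continuousOn_pi.2 fun j => ?_
  rcases i with (i | i) | i <;> rcases j with (j | j) | j <;>
    simp only [Atheta, Matrix.fromBlocks_apply₁₁, Matrix.fromBlocks_apply₁₂,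
      Matrix.fromBlocks_apply₂₁, Matrix.fromBlocks_apply₂₂, Matrix.replicateCol_apply,
      Sum.elim_inl, Sum.elim_inr, Matrix.neg_apply, Matrix.zero_apply, Pi.zero_apply] <;>
    first
      | exact continuousOn_const
      | exact (continuousOn_matrix_elem (continuousOn_skew hω) _ _).neg
      | exact continuousOn_pi.1 hcol _

section Norm

open scoped Matrix.Norms.L2Operator

theorem norm_Atheta_le {ω a : V3} {R : M3} (hR : R ∈ Matrix.specialOrthogonalGroup (Fin 3) ℝ)
    {cω ca : ℝ} (hω : eucl ω ≤ cω) (ha : eucl a ≤ ca) :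
    ‖Atheta ω R a‖ ≤ 2 * cω + 1 + ca := by
  have hcω := (eucl_nonneg ω).trans hω
  have hca := (eucl_nonneg a).trans ha
  refine norm_le_of_eucl_mulVec_le (by positivity) fun x => ?_
  have hrot : ∀ z, eucl z ≤ eucl x → eucl (-(skew ω *ᵥ z)) ≤ cω * eucl x := fun z hz => by
    rw [eucl_neg]
    exact (eucl_skew_mulVec_le ω z).trans (mul_le_mul hω hz (eucl_nonneg z) hcω)
  have hyaw : eucl (yawErr x • (Rᵀ *ᵥ (skew a *ᵥ e3))) ≤ eucl x * ca := by
    rw [eucl_smul, eucl_rot_mulVec (transpose_mem_specialOrthogonalGroup hR)]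
    exact mul_le_mul (abs_yawErr_le x) ((eucl_skew_e3_le a).trans ha) (eucl_nonneg _)
      (eucl_nonneg x)
  rw [Atheta_mulVec]
  calc _ ≤ (eucl (-(skew ω *ᵥ posErr x)) + eucl (velErr x))
        + (eucl (-(skew ω *ᵥ velErr x)) + eucl (yawErr x • (Rᵀ *ᵥ (skew a *ᵥ e3)))) := by
        refine (eucl_sumElim_le _ _).trans ?_
        rw [eucl_zero, add_zero]
        exact (eucl_sumElim_le _ _).trans (add_le_add (eucl_add_le _ _) (eucl_add_le _ _))
    _ ≤ (2 * cω + 1 + ca) * eucl x := by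
        linarith [hrot _ (eucl_posErr_le x), hrot _ (eucl_velErr_le x), eucl_velErr_le x]

theorem norm_Ctheta_le {y : V3} (hy : eucl y = 1) : ‖Ctheta y‖ ≤ 1 :=
  norm_le_of_eucl_mulVec_le zero_le_one fun x => by
    rw [Ctheta_mulVec, one_mul]
    exact (eucl_proj_mulVec_le hy _).trans (eucl_posErr_le x)

theorem norm_le_card_mul_card_mul {m n : Type} [Fintype m] [Fintype n] [DecidableEq n]
    {M : Matrix m n ℝ} {ε : ℝ} (hε : 0 ≤ ε) (hM : ∀ i j, |M i j| ≤ ε) :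
    ‖M‖ ≤ Fintype.card m * (Fintype.card n * ε) := by
  refine norm_le_of_eucl_mulVec_le (by positivity) fun z => ?_
  have hcoord : ‖M *ᵥ z‖ ≤ Fintype.card n * (ε * eucl z) := by
    refine (pi_norm_le_iff_of_nonneg (mul_nonneg (Nat.cast_nonneg _)
      (mul_nonneg hε (eucl_nonneg z)))).2 fun i => ?_
    calc ‖(M *ᵥ z) i‖ ≤ ∑ j, |M i j * z j| := Finset.abs_sum_le_sum_abs _ _
      _ ≤ ∑ _j : n, ε * eucl z := Finset.sum_le_sum fun j _ => by
          rw [abs_mul]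
          exact mul_le_mul (hM i j) (abs_apply_le_eucl z j) (abs_nonneg _) hε
      _ = Fintype.card n * (ε * eucl z) := by simp
  calc eucl (M *ᵥ z) ≤ Fintype.card m * ‖M *ᵥ z‖ := eucl_le_card_mul_norm _
    _ ≤ Fintype.card m * (Fintype.card n * (ε * eucl z)) := by gcongr
    _ = Fintype.card m * (Fintype.card n * ε) * eucl z := by ring

end Norm

end ErrorState

/-! ### Uniform observability -/

section Gramian

variable {m n : Type} [Fintype m]

theorem posSemidef_transpose_mul_mul [Finite n] {M : Matrix m m ℝ} (hM : M.PosSemidef)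
    (N : Matrix m n ℝ) : (Nᵀ * M * N).PosSemidef := by
  simpa using hM.conjTranspose_mul_mul_same N

variable [Fintype n]

theorem dotProduct_transpose_mul_mul_mulVec (M : Matrix m m ℝ) (N : Matrix m n ℝ) (z : n → ℝ) :
    z ⬝ᵥ ((Nᵀ * M * N) *ᵥ z) = (N *ᵥ z) ⬝ᵥ (M *ᵥ (N *ᵥ z)) := by
  rw [← Matrix.mulVec_mulVec, ← Matrix.mulVec_mulVec, Matrix.dotProduct_transpose_mulVec,
    dotProduct_comm]

variable [DecidableEq m] [DecidableEq n]

theorem succeq_matIntegral_of_le_integral {F : ℝ → Matrix n n ℝ} {C : ℝ → Matrix m n ℝ}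
    {D : ℝ → Matrix m m ℝ} {a b c d : ℝ} (hab : a ≤ b) (hF : ContinuousOn F (Set.Icc a b))
    (hC : ContinuousOn C (Set.Icc a b)) (hD : ContinuousOn D (Set.Icc a b)) (hd : 0 ≤ d)
    (hDd : ∀ s ∈ Set.Icc a b, Succeq (D s) (d • 1))
    (h : ∀ q, c * eucl q ^ 2 ≤ ∫ s in a..b, eucl (C s *ᵥ (F s *ᵥ q)) ^ 2) :
    Succeq (matIntegral (fun s => (F s)ᵀ * ((C s)ᵀ * D s * C s) * F s) a b) ((d * c) • 1) := by
  have hcont : ContinuousOn (fun s => (F s)ᵀ * ((C s)ᵀ * D s * C s) * F s) (Set.Icc a b) :=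
    continuousOn_matrix_mul (continuousOn_matrix_mul (continuousOn_transpose hF)
      (continuousOn_matrix_mul (continuousOn_matrix_mul (continuousOn_transpose hC) hD) hC)) hF
  have hpos := posSemidef_matIntegral hab hcont fun s hs => posSemidef_transpose_mul_mul
    (posSemidef_transpose_mul_mul (posSemidef_of_succeq_smul_one hd (hDd s hs)) (C s)) (F s)
  refine succeq_smul_one_of_le (transpose_eq_of_posSemidef hpos) fun q => ?_
  have hout : ContinuousOn (fun s => eucl (C s *ᵥ (F s *ᵥ q)) ^ 2) (Set.Icc a b) :=
    (continuous_eucl.comp_continuousOn (continuousOn_mulVec hC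
      (continuousOn_mulVec hF continuousOn_const))).pow 2
  rw [dotProduct_matIntegral_mulVec hab hcont, mul_assoc]
  calc d * (c * eucl q ^ 2) ≤ ∫ s in a..b, d * eucl (C s *ᵥ (F s *ᵥ q)) ^ 2 := by
        rw [intervalIntegral.integral_const_mul]
        exact mul_le_mul_of_nonneg_left (h q) hd
    _ ≤ _ := by
        refine intervalIntegral.integral_mono_on hab
          ((continuousOn_const.mul hout).intervalIntegrable_of_Icc hab)
          ((continuousOn_dotProduct continuousOn_const (continuousOn_mulVec hcont
            continuousOn_const)).intervalIntegrable_of_Icc hab) fun s hs => ?_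
        rw [dotProduct_transpose_mul_mul_mulVec, dotProduct_transpose_mul_mul_mulVec]
        exact mul_eucl_sq_le_of_succeq (hDd s hs) _

end Gramian

section LinearError

variable {Q Rhat : ℝ → M3} {ω a : ℝ → V3} {x : ℝ → V7} {J : Set ℝ}

theorem hasAcceleration_rot_posErr
    (hQ : ∀ s ∈ J, MatHasDerivWithinAt Q (Q s * skew (ω s)) J s)
    (hx : ∀ s ∈ J, HasDerivWithinAt x (Atheta (ω s) (Rhat s) (a s) *ᵥ x s) J s) :
    HasAcceleration (fun s => Q s *ᵥ posErr (x s)) (fun s => Q s *ᵥ velErr (x s))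
      (fun s => yawErr (x s) • (Q s *ᵥ ((Rhat s)ᵀ *ᵥ (skew (a s) *ᵥ e3)))) J := by
  have hcomp : ∀ s ∈ J, ∀ i, HasDerivWithinAt (fun r => x r i)
      ((Atheta (ω s) (Rhat s) (a s) *ᵥ x s) i) J s := fun s hs => hasDerivWithinAt_pi.1 (hx s hs)
  refine ⟨fun s hs => ?_, fun s hs => ?_⟩
  · refine ((hQ s hs).mulVec (hasDerivWithinAt_pi.2 fun i =>
      hcomp s hs (Sum.inl (Sum.inl i)))).congr_deriv ?_
    simp only [Atheta_mulVec, Sum.elim_inl]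
    change (Q s * skew (ω s)) *ᵥ posErr (x s)
      + Q s *ᵥ (-(skew (ω s) *ᵥ posErr (x s)) + velErr (x s)) = _
    rw [Matrix.mulVec_add, Matrix.mulVec_neg, Matrix.mulVec_mulVec, add_neg_cancel_left]
  · refine ((hQ s hs).mulVec (hasDerivWithinAt_pi.2 fun i =>
      hcomp s hs (Sum.inl (Sum.inr i)))).congr_deriv ?_
    simp only [Atheta_mulVec, Sum.elim_inl, Sum.elim_inr]
    change (Q s * skew (ω s)) *ᵥ velErr (x s)
      + Q s *ᵥ (-(skew (ω s) *ᵥ velErr (x s)) + yawErr (x s) • _) = _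
    rw [Matrix.mulVec_add, Matrix.mulVec_neg, Matrix.mulVec_mulVec, add_neg_cancel_left,
      Matrix.mulVec_smul]

theorem yawErr_eq_of_hasDerivWithinAt {t t' : ℝ}
    (hx : ∀ s ∈ Set.Icc t t', HasDerivWithinAt x (Atheta (ω s) (Rhat s) (a s) *ᵥ x s)
      (Set.Icc t t') s) : ∀ s ∈ Set.Icc t t', yawErr (x s) = yawErr (x t) := by
  have hyaw : ∀ s ∈ Set.Icc t t', HasDerivWithinAt (fun r => yawErr (x r)) 0 (Set.Icc t t') s :=
    fun s hs => (hasDerivWithinAt_pi.1 (hx s hs) (Sum.inr 0)).congr_deriv (by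
      simp [Atheta_mulVec])
  exact constant_of_derivWithin_zero (fun s hs => (hyaw s hs).differentiableWithinAt)
    fun s hs => (hyaw s (Set.Ico_subset_Icc_self hs)).derivWithin
      (uniqueDiffOn_Icc (hs.1.trans_lt hs.2) s (Set.Ico_subset_Icc_self hs))

end LinearError

section Observability

open scoped Matrix.Norms.L2Operator

variable {g : ℝ} {QB QT : ℝ → M3} {pB vB ωB aB pT vT ωT aT : ℝ → V3}
  (hB : IsRigidMotion g QB pB vB ωB aB) (hT : IsRigidMotion g QT pT vT ωT aT)
  (hsep : ∀ t, 0 ≤ t → pB t ≠ pT t)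
include hB hT

theorem rot_relAtt_transpose_mulVec {t : ℝ} (ht : 0 ≤ t) :
    QB t *ᵥ ((relAtt QB QT t)ᵀ *ᵥ (skew (aT t) *ᵥ e3)) = bVec QT aT t := by
  rw [relAtt, Matrix.transpose_mul, Matrix.transpose_transpose, ← Matrix.mulVec_mulVec,
    Matrix.mulVec_mulVec _ (QB t), mul_transpose_self_of_mem_specialOrthogonalGroup (hB.rot t ht),
    Matrix.one_mulVec, bVec, skew_mulVec, rot_mulVec_cross (hT.rot t ht)]

theorem eucl_rot_transpose_mulVec_sub_bVec_le (Rhat : M3) {t : ℝ} (ht : 0 ≤ t) :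
    eucl (QB t *ᵥ (Rhatᵀ *ᵥ (skew (aT t) *ᵥ e3)) - bVec QT aT t)
      ≤ ‖Rhat - relAtt QB QT t‖ * eucl (aT t) := by
  rw [← rot_relAtt_transpose_mulVec hB hT ht, ← Matrix.mulVec_sub, eucl_rot_mulVec (hB.rot t ht),
    ← Matrix.sub_mulVec, ← Matrix.transpose_sub, ← norm_transpose (Rhat - _)]
  exact (eucl_mulVec_le _ _).trans
    (mul_le_mul_of_nonneg_left (eucl_skew_e3_le _) (norm_nonneg _))

theorem half_le_dotProduct_rot_transpose_mulVec {Rhat : M3} {b₀ : V3} {c₀ c t : ℝ} (ht : 0 ≤ t)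
    (hR : ‖Rhat - relAtt QB QT t‖ ≤ c₀ / (2 * (eucl b₀ * c + 1))) (haT : eucl (aT t) ≤ c)
    (hc₀ : 0 ≤ c₀) (hb : c₀ ≤ b₀ ⬝ᵥ bVec QT aT t) :
    c₀ / 2 ≤ b₀ ⬝ᵥ (QB t *ᵥ (Rhatᵀ *ᵥ (skew (aT t) *ᵥ e3))) := by
  have hc := (eucl_nonneg _).trans haT
  have hb₀ := eucl_nonneg b₀
  have hdist : eucl b₀ * eucl (QB t *ᵥ (Rhatᵀ *ᵥ (skew (aT t) *ᵥ e3)) - bVec QT aT t)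
      ≤ c₀ / 2 :=
    calc _ ≤ eucl b₀ * (c₀ / (2 * (eucl b₀ * c + 1)) * c) := by
          gcongr
          refine (eucl_rot_transpose_mulVec_sub_bVec_le hB hT Rhat ht).trans ?_
          exact mul_le_mul hR haT (eucl_nonneg _) (by positivity)
      _ = c₀ / 2 * (eucl b₀ * c / (eucl b₀ * c + 1)) := by field_simp
      _ ≤ c₀ / 2 := mul_le_of_le_one_right (by positivity)
          (div_le_one_of_le₀ (by linarith) (by positivity))
  have hdot := neg_le_of_abs_le (abs_dotProduct_le_eucl_mul_eucl b₀
    (QB t *ᵥ (Rhatᵀ *ᵥ (skew (aT t) *ᵥ e3)) - bVec QT aT t))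
  rw [dotProduct_sub] at hdot
  linarith

include hsep

/-- In the inertial frame the position error of the linear system moves with an acceleration
that is close to a constant multiple of `b`. -/
theorem exists_integral_Ctheta_ge {δ μ c₀ c : ℝ} {b₀ : V3}
    (hδ : 0 < δ) (hμ : 0 < μ)
    (hPE : BearingPE (bearingI QB pB pT) δ μ) (haT : ∀ t, 0 ≤ t → eucl (aT t) ≤ c)
    (hc₀ : 0 < c₀) (hb : ∀ t, 0 ≤ t → c₀ ≤ b₀ ⬝ᵥ bVec QT aT t) :
    ∃ ε δ' μ' : ℝ, 0 < ε ∧ 0 < δ' ∧ 0 < μ' ∧ ∀ Rhat : ℝ → M3,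
      (∀ t, 0 ≤ t → Rhat t ∈ Matrix.specialOrthogonalGroup (Fin 3) ℝ) →
      (∀ t, 0 ≤ t → ‖Rhat t - relAtt QB QT t‖ ≤ ε) → ∀ t, 0 ≤ t → ∀ x : ℝ → V7,
      (∀ s ∈ Set.Icc t (t + δ'), HasDerivWithinAt x (Atheta (ωB s) (Rhat s) (aT s) *ᵥ x s)
        (Set.Icc t (t + δ')) s) →
      δ' * μ' * eucl (x t) ^ 2
        ≤ ∫ s in t..t + δ', eucl (Ctheta (bearing QB pB pT s) *ᵥ x s) ^ 2 := by
  have hc : 0 ≤ c := (eucl_nonneg _).trans (haT 0 le_rfl)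
  have hb₀ := eucl_nonneg b₀
  obtain ⟨δ', μ', hδ', hμ', hobs⟩ :=
    exists_observability_constants hδ hμ (half_pos hc₀) hc b₀
  refine ⟨c₀ / (2 * (eucl b₀ * c + 1)), δ', μ', by positivity, hδ', hμ',
    fun Rhat hR hRε t ht x hx => ?_⟩
  have hacc := hasAcceleration_rot_posErr
    (fun s hs => (hB.att s (ht.trans hs.1)).mono fun r hr => ht.trans hr.1) hx
  have hyaw := yawErr_eq_of_hasDerivWithinAt hx
  have hbc : ∀ s, 0 ≤ s → eucl (QB s *ᵥ ((Rhat s)ᵀ *ᵥ (skew (aT s) *ᵥ e3))) ≤ c := fun s hs => by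
    rw [eucl_rot_mulVec (hB.rot s hs),
      eucl_rot_mulVec (transpose_mem_specialOrthogonalGroup (hR s hs))]
    exact (eucl_skew_e3_le _).trans (haT s hs)
  have hbb₀ : ∀ s, 0 ≤ s →
      c₀ / 2 ≤ b₀ ⬝ᵥ (QB s *ᵥ ((Rhat s)ᵀ *ᵥ (skew (aT s) *ᵥ e3))) := fun s hs =>
    half_le_dotProduct_rot_transpose_mulVec hB hT hs (hRε s hs) (haT s hs) hc₀.le (hb s hs)
  have hkey := hobs _ hPE (continuousOn_bearingI hB hT hsep) (fun s hs => eucl_bearingI hB hsep hs)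
    ht ⟨hacc.pos, fun s hs => by simpa only [hyaw s hs] using hacc.vel s hs⟩
    (fun s hs => hbb₀ s (ht.trans hs.1)) (fun s hs => hbc s (ht.trans hs.1))
  rw [eucl_rot_mulVec (hB.rot t ht), eucl_rot_mulVec (hB.rot t ht), ← eucl_state_sq] at hkey
  refine hkey.trans_eq (intervalIntegral.integral_congr fun s hs => ?_)
  rw [Set.uIcc_of_le (by linarith)] at hs
  simp only [bearingI, eucl_proj_rot_mulVec (hB.rot s (ht.trans hs.1)), Ctheta_mulVec]

theorem exists_isTransitionMatrix_succeq_gramian {δ μ c₀ c : ℝ} {b₀ : V3}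
    (hωB : ContinuousOn ωB (Set.Ici 0)) (hδ : 0 < δ)
    (hμ : 0 < μ) (hPE : BearingPE (bearingI QB pB pT) δ μ) (haT : ContinuousOn aT (Set.Ici 0))
    (haTc : ∀ t, 0 ≤ t → eucl (aT t) ≤ c) (hc₀ : 0 < c₀)
    (hb : ∀ t, 0 ≤ t → c₀ ≤ b₀ ⬝ᵥ bVec QT aT t) :
    ∃ ε δ' μ' : ℝ, 0 < ε ∧ 0 < δ' ∧ 0 < μ' ∧ ∀ Rhat : ℝ → M3, ContinuousOn Rhat (Set.Ici 0) →
      (∀ t, 0 ≤ t → Rhat t ∈ Matrix.specialOrthogonalGroup (Fin 3) ℝ) →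
      (∀ t, 0 ≤ t → ‖Rhat t - relAtt QB QT t‖ ≤ ε) →
      ∃ Φ, IsTransitionMatrix (fun t => Atheta (ωB t) (Rhat t) (aT t)) Φ ∧
        ∀ (D : ℝ → M3) (d : ℝ), ContinuousOn D (Set.Ici 0) → 0 ≤ d →
          (∀ t, 0 ≤ t → Succeq (D t) (d • 1)) → ∀ t, 0 ≤ t →
          Succeq (matIntegral (fun s => (Φ s t)ᵀ * ((Ctheta (bearing QB pB pT s))ᵀ * D s
            * Ctheta (bearing QB pB pT s)) * Φ s t) t (t + δ')) ((d * (δ' * μ')) • 1) := by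
  obtain ⟨ε, δ', μ', hε, hδ', hμ', hobs⟩ :=
    exists_integral_Ctheta_ge hB hT hsep hδ hμ hPE haTc hc₀ hb
  refine ⟨ε, δ', μ', hε, hδ', hμ', fun Rhat hRc hR hRε => ?_⟩
  obtain ⟨Φ, hΦ⟩ := exists_isTransitionMatrix (continuousOn_Atheta hωB hRc haT)
  refine ⟨Φ, hΦ, fun D d hD hd hDd t ht => ?_⟩
  have hsub : Set.Icc t (t + δ') ⊆ Set.Ici 0 := fun s hs => ht.trans hs.1
  have hflow : ∀ s ∈ Set.Icc t (t + δ'), MatHasDerivWithinAt (fun r => Φ r t)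
      (Atheta (ωB s) (Rhat s) (aT s) * Φ s t) (Set.Icc t (t + δ')) s := fun s hs =>
    ((hΦ t ht).2 s hs.1).mono fun r hr => hr.1
  refine succeq_matIntegral_of_le_integral (by linarith)
    (fun s hs => (hflow s hs).continuousWithinAt)
    ((continuousOn_Ctheta (continuousOn_bearing hB hT hsep)).mono hsub) (hD.mono hsub) hd
    (fun s hs => hDd s (hsub hs)) fun q => ?_
  have hq := hobs Rhat hR hRε t ht _ (hasDerivWithinAt_flow_mulVec hflow q)
  rwa [(hΦ t ht).1, Matrix.one_mulVec] at hq

end Observability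

/-! ### The attitude estimate -/

section Attitude

theorem rodrigues_e3 (θ : ℝ) : rodrigues θ e3 =
    !![Real.cos θ, -Real.sin θ, 0; Real.sin θ, Real.cos θ, 0; 0, 0, 1] := by
  ext i j
  fin_cases i <;> fin_cases j <;> simp [rodrigues, skew, e3]

theorem rodrigues_e3_mem_specialOrthogonalGroup (θ : ℝ) :
    rodrigues θ e3 ∈ Matrix.specialOrthogonalGroup (Fin 3) ℝ := by
  rw [rodrigues_e3]
  refine Matrix.mem_specialOrthogonalGroup_iff.2 ⟨?_, ?_⟩
  · rw [Matrix.mem_orthogonalGroup_iff']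
    ext i j
    fin_cases i <;> fin_cases j <;>
      simp [Matrix.mul_apply, Fin.sum_univ_three] <;> linarith [Real.sin_sq_add_cos_sq θ]
  · rw [Matrix.det_fin_three]
    simp [← sq]

theorem attEst_mem_specialOrthogonalGroup {R : M3}
    (hR : R ∈ Matrix.specialOrthogonalGroup (Fin 3) ℝ) (x : V7) :
    attEst R x ∈ Matrix.specialOrthogonalGroup (Fin 3) ℝ :=
  mul_mem (rodrigues_e3_mem_specialOrthogonalGroup _) hR

theorem continuous_yawErr : Continuous yawErr := continuous_apply _

theorem continuous_rodrigues_e3 : Continuous fun θ => rodrigues θ e3 := by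
  refine continuous_pi fun i => continuous_pi fun j => ?_
  simp only [rodrigues, Matrix.add_apply, Matrix.smul_apply, smul_eq_mul]
  fun_prop

theorem continuousOn_attEst {X : Type} [TopologicalSpace X] {J : Set X} {R : X → M3} {x : X → V7}
    (hR : ContinuousOn R J) (hx : ContinuousOn x J) :
    ContinuousOn (fun s => attEst (R s) (x s)) J :=
  continuousOn_matrix_mul ((continuous_rodrigues_e3.comp continuous_yawErr).comp_continuousOn hx) hR

theorem eucl_skew_e3_mulVec_le (z : V3) : eucl (skew e3 *ᵥ z) ≤ eucl z := by
  simpa [eucl_e3] using eucl_skew_mulVec_le e3 z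

open scoped Matrix.Norms.L2Operator

theorem norm_rodrigues_e3_sub_one_le (θ : ℝ) : ‖rodrigues θ e3 - 1‖ ≤ 2 * |θ| := by
  refine norm_le_of_eucl_mulVec_le (by positivity) fun z => ?_
  have hexpand : (rodrigues θ e3 - 1) *ᵥ z
      = Real.sin θ • (skew e3 *ᵥ z) + (1 - Real.cos θ) • (skew e3 *ᵥ (skew e3 *ᵥ z)) := by
    rw [rodrigues, add_assoc, add_sub_cancel_left, Matrix.add_mulVec, Matrix.smul_mulVec,
      Matrix.smul_mulVec, Matrix.mulVec_mulVec]
  have hcos : |1 - Real.cos θ| ≤ |θ| := by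
    simpa [abs_sub_comm] using Real.abs_cos_sub_cos_le θ 0
  calc eucl ((rodrigues θ e3 - 1) *ᵥ z)
      ≤ |Real.sin θ| * eucl (skew e3 *ᵥ z)
        + |1 - Real.cos θ| * eucl (skew e3 *ᵥ (skew e3 *ᵥ z)) := by
        rw [hexpand, ← eucl_smul, ← eucl_smul]
        exact eucl_add_le _ _
    _ ≤ |θ| * eucl z + |θ| * eucl z :=
        add_le_add
          (mul_le_mul Real.abs_sin_le_abs (eucl_skew_e3_mulVec_le z) (eucl_nonneg _) (abs_nonneg θ))
          (mul_le_mul hcos ((eucl_skew_e3_mulVec_le _).trans (eucl_skew_e3_mulVec_le z))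
            (eucl_nonneg _) (abs_nonneg θ))
    _ = 2 * |θ| * eucl z := by ring

theorem norm_attEst_sub_le {R : M3} (hR : R ∈ Matrix.specialOrthogonalGroup (Fin 3) ℝ) (x : V7) :
    ‖attEst R x - R‖ ≤ 2 * |yawErr x| := by
  refine norm_le_of_eucl_mulVec_le (by positivity) fun z => ?_
  rw [attEst, Matrix.sub_mulVec, ← Matrix.mulVec_mulVec, ← eucl_rot_mulVec hR z]
  nth_rw 2 [← Matrix.one_mulVec (R *ᵥ z)]
  rw [← Matrix.sub_mulVec]
  exact (eucl_mulVec_le _ _).trans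
    (mul_le_mul_of_nonneg_right (norm_rodrigues_e3_sub_one_le _) (eucl_nonneg _))

end Attitude

section UnifLip

variable {ω a : ℝ → V3} {R : ℝ → M3} {t₀ T : ℝ} {B : Set V7}

theorem unifLip_attEst (hR : ContinuousOn R (Set.Icc t₀ T)) (hB : Bornology.IsBounded B)
    (i j : Fin 3) : UnifLip (Set.Icc t₀ T) B fun t x => attEst (R t) x i j := by
  refine UnifLip.matrix_mul (fun i j => ?_)
    (fun i j => unifLip_of_continuousOn (continuousOn_matrix_elem hR i j)) i j
  have hsin : UnifLip (Set.Icc t₀ T) B fun _ x => Real.sin (yawErr x) :=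
    unifLip_of_lipschitzWith (Real.lipschitzWith_sin.comp (LipschitzWith.eval (Sum.inr 0))) hB
  have hcos : UnifLip (Set.Icc t₀ T) B fun _ x => Real.cos (yawErr x) :=
    unifLip_of_lipschitzWith (Real.lipschitzWith_cos.comp (LipschitzWith.eval (Sum.inr 0))) hB
  exact ((unifLip_const _).add (hsin.mul (unifLip_const _))).add
    (((unifLip_const 1).sub hcos).mul (unifLip_const _))

theorem unifLip_Atheta_attEst (hω : ContinuousOn ω (Set.Icc t₀ T))
    (hR : ContinuousOn R (Set.Icc t₀ T)) (ha : ContinuousOn a (Set.Icc t₀ T))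
    (hB : Bornology.IsBounded B) (i j : Idx7) :
    UnifLip (Set.Icc t₀ T) B fun t x => Atheta (ω t) (attEst (R t) x) (a t) i j := by
  have hcol : ∀ i, UnifLip (Set.Icc t₀ T) B
      fun t x => ((attEst (R t) x)ᵀ *ᵥ (skew (a t) *ᵥ e3)) i :=
    UnifLip.matrix_mulVec (fun i j => unifLip_attEst hR hB j i) fun i => unifLip_of_continuousOn
      (continuousOn_pi.1 (continuousOn_mulVec (continuousOn_skew ha) continuousOn_const) i)
  rcases i with (i | i) | i <;> rcases j with (j | j) | j <;>
    simp only [Atheta, Matrix.fromBlocks_apply₁₁, Matrix.fromBlocks_apply₁₂,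
      Matrix.fromBlocks_apply₂₁, Matrix.fromBlocks_apply₂₂, Matrix.replicateCol_apply,
      Sum.elim_inl, Sum.elim_inr, Matrix.neg_apply, Matrix.zero_apply, Pi.zero_apply] <;>
    first
      | exact unifLip_const _
      | exact (unifLip_of_continuousOn (continuousOn_matrix_elem (continuousOn_skew hω) _ _)).neg
      | exact hcol _

end UnifLip

/-! ### Quadratic remainders -/

namespace IsQuadraticRemainder

variable {ρ : ℝ → V7 → V7}

theorem continuousOn (hρ : IsQuadraticRemainder ρ) (x : V7) :
    ContinuousOn (fun t => ρ t x) (Set.Ici 0) :=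
  hρ.cont.comp (continuousOn_id.prodMk continuousOn_const) fun _ ht => ⟨ht, Set.mem_univ x⟩

theorem exists_eucl_le_mul (hρ : IsQuadraticRemainder ρ) {c : ℝ} (hc : 0 < c) :
    ∃ r : ℝ, 0 < r ∧ ∀ t, 0 ≤ t → ∀ x, eucl x ≤ r → eucl (ρ t x) ≤ c * eucl x := by
  obtain ⟨r, k, hr, hquad⟩ := hρ.quad
  have hk : 0 < |k| + 1 := by positivity
  refine ⟨min r (c / (|k| + 1)), lt_min hr (div_pos hc hk), fun t ht x hx => ?_⟩
  have hx0 := eucl_nonneg x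
  have hsmall : (|k| + 1) * eucl x ≤ c := by
    rw [mul_comm, ← le_div_iff₀ hk]
    exact hx.trans (min_le_right _ _)
  calc eucl (ρ t x) ≤ k * |yawErr x| ^ 2 := hquad t ht x (hx.trans (min_le_left _ _))
    _ ≤ (|k| + 1) * eucl x ^ 2 := by
        gcongr
        · linarith [le_abs_self k]
        · exact abs_yawErr_le x
    _ = (|k| + 1) * eucl x * eucl x := by ring
    _ ≤ c * eucl x := by gcongr

theorem apply_zero (hρ : IsQuadraticRemainder ρ) {t : ℝ} (ht : 0 ≤ t) : ρ t 0 = 0 := by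
  obtain ⟨r, k, hr, hquad⟩ := hρ.quad
  have hle := hquad t ht 0 (by simpa using hr.le)
  by_contra hne
  have hpos := eucl_pos hne
  simp only [yawErr, Pi.zero_apply, abs_zero, ne_eq, OfNat.ofNat_ne_zero, not_false_eq_true,
    zero_pow, mul_zero] at hle
  linarith

theorem unifLip (hρ : IsQuadraticRemainder ρ) (T r : ℝ) (i : Idx7) :
    UnifLip (Set.Icc 0 T) (Metric.closedBall 0 r) fun t x => ρ t x i := by
  have hN : (0 : ℝ) ≤ Fintype.card Idx7 := Nat.cast_nonneg _
  obtain ⟨L, hL⟩ := hρ.lip T (Fintype.card Idx7 * |r|)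
  have hball : ∀ x ∈ Metric.closedBall (0 : V7) |r|, eucl x ≤ Fintype.card Idx7 * |r| :=
    fun x hx => (eucl_le_card_mul_norm x).trans
      (mul_le_mul_of_nonneg_left (mem_closedBall_zero_iff.1 hx) hN)
  have hlip : ∀ t ∈ Set.Icc 0 T, ∀ x ∈ Metric.closedBall (0 : V7) |r|,
      ∀ x' ∈ Metric.closedBall (0 : V7) |r|,
      |ρ t x i - ρ t x' i| ≤ |L| * Fintype.card Idx7 * dist x x' := fun t ht x hx x' hx' =>
    calc |ρ t x i - ρ t x' i| ≤ eucl (ρ t x - ρ t x') := abs_apply_le_eucl (ρ t x - ρ t x') i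
      _ ≤ L * eucl (x - x') := hL t ht.1 ht.2 x x' (hball x hx) (hball x' hx')
      _ ≤ |L| * (Fintype.card Idx7 * ‖x - x'‖) :=
          mul_le_mul (le_abs_self L) (eucl_le_card_mul_norm _) (eucl_nonneg _) (abs_nonneg L)
      _ = |L| * Fintype.card Idx7 * dist x x' := by rw [dist_eq_norm, mul_assoc]
  have hsub : Metric.closedBall (0 : V7) r ⊆ Metric.closedBall 0 |r| :=
    Metric.closedBall_subset_closedBall (le_abs_self r)
  have hzero : (0 : V7) ∈ Metric.closedBall 0 |r| := Metric.mem_closedBall_self (abs_nonneg r)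
  have hC : 0 ≤ |L| * Fintype.card Idx7 := by positivity
  refine ⟨|L| * Fintype.card Idx7 * (|r| + 1), by positivity, fun t ht x hx => ?_,
    fun t ht x hx x' hx' => (hlip t ht x (hsub hx) x' (hsub hx')).trans ?_⟩
  · have hx0 := hlip t ht x (hsub hx) 0 hzero
    rw [hρ.apply_zero ht.1, Pi.zero_apply, sub_zero] at hx0
    refine hx0.trans (mul_le_mul_of_nonneg_left ?_ hC)
    exact (hsub hx).trans (by linarith)
  · exact mul_le_mul_of_nonneg_right (le_mul_of_one_le_right hC (by linarith [abs_nonneg r]))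
      dist_nonneg

end IsQuadraticRemainder

section ExactRemainder

/-- The velocity part of the remainder, after expansion of `R̂ᵀ (I - exp(θ e₃^×)) a` in `θ`. -/
noncomputable def velRemainder (R : M3) (a : V3) (θ : ℝ) : V3 :=
  Rᵀ *ᵥ ((Real.cos θ - 1 + θ * Real.sin θ) • (skew e3 *ᵥ (skew a *ᵥ e3))
    + (Real.sin θ - θ * Real.cos θ) • (skew a *ᵥ e3))

/-- The remainder for which the expanded error dynamics coincide with the unexpanded ones. -/
noncomputable def exactRemainder (aT : ℝ → V3) (R : ℝ → M3) (t : ℝ) (x : V7) : V7 :=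
  Sum.elim (Sum.elim 0 (velRemainder (R t) (aT t) (yawErr x))) 0

theorem rodrigues_transpose_mulVec_one_sub_rodrigues_mulVec (a : V3) (θ : ℝ) :
    (rodrigues θ e3)ᵀ *ᵥ ((1 - rodrigues θ e3) *ᵥ a)
      = θ • ((rodrigues θ e3)ᵀ *ᵥ (skew a *ᵥ e3))
        + ((Real.cos θ - 1 + θ * Real.sin θ) • (skew e3 *ᵥ (skew a *ᵥ e3))
          + (Real.sin θ - θ * Real.cos θ) • (skew a *ᵥ e3)) := by
  have hcol : skew a *ᵥ e3 = ![a 1, -a 0, 0] := by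
    ext i
    fin_cases i <;> simp [skew, e3, Matrix.mulVec, dotProduct, Fin.sum_univ_three]
  have hperp : skew e3 *ᵥ ![a 1, -a 0, 0] = ![a 0, a 1, 0] := by
    ext i
    fin_cases i <;> simp [skew, e3, Matrix.mulVec, dotProduct, Fin.sum_univ_three]
  have hsc := Real.sin_sq_add_cos_sq θ
  rw [rodrigues_e3, hcol, hperp]
  ext i
  fin_cases i <;> simp [Matrix.mulVec, dotProduct, Fin.sum_univ_three, Matrix.sub_apply]
  · linear_combination (-a 0) * hsc
  · linear_combination (-a 1) * hsc

theorem attEst_transpose_mulVec_one_sub_rodrigues_mulVec (R : M3) (a : V3) (x : V7) :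
    (attEst R x)ᵀ *ᵥ ((1 - rodrigues (yawErr x) e3) *ᵥ a)
      = yawErr x • ((attEst R x)ᵀ *ᵥ (skew a *ᵥ e3)) + velRemainder R a (yawErr x) := by
  rw [attEst, Matrix.transpose_mul, ← Matrix.mulVec_mulVec,
    rodrigues_transpose_mulVec_one_sub_rodrigues_mulVec, ← Matrix.mulVec_mulVec,
    Matrix.mulVec_add, Matrix.mulVec_smul, velRemainder]

theorem exactErrField_eq_errField (ωB aT : ℝ → V3) (R : ℝ → M3) (y : ℝ → V3) (D : ℝ → M3) :
    exactErrField ωB aT R y D = errField ωB aT R y D (exactRemainder aT R) := by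
  funext t x P
  rw [exactErrField, errField, Atheta_mulVec,
    attEst_transpose_mulVec_one_sub_rodrigues_mulVec, exactRemainder, sub_add_eq_add_sub]
  congr 1
  ext i
  rcases i with (i | i) | i <;> simp [add_assoc]

theorem hasDerivAt_cos_sub_one_add_mul_sin (θ : ℝ) :
    HasDerivAt (fun θ => Real.cos θ - 1 + θ * Real.sin θ) (θ * Real.cos θ) θ :=
  (((Real.hasDerivAt_cos θ).sub_const 1).add
    ((hasDerivAt_id θ).mul (Real.hasDerivAt_sin θ))).congr_deriv (by simp)

theorem hasDerivAt_sin_sub_mul_cos (θ : ℝ) :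
    HasDerivAt (fun θ => Real.sin θ - θ * Real.cos θ) (θ * Real.sin θ) θ :=
  ((Real.hasDerivAt_sin θ).sub
    ((hasDerivAt_id θ).mul (Real.hasDerivAt_cos θ))).congr_deriv (by simp)

theorem abs_sub_le_mul_of_hasDerivAt_mul {φ ψ : ℝ → ℝ}
    (hφ : ∀ u, HasDerivAt φ (u * ψ u) u) (hψ : ∀ u, |ψ u| ≤ 1) {r u v : ℝ} (hu : |u| ≤ r)
    (hv : |v| ≤ r) : |φ u - φ v| ≤ r * |u - v| :=
  (convex_Icc (-r) r).norm_image_sub_le_of_norm_hasDerivWithin_le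
    (fun w _ => (hφ w).hasDerivWithinAt) (fun w hw => by
      rw [Real.norm_eq_abs, abs_mul]
      exact (mul_le_of_le_one_right (abs_nonneg w) (hψ w)).trans (abs_le.2 hw))
    (abs_le.1 hv) (abs_le.1 hu)

theorem eucl_velRemainder_sub_le {R : M3} (hR : R ∈ Matrix.specialOrthogonalGroup (Fin 3) ℝ)
    {a : V3} {c : ℝ} (ha : eucl a ≤ c) {r θ θ' : ℝ} (hθ : |θ| ≤ r) (hθ' : |θ'| ≤ r) :
    eucl (velRemainder R a θ - velRemainder R a θ') ≤ 2 * c * r * |θ - θ'| := by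
  have hcos := abs_sub_le_mul_of_hasDerivAt_mul hasDerivAt_cos_sub_one_add_mul_sin
    Real.abs_cos_le_one hθ hθ'
  have hsin := abs_sub_le_mul_of_hasDerivAt_mul hasDerivAt_sin_sub_mul_cos
    Real.abs_sin_le_one hθ hθ'
  have hv := (eucl_skew_e3_le a).trans ha
  have hdiff : velRemainder R a θ - velRemainder R a θ' = Rᵀ *ᵥ
      (((Real.cos θ - 1 + θ * Real.sin θ) - (Real.cos θ' - 1 + θ' * Real.sin θ'))
          • (skew e3 *ᵥ (skew a *ᵥ e3))
        + ((Real.sin θ - θ * Real.cos θ) - (Real.sin θ' - θ' * Real.cos θ'))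
          • (skew a *ᵥ e3)) := by
    rw [velRemainder, velRemainder, ← Matrix.mulVec_sub]
    congr 1
    module
  have hr : 0 ≤ r * |θ - θ'| := mul_nonneg ((abs_nonneg _).trans hθ) (abs_nonneg _)
  rw [hdiff, eucl_rot_mulVec (transpose_mem_specialOrthogonalGroup hR)]
  refine (eucl_add_le _ _).trans ?_
  rw [eucl_smul, eucl_smul]
  linarith [mul_le_mul hcos ((eucl_skew_e3_mulVec_le _).trans hv) (eucl_nonneg _) hr,
    mul_le_mul hsin hv (eucl_nonneg _) hr]

variable {aT : ℝ → V3} {R : ℝ → M3}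

theorem eucl_exactRemainder_sub_le (t : ℝ) (x x' : V7) :
    eucl (exactRemainder aT R t x - exactRemainder aT R t x')
      ≤ eucl (velRemainder (R t) (aT t) (yawErr x) - velRemainder (R t) (aT t) (yawErr x')) := by
  have hdiff : exactRemainder aT R t x - exactRemainder aT R t x' = Sum.elim
      (Sum.elim (0 : V3) (velRemainder (R t) (aT t) (yawErr x)
        - velRemainder (R t) (aT t) (yawErr x'))) (0 : Fin 1 → ℝ) := by
    ext i
    rcases i with (i | i) | i <;> simp [exactRemainder]
  rw [hdiff]
  refine (eucl_sumElim_le _ _).trans ?_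
  rw [eucl_zero, add_zero]
  exact (eucl_sumElim_le _ _).trans_eq (by rw [eucl_zero, zero_add])

theorem exactRemainder_zero (t : ℝ) : exactRemainder aT R t 0 = 0 := by
  have hyaw : yawErr 0 = 0 := rfl
  ext i
  rcases i with (i | i) | i <;> simp [exactRemainder, velRemainder, hyaw]

theorem continuousOn_exactRemainder (haT : ContinuousOn aT (Set.Ici 0))
    (hR : ContinuousOn R (Set.Ici 0)) :
    ContinuousOn (fun q : ℝ × V7 => exactRemainder aT R q.1 q.2) (Set.Ici 0 ×ˢ Set.univ) := by
  have hfst : Set.MapsTo (Prod.fst : ℝ × V7 → ℝ) (Set.Ici 0 ×ˢ Set.univ) (Set.Ici 0) :=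
    fun q hq => hq.1
  have hθ : Continuous fun q : ℝ × V7 => yawErr q.2 := continuous_yawErr.comp continuous_snd
  have hcos : Continuous fun q : ℝ × V7 =>
      Real.cos (yawErr q.2) - 1 + yawErr q.2 * Real.sin (yawErr q.2) := by fun_prop
  have hsin : Continuous fun q : ℝ × V7 =>
      Real.sin (yawErr q.2) - yawErr q.2 * Real.cos (yawErr q.2) := by fun_prop
  have hcol : ContinuousOn (fun q : ℝ × V7 => skew (aT q.1) *ᵥ e3) (Set.Ici 0 ×ˢ Set.univ) :=
    continuousOn_mulVec (continuousOn_skew (haT.comp continuousOn_fst hfst)) continuousOn_const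
  have hvel : ContinuousOn (fun q : ℝ × V7 => velRemainder (R q.1) (aT q.1) (yawErr q.2))
      (Set.Ici 0 ×ˢ Set.univ) :=
    continuousOn_mulVec (continuousOn_transpose (hR.comp continuousOn_fst hfst))
      ((hcos.continuousOn.smul (continuousOn_mulVec continuousOn_const hcol)).add
        (hsin.continuousOn.smul hcol))
  refine continuousOn_pi.2 fun i => ?_
  rcases i with (_ | i) | _
  · exact continuousOn_const
  · exact continuousOn_pi.1 hvel i
  · exact continuousOn_const

theorem isQuadraticRemainder_exactRemainder {c : ℝ} (haT : ContinuousOn aT (Set.Ici 0))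
    (haTc : ∀ t, 0 ≤ t → eucl (aT t) ≤ c) (hR : ContinuousOn R (Set.Ici 0))
    (hRmem : ∀ t, 0 ≤ t → R t ∈ Matrix.specialOrthogonalGroup (Fin 3) ℝ) :
    IsQuadraticRemainder (exactRemainder aT R) where
  cont := continuousOn_exactRemainder haT hR
  lip T r := by
    have hc : 0 ≤ c := (eucl_nonneg _).trans (haTc 0 le_rfl)
    refine ⟨2 * c * |r|, fun t ht _ x x' hx hx' => (eucl_exactRemainder_sub_le t x x').trans ?_⟩
    exact (eucl_velRemainder_sub_le (hRmem t ht) (haTc t ht)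
      ((abs_yawErr_le x).trans (hx.trans (le_abs_self r)))
      ((abs_yawErr_le x').trans (hx'.trans (le_abs_self r)))).trans
      (mul_le_mul_of_nonneg_left (abs_yawErr_le (x - x')) (by positivity))
  quad := by
    refine ⟨1, 2 * c, one_pos, fun t ht x _ => ?_⟩
    have hyaw : yawErr 0 = 0 := rfl
    have hle := (eucl_exactRemainder_sub_le (aT := aT) (R := R) t x 0).trans
      (eucl_velRemainder_sub_le (hRmem t ht) (haTc t ht) le_rfl (by simp [hyaw]))
    rwa [exactRemainder_zero, sub_zero, hyaw, sub_zero, mul_assoc, ← sq] at hle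

end ExactRemainder

/-! ### The observer -/

section Observer

/-- The error system of the observer, with remainder `ρ`, as an `ErrorSystem`: the linear part is
`A_θ` at the attitude estimate for the current yaw error, and the information rate is
`C_θᵀ D C_θ`. -/
noncomputable def observerSystem (ω a : ℝ → V3) (R : ℝ → M3) (y : ℝ → V3) (S : ℝ → M7) (D : ℝ → M3)
    (ρ : ℝ → V7 → V7) : ErrorSystem Idx7 where
  A t x := Atheta (ω t) (attEst (R t) x) (a t)
  G t := (Ctheta (y t))ᵀ * D t * Ctheta (y t)
  S := S
  ρ := ρ

variable (ω a : ℝ → V3) (R : ℝ → M3) (y : ℝ → V3) (S : ℝ → M7) (D : ℝ → M3) (ρ : ℝ → V7 → V7)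

theorem errorRhs_observerSystem :
    (observerSystem ω a R y S D ρ).errorRhs = errField ω a R y D ρ := by
  funext t x P
  simp only [ErrorSystem.errorRhs, observerSystem, errField, innovation, Matrix.mulVec_mulVec,
    Matrix.mul_assoc]

theorem riccatiRhs_observerSystem :
    (observerSystem ω a R y S D ρ).riccatiRhs = riccatiField ω a R y S D := by
  funext t x P
  simp only [ErrorSystem.riccatiRhs, observerSystem, riccatiField, Matrix.mul_assoc]

variable {ω a : ℝ → V3} {R : ℝ → M3} {y : ℝ → V3} {S : ℝ → M7} {D : ℝ → M3} {ρ : ℝ → V7 → V7}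

open scoped Matrix.Norms.L2Operator

theorem norm_Ctheta_transpose_mul_mul_Ctheta_le {y : V3} (hy : eucl y = 1) {D : M3} {d : ℝ}
    (hD : ‖D‖ ≤ d) : ‖(Ctheta y)ᵀ * D * Ctheta y‖ ≤ d := by
  have hC := norm_Ctheta_le hy
  have hd := (norm_nonneg D).trans hD
  calc _ ≤ ‖(Ctheta y)ᵀ‖ * ‖D‖ * ‖Ctheta y‖ :=
        (Matrix.l2_opNorm_mul _ _).trans
          (mul_le_mul_of_nonneg_right (Matrix.l2_opNorm_mul _ _) (norm_nonneg _))
    _ ≤ 1 * d * 1 := by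
        rw [norm_transpose]
        gcongr
    _ = d := by ring

theorem isRegular_observerSystem {cω ca : ℝ} (hω : ContinuousOn ω (Set.Ici 0))
    (hωc : ∀ t, 0 ≤ t → eucl (ω t) ≤ cω) (ha : ContinuousOn a (Set.Ici 0))
    (hac : ∀ t, 0 ≤ t → eucl (a t) ≤ ca) (hR : ContinuousOn R (Set.Ici 0))
    (hRmem : ∀ t, 0 ≤ t → R t ∈ Matrix.specialOrthogonalGroup (Fin 3) ℝ)
    (hy : ContinuousOn y (Set.Ici 0)) (hy1 : ∀ t, 0 ≤ t → eucl (y t) = 1) (hS : IsWeight S)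
    (hD : IsWeight D) (hρ : IsQuadraticRemainder ρ) : (observerSystem ω a R y S D ρ).IsRegular := by
  obtain ⟨hDc, d₁, d₂, hd₁, hd₂, hDd⟩ := hD
  have hDpos : ∀ t, 0 ≤ t → (D t).PosSemidef := fun t ht =>
    posSemidef_of_succeq_smul_one hd₁.le (hDd t ht).1
  have hC := continuousOn_Ctheta hy
  have hIcc : ∀ T, Set.Icc 0 T ⊆ Set.Ici (0 : ℝ) := fun _ => Set.Icc_subset_Ici_self
  exact {
    continuousOn_A :=
      have hfst : Set.MapsTo Prod.fst (Set.Ici (0 : ℝ) ×ˢ (Set.univ : Set V7)) (Set.Ici 0) :=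
        fun _ hq => hq.1
      continuousOn_Atheta (hω.comp continuousOn_fst hfst)
        (continuousOn_attEst (hR.comp continuousOn_fst hfst) continuousOn_snd)
        (ha.comp continuousOn_fst hfst)
    norm_A_le := ⟨2 * cω + 1 + ca, fun t ht x =>
      norm_Atheta_le (attEst_mem_specialOrthogonalGroup (hRmem t ht) x) (hωc t ht) (hac t ht)⟩
    unifLip_A := fun T r => unifLip_Atheta_attEst (hω.mono (hIcc T)) (hR.mono (hIcc T))
      (ha.mono (hIcc T)) Metric.isBounded_closedBall
    continuousOn_G := continuousOn_matrix_mul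
      (continuousOn_matrix_mul (continuousOn_transpose hC) hDc) hC
    posSemidef_G := fun t ht => posSemidef_transpose_mul_mul (hDpos t ht) _
    norm_G_le := ⟨d₂, fun t ht => norm_Ctheta_transpose_mul_mul_Ctheta_le (hy1 t ht)
      (norm_le_of_succeq hd₂ (hDpos t ht) (hDd t ht).2)⟩
    isWeight_S := hS
    continuousOn_ρ := hρ.continuousOn
    unifLip_ρ := hρ.unifLip
    eucl_ρ_le := fun _ hc => hρ.exists_eucl_le_mul hc }

end Observer

section Main

variable {g δ μ c₀ ca cω : ℝ} {QB QT : ℝ → M3} {pB vB ωB aB pT vT ωT aT : ℝ → V3} {b₀ : V3}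

theorem half_sq_le_dotProduct_bVec {b₁ : ℝ → V3} (hB : IsRigidMotion g QB pB vB ωB aB)
    (hT : IsRigidMotion g QT pT vT ωT aT) (hsep : ∀ t, 0 ≤ t → pB t ≠ pT t) (hδ : 0 < δ)
    (hμ : 0 < μ) (hPE : BearingPE (bearingI QB pB pT) δ μ) {t : ℝ} (ht : 0 ≤ t)
    (hb : bVec QT aT t = b₀ + b₁ t)
    (hb₁ : (1 / δ) * ∫ s in t..(t + δ), eucl (proj (bearingI QB pB pT s) *ᵥ b₁ t) ^ 2
      ≤ μ / 4 * eucl b₀ ^ 2) :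
    eucl b₀ ^ 2 / 2 ≤ b₀ ⬝ᵥ bVec QT aT t := by
  have hexcited := hPE.mul_eucl_sq_le_integral hδ (continuousOn_bearingI hB hT hsep)
    (fun s hs => eucl_bearingI hB hsep hs) ht (b₁ t)
  rw [one_div, ← div_eq_inv_mul, div_le_iff₀ hδ] at hb₁
  have hsq : eucl (b₁ t) ^ 2 ≤ (eucl b₀ / 2) ^ 2 :=
    le_of_mul_le_mul_left (by linarith) (mul_pos hδ hμ)
  have hhalf := (abs_le_of_sq_le_sq' hsq (div_nonneg (eucl_nonneg b₀) zero_le_two)).2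
  have hdot := neg_le_of_abs_le (abs_dotProduct_le_eucl_mul_eucl b₀ (b₁ t))
  rw [hb, dotProduct_add, ← eucl_sq]
  linarith [mul_le_mul_of_nonneg_left hhalf (eucl_nonneg b₀)]

theorem exists_uniformlyObservableWith (hB : IsRigidMotion g QB pB vB ωB aB)
    (hT : IsRigidMotion g QT pT vT ωT aT) (hsep : ∀ t, 0 ≤ t → pB t ≠ pT t)
    (hωB : ContinuousOn ωB (Set.Ici 0)) (hδ : 0 < δ) (hμ : 0 < μ)
    (hPE : BearingPE (bearingI QB pB pT) δ μ) (haT : ContinuousOn aT (Set.Ici 0))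
    (haTc : ∀ t, 0 ≤ t → eucl (aT t) ≤ ca) (hc₀ : 0 < c₀)
    (hb : ∀ t, 0 ≤ t → c₀ ≤ b₀ ⬝ᵥ bVec QT aT t) :
    ∃ ε δ' μ' : ℝ, 0 < ε ∧ ∀ Rhat : ℝ → M3, ContinuousOn Rhat (Set.Ici 0) →
      (∀ t, 0 ≤ t → Rhat t ∈ Matrix.specialOrthogonalGroup (Fin 3) ℝ) →
      (∀ t, 0 ≤ t → ∀ i j, |Rhat t i j - relAtt QB QT t i j| ≤ ε) →
      UniformlyObservableWith (fun t => Atheta (ωB t) (Rhat t) (aT t))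
        (fun t => Ctheta (bearing QB pB pT t)) δ' μ' := by
  obtain ⟨ε, δ', μ', hε, hδ', hμ', hobs⟩ :=
    exists_isTransitionMatrix_succeq_gramian hB hT hsep hωB hδ hμ hPE haT haTc hc₀ hb
  refine ⟨ε / 9, δ', μ', by positivity, fun Rhat hRc hR hRε => ?_⟩
  obtain ⟨Φ, hΦ, hgram⟩ := hobs Rhat hRc hR fun t ht =>
    (norm_le_card_mul_card_mul (by positivity) (hRε t ht)).trans_eq
      (by rw [Fintype.card_fin]; push_cast; ring)
  refine ⟨hδ', hμ', Φ, hΦ, fun t ht => ?_⟩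
  have hunit := hgram (fun _ => 1) 1 continuousOn_const zero_le_one
    (fun _ _ => by simpa [Succeq] using Matrix.PosSemidef.zero) t ht
  simp only [Matrix.mul_one, one_mul, Matrix.mul_assoc] at hunit
  have hscaled := hunit.smul (inv_nonneg.2 hδ'.le)
  rw [smul_sub, smul_smul, inv_mul_cancel_left₀ hδ'.ne'] at hscaled
  simpa only [Succeq, gramian, one_div, Matrix.mul_assoc] using hscaled

theorem uniformlyObservable_observerSystem {S : ℝ → M7} {D : ℝ → M3} {ρ : ℝ → V7 → V7}
    (hB : IsRigidMotion g QB pB vB ωB aB) (hT : IsRigidMotion g QT pT vT ωT aT)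
    (hsep : ∀ t, 0 ≤ t → pB t ≠ pT t) (hωB : ContinuousOn ωB (Set.Ici 0)) (hD : IsWeight D)
    (hδ : 0 < δ) (hμ : 0 < μ) (hPE : BearingPE (bearingI QB pB pT) δ μ)
    (haT : ContinuousOn aT (Set.Ici 0)) (haTc : ∀ t, 0 ≤ t → eucl (aT t) ≤ ca) (hc₀ : 0 < c₀)
    (hb : ∀ t, 0 ≤ t → c₀ ≤ b₀ ⬝ᵥ bVec QT aT t) :
    (observerSystem ωB aT (relAtt QB QT) (bearing QB pB pT) S D ρ).UniformlyObservable := by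
  obtain ⟨hDc, d, _, hd, _, hDd⟩ := hD
  obtain ⟨ε, δ', μ', hε, hδ', hμ', hobs⟩ :=
    exists_isTransitionMatrix_succeq_gramian hB hT hsep hωB hδ hμ hPE haT haTc hc₀ hb
  refine ⟨ε / 2, δ', d * (δ' * μ'), by positivity, hδ', by positivity, fun x hx hxε => ?_⟩
  obtain ⟨Φ, hΦ, hgram⟩ := hobs (fun t => attEst (relAtt QB QT t) (x t))
    (continuousOn_attEst (continuousOn_relAtt hB hT) hx.continuousOn)
    (fun t ht => attEst_mem_specialOrthogonalGroup (relAtt_mem_specialOrthogonalGroup hB hT ht) _)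
    fun t ht => by
      have hclose := norm_attEst_sub_le (relAtt_mem_specialOrthogonalGroup hB hT ht) (x t)
      linarith [abs_yawErr_le (x t), hxε t]
  exact ⟨Φ, hΦ, hgram D d hDc hd.le fun t ht => (hDd t ht).1⟩

theorem lemma3_general (hB : IsRigidMotion g QB pB vB ωB aB)
    (hT : IsRigidMotion g QT pT vT ωT aT) (hsep : ∀ t, 0 ≤ t → pB t ≠ pT t)
    (hωB : ContinuousOn ωB (Set.Ici 0)) (hωBc : ∀ t, 0 ≤ t → eucl (ωB t) ≤ cω)
    {S : ℝ → M7} {D : ℝ → M3} (hS : IsWeight S) (hD : IsWeight D) (hδ : 0 < δ) (hμ : 0 < μ)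
    (hPE : BearingPE (bearingI QB pB pT) δ μ) (haT : ContinuousOn aT (Set.Ici 0))
    (haTc : ∀ t, 0 ≤ t → eucl (aT t) ≤ ca) (hc₀ : 0 < c₀)
    (hb : ∀ t, 0 ≤ t → c₀ ≤ b₀ ⬝ᵥ bVec QT aT t) :
    (∃ ε δ' μ' : ℝ, 0 < ε ∧ ∀ Rhat : ℝ → M3, ContinuousOn Rhat (Set.Ici 0) →
      (∀ t, 0 ≤ t → Rhat t ∈ Matrix.specialOrthogonalGroup (Fin 3) ℝ) →
      (∀ t, 0 ≤ t → ∀ i j, |Rhat t i j - relAtt QB QT t i j| ≤ ε) →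
      UniformlyObservableWith (fun t => Atheta (ωB t) (Rhat t) (aT t))
        (fun t => Ctheta (bearing QB pB pT t)) δ' μ') ∧
    (∀ ρ : ℝ → V7 → V7, IsQuadraticRemainder ρ →
      LocallyExpStable (errField ωB aT (relAtt QB QT) (bearing QB pB pT) D ρ)
        (riccatiField ωB aT (relAtt QB QT) (bearing QB pB pT) S D)) ∧
    LocallyExpStable (exactErrField ωB aT (relAtt QB QT) (bearing QB pB pT) D)
      (riccatiField ωB aT (relAtt QB QT) (bearing QB pB pT) S D) := by
  have hR := continuousOn_relAtt hB hT
  have hRmem : ∀ t, 0 ≤ t → relAtt QB QT t ∈ Matrix.specialOrthogonalGroup (Fin 3) ℝ := fun t ht =>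
    relAtt_mem_specialOrthogonalGroup hB hT ht
  have hstable : ∀ ρ : ℝ → V7 → V7, IsQuadraticRemainder ρ →
      LocallyExpStable (errField ωB aT (relAtt QB QT) (bearing QB pB pT) D ρ)
        (riccatiField ωB aT (relAtt QB QT) (bearing QB pB pT) S D) := fun ρ hρ => by
    have hreg := isRegular_observerSystem hωB hωBc haT haTc hR hRmem
      (continuousOn_bearing hB hT hsep) (fun t ht => eucl_bearing hB hsep ht) hS hD hρ
    have hobs := uniformlyObservable_observerSystem (S := S) (ρ := ρ) hB hT hsep hωB hD hδ hμ hPE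
      haT haTc hc₀ hb
    simpa only [errorRhs_observerSystem, riccatiRhs_observerSystem] using
      ErrorSystem.locallyExpStable hreg hobs
  refine ⟨exists_uniformlyObservableWith hB hT hsep hωB hδ hμ hPE haT haTc hc₀ hb, hstable, ?_⟩
  rw [exactErrField_eq_errField]
  exact hstable _ (isQuadraticRemainder_exactRemainder haT haTc hR hRmem)

end Main

theorem lemma3
    (g : ℝ)
    (QB QT : ℝ → M3) (pB vB ωB aB pT vT ωT aT : ℝ → V3)
    (hB : IsRigidMotion g QB pB vB ωB aB)
    (hT : IsRigidMotion g QT pT vT ωT aT)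
    (hsep : ∀ t, 0 ≤ t → pB t ≠ pT t)
    (hωB : BddUnifCont ωB) (hωT : BddUnifCont ωT)
    (S : ℝ → M7) (D : ℝ → M3) (hS : IsWeight S) (hD : IsWeight D)
    (δ μ : ℝ) (hδ : 0 < δ) (hμ : 0 < μ)
    (hPE : BearingPE (bearingI QB pB pT) δ μ)
    (haT : ContinuousOn aT (Set.Ici 0)) (haT' : ∃ c, ∀ t, 0 ≤ t → eucl (aT t) ≤ c)
    (b₀ : V3) (b₁ : ℝ → V3) (hb₀ : b₀ ≠ 0)
    (hb : ∀ t, 0 ≤ t → bVec QT aT t = b₀ + b₁ t)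
    (hb₁ : ∀ t, 0 ≤ t →
      (1 / δ) * ∫ s in t..(t + δ), eucl (proj (bearingI QB pB pT s) *ᵥ b₁ t) ^ 2
        ≤ μ / 4 * eucl b₀ ^ 2) :
    -- uniform observability, for attitude estimates in a uniform neighbourhood of the attitude
    (∃ ε δ' μ' : ℝ, 0 < ε ∧ ∀ Rhat : ℝ → M3,
      ContinuousOn Rhat (Set.Ici 0) →
      (∀ t, 0 ≤ t → Rhat t ∈ Matrix.specialOrthogonalGroup (Fin 3) ℝ) →
      (∀ t, 0 ≤ t → ∀ i j, |Rhat t i j - relAtt QB QT t i j| ≤ ε) →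
      UniformlyObservableWith (fun t => Atheta (ωB t) (Rhat t) (aT t))
        (fun t => Ctheta (bearing QB pB pT t)) δ' μ') ∧
    -- local exponential stability of the error system, for every remainder `O(|θ̃|²)`
    (∀ ρ : ℝ → V7 → V7, IsQuadraticRemainder ρ →
      LocallyExpStable
        (errField ωB aT (relAtt QB QT) (bearing QB pB pT) D ρ)
        (riccatiField ωB aT (relAtt QB QT) (bearing QB pB pT) S D)) ∧
    -- and in particular for the error dynamics before expansion in `θ̃`
    LocallyExpStable
      (exactErrField ωB aT (relAtt QB QT) (bearing QB pB pT) D)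
      (riccatiField ωB aT (relAtt QB QT) (bearing QB pB pT) S D) := by
  obtain ⟨_, hωBc⟩ := hωB.2
  obtain ⟨_, haTc⟩ := haT'
  exact lemma3_general hB hT hsep hωB.1.continuousOn hωBc hS hD hδ hμ hPE haT haTc
    (half_pos (pow_pos (eucl_pos hb₀) 2)) fun t ht =>
      half_sq_le_dotProduct_bVec hB hT hsep hδ hμ hPE ht (hb t ht) (hb₁ t ht)
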